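/- Let $m,r\ge 0$ be integers and $N=2m+r$. Let $K_{1,N}$ be the star graph with vertices $1,\dots,N+1$, in which vertex $1$ is joined to all other vertices, and let an angle $\theta_{\{1,i\}}\in(0,\pi/2)$ be given for every $i=2,\dots,N+1$; put $\tau_{\{1,i\}}=\cos\theta_{\{1,i\}}$. Assume that $\theta_{\{1,2k\}}=\theta_{\{1,2k+1\}}$ for $1\le k\le m$, and put $\tau_k=\tau_{\{1,2k\}}=\tau_{\{1,2k+1\}}$ for $1\le k\le m$ and $\tau_k=\tau_{\{1,k+m+1\}}$ for $m+1\le k\le m+r$. Consider systems $S=(H;H_1,\dots,H_{N+1})$ of closed subspaces of a complex Hilbert space $H$ (of any dimension), with orthogonal projections $P_i$ onto $H_i$, such that - (Ang) $P_1P_iP_1=\tau_{\{1,i\}}^2P_1$ and $P_iP_1P_i=\tau_{\{1,i\}}^2P_i$ for $i=2,\dots,N+1$; - (Com) $P_{2k}P_{2k+1}=P_{2k+1}P_{2k}$ for $1\le k\le m$; - (Ort) $P_iP_j=0$ for all distinct $i,j\ge 2$ such that $\{i,j\}$ is not one of the pairs $\{2k,2k+1\}$, $1\le k\le m$. A system is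 nonzero if some $H_i\ne0$; it is irreducible if every bounded operator on $H$ commuting with all $P_i$ is a scalar multiple of the identity. Systems $S$ and $S'$ are unitarily equivalent if some unitary $U:H\to H'$ satisfies $U(H_i)=H_i'$ for all $i$. A system has generalized dimension $(d;e)$ if $\dim H=d$ and $\dim H_i=e$ for all $i$. Put $$\xi=1-\sum_{k=1}^{m+r}\tau_k^2,\quad M_l=\{k\le m:\tau_k^2<\xi\},\quad M_e=\{k\le m:\tau_k^2=\xi\},\quad M_g=\{k\le m:\tau_k^2>\xi\}.$$ For $|M_l|=2$, $M_l=\{k_1<k_2\}$, the system corresponding to an angle $\varphi$ is the system, unique up to unitary equivalence, for which there are isometries $V_i$ of $\mathbb C^2$ onto $H_i$ ($1\le i\le N+1$), with $\sum_iH_i$ dense in $H$, such that $V_1^*V_i=\tau_{\{1,i\}}I$ for $i\ge2$, $V_{2k}^*V_{2k+1}=I-R_k$ for $1\le k\le m$, and $V_i^*V_j=0$ for all other pairs of distinct $i,j\ge 2$; here $$R_{k_1}=\begin{pmatrix}1&0\\0&0\end{pmatrix},\quad R_{k_2}=\begin{pmatrix}\cos^2\varphi&\cos\varphi\sin\varphi\\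 \cos\varphi\sin\varphi&\sin^2\varphi\end{pmatrix},\quad R_k=0\ \ (k\ne k_1,k_2).$$ Put also $\varphi(\tau)=\arccos\Big(\prod_{k\in M_l}\frac{\xi-\tau_k^2}{\tau_k^2}\Big)^{1/2}$. **Theorem.** If $\xi<0$, there is no nonzero system satisfying (Ang), (Com), (Ort). If $\xi=0$, there is, up to unitary equivalence, exactly one nonzero irreducible system satisfying (Ang), (Com), (Ort); its generalized dimension is $(m+r;1)$. If $\xi>0$, all nonzero irreducible systems satisfying (Ang), (Com), (Ort), up to unitary equivalence and without repetitions, are the following. 1. $M_l=\varnothing$: $|M_e|+1$ systems of generalized dimension $(m+r+1;1)$. 2. $|M_l|=1$: $|M_e|+1$ systems of generalized dimension $(m+r+1;1)$ and one of generalized dimension $(m+r+2;1)$. 3. $|M_l|=2$ and $\sum_{k\in M_l}\tau_k^2>\xi$: $|M_e|+1$ systems of generalized dimension $(m+r+1;1)$; two of generalized dimension $(m+r+2;1)$; an infinite family of systems of generalized dimension $(2m+2r+4;2)$, one corresponding to each angle $\varphi\in(\varphi(\tau),\pi/2)$, where $\varphi(\tau)\in(0,\pi/2)$; and one system of generalized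 dimension $(2m+2r+3;2)$, corresponding to $\varphi=\varphi(\tau)$. 4. $|M_l|=2$ and $\sum_{k\in M_l}\tau_k^2=\xi$: $|M_e|+1$ systems of generalized dimension $(m+r+1;1)$; three of generalized dimension $(m+r+2;1)$; and an infinite family of systems of generalized dimension $(2m+2r+4;2)$, one corresponding to each angle $\varphi\in(0,\pi/2)$. 5. $|M_l|=2$ and $\sum_{k\in M_l}\tau_k^2<\xi$: $|M_e|+1$ systems of generalized dimension $(m+r+1;1)$; two of generalized dimension $(m+r+2;1)$; one of generalized dimension $(m+r+3;1)$; and an infinite family of systems of generalized dimension $(2m+2r+4;2)$, one corresponding to each angle $\varphi\in(0,\pi/2)$. If $|M_l|\ge3$, the problem of describing the systems satisfying (Ang), (Com), (Ort) up to unitary equivalence is $*$-wild, that is, it majorizes the problem of describing pairs of bounded self-adjoint operators: for some $n\ge1$ there is a full and faithful functor (morphisms on both sides being the bounded intertwining operators) from the pairs $(A,B)$ of bounded self-adjoint operators on complex Hilbert spaces $K$ to these systems, which sends a pair $(A,B)$ on $K$ to a system in $K^n$ whose projections are $n\times n$ matrices with entries in the unital $C^*$-algebra generated by $A$ and $B$,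 and sends a morphism $C:K\to K'$ to $\mathrm{diag}(C,\dots,C):K^n\to K'^n$. -/

import Mathlib

open scoped InnerProductSpace

universe u v

/-- A system `(H; H_i, i ∈ ι)` of (closed) subspaces of a Hilbert space `H`. -/
structure SubspaceSystem (ι : Type) (H : Type u) [NormedAddCommGroup H] [InnerProductSpace ℂ H] where
  space : ι → Submodule ℂ H
  isClosed : ∀ i, IsClosed (space i : Set H)

namespace SubspaceSystem

variable {ι : Type} {H : Type u} [NormedAddCommGroup H] [InnerProductSpace ℂ H]
  {H' : Type v} [NormedAddCommGroup H'] [InnerProductSpace ℂ H']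

/-- The orthogonal projection `P_i` of `H` onto `H_i`. -/
noncomputable def proj [CompleteSpace H] (S : SubspaceSystem ι H) (i : ι) : H →L[ℂ] H :=
  haveI : CompleteSpace (S.space i) := (S.isClosed i).completeSpace_coe
  (S.space i).starProjection

/-- The system is nonzero if some `H_i` is not `0`. -/
def IsNonzero (S : SubspaceSystem ι H) : Prop := ∃ i, S.space i ≠ ⊥

/-- Irreducibility: only scalars commute with all the projections `P_i`. -/
def IsIrreducible [CompleteSpace H] (S : SubspaceSystem ι H) : Prop :=
  ∀ A : H →L[ℂ] H, (∀ i, A ∘L S.proj i = S.proj i ∘L A) →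
    ∃ c : ℂ, A = c • ContinuousLinearMap.id ℂ H

/-- Unitary equivalence: a unitary `U : H → H'` with `U (H_i) = H'_i` for all `i`. -/
def UnitarilyEquivalent (S : SubspaceSystem ι H) (S' : SubspaceSystem ι H') : Prop :=
  ∃ U : H ≃ₗᵢ[ℂ] H', ∀ i, (S.space i).map (U.toLinearEquiv : H →ₗ[ℂ] H') = S'.space i

/-- Generalized dimension `(d; e)`: `dim H = d`, and `dim H_i = e` for all `i`. -/
def HasGenDim (S : SubspaceSystem ι H) (d : ℕ × ℕ) : Prop :=
  Module.rank ℂ H = (d.1 : Cardinal) ∧ ∀ i, Module.rank ℂ (S.space i) = (d.2 : Cardinal)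

/-- `S` is (up to unitary equivalence) the system with Gram operator `B = (B i j)` acting in the
direct sum of copies of `H₀` indexed by `ι`: there are isometries `V_i` of `H₀` onto `H_i` such
that `V_i^* V_j = B i j`, and the sum of the `H_i` is dense in `H`. -/
def HasGram {H₀ : Type v} [NormedAddCommGroup H₀] [InnerProductSpace ℂ H₀]
    (S : SubspaceSystem ι H) (B : ι → ι → H₀ →L[ℂ] H₀) : Prop :=
  ∃ V : ι → H₀ →ₗᵢ[ℂ] H,
    (∀ i, LinearMap.range (V i).toLinearMap = S.space i) ∧
    (∀ i j x y, ⟪V i x, V j y⟫_ℂ = ⟪x, B i j y⟫_ℂ) ∧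
    (⨆ i, S.space i).topologicalClosure = ⊤

end SubspaceSystem

/-- The end vertices of the star `K_{1,N}`, `N = 2m + r`: the pairs `fst k`, `snd k`
(vertices `2k`, `2k+1`, joined by a dotted line) and the remaining `r` vertices. -/
inductive Ray (m r : ℕ) : Type
  | fst (k : Fin m) : Ray m r
  | snd (k : Fin m) : Ray m r
  | leaf (j : Fin r) : Ray m r

/-- The vertices of `K_{1,N}`: `none` is the centre (vertex `1`), joined by an edge to every
`some i`. -/
abbrev StarVertex (m r : ℕ) : Type := Option (Ray m r)

/-- `{i, j}` is one of the dotted pairs `{2k, 2k+1}`. -/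
def IsDottedPair {m r : ℕ} (i j : Ray m r) : Prop :=
  ∃ k : Fin m, (i = .fst k ∧ j = .snd k) ∨ (i = .snd k ∧ j = .fst k)

/-- The conditions (Ang), (Com), (Ort); `θ i` is the angle assigned to the edge from the centre
to the end vertex `i`. -/
structure AngComOrt {m r : ℕ} (θ : Ray m r → ℝ) (H : Type u) [NormedAddCommGroup H]
    [InnerProductSpace ℂ H] [CompleteSpace H] (S : SubspaceSystem (StarVertex m r) H) : Prop where
  ang_center : ∀ i, S.proj none ∘L S.proj (some i) ∘L S.proj none
    = ((Real.cos (θ i) ^ 2 : ℝ) : ℂ) • S.proj none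
  ang_ray : ∀ i, S.proj (some i) ∘L S.proj none ∘L S.proj (some i)
    = ((Real.cos (θ i) ^ 2 : ℝ) : ℂ) • S.proj (some i)
  com : ∀ k, S.proj (some (.fst k)) ∘L S.proj (some (.snd k))
    = S.proj (some (.snd k)) ∘L S.proj (some (.fst k))
  ort : ∀ i j : Ray m r, i ≠ j → ¬ IsDottedPair i j → S.proj (some i) ∘L S.proj (some j) = 0

section Classification

variable {m r : ℕ} (θ : Ray m r → ℝ)

/-- The squares `τ_k²` for `1 ≤ k ≤ m`. -/
noncomputable def tauSq (k : Fin m) : ℝ := Real.cos (θ (.fst k)) ^ 2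

/-- `ξ(τ) = 1 - ∑_{k=1}^{m+r} τ_k²`. -/
noncomputable def xi : ℝ := 1 - ∑ k, tauSq θ k - ∑ j : Fin r, Real.cos (θ (.leaf j)) ^ 2

open Classical in
/-- `M_l = {k ≤ m | τ_k² < ξ(τ)}`. -/
noncomputable def Ml : Finset (Fin m) := {k | tauSq θ k < xi θ}

open Classical in
/-- `M_e = {k ≤ m | τ_k² = ξ(τ)}`. -/
noncomputable def Me : Finset (Fin m) := {k | tauSq θ k = xi θ}

/-- `φ(τ) = arccos √η(τ)`, `η(τ) = ∏_{k ∈ M_l} (ξ(τ) - τ_k²) / τ_k²` (used for `|M_l| = 2`). -/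
noncomputable def phi : ℝ :=
  Real.arccos (Real.sqrt (∏ k ∈ Ml θ, (xi θ - tauSq θ k) / tauSq θ k))

open Classical in
/-- The block operator `B(Q_1, …, Q_m)`: identities on the diagonal, `τ_i I` between the centre
and the end vertex `i`, `Q_k` between the two vertices of the `k`-th pair, and zeros elsewhere. -/
noncomputable def gramB {H₀ : Type v} [NormedAddCommGroup H₀] [InnerProductSpace ℂ H₀]
    (Q : Fin m → H₀ →L[ℂ] H₀) : StarVertex m r → StarVertex m r → H₀ →L[ℂ] H₀
  | none, none => ContinuousLinearMap.id ℂ H₀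
  | none, some i => (Real.cos (θ i) : ℂ) • ContinuousLinearMap.id ℂ H₀
  | some i, none => (Real.cos (θ i) : ℂ) • ContinuousLinearMap.id ℂ H₀
  | some (.fst k), some (.snd l) => if k = l then Q k else 0
  | some (.snd k), some (.fst l) => if k = l then Q k else 0
  | some i, some j => if i = j then ContinuousLinearMap.id ℂ H₀ else 0

/-- The `2 × 2` matrices of the pair of one-dimensional projections `R_1`, `R_2` at angle `φ`. -/
def matR₁ : Matrix (Fin 2) (Fin 2) ℂ := !![1, 0; 0, 0]

noncomputable def matR₂ (φ : ℝ) : Matrix (Fin 2) (Fin 2) ℂ :=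
  !![(Real.cos φ : ℂ) ^ 2, (Real.cos φ : ℂ) * (Real.sin φ : ℂ);
     (Real.cos φ : ℂ) * (Real.sin φ : ℂ), (Real.sin φ : ℂ) ^ 2]

/-- The projections `Q_k = I - R_k` in `ℂ²`, where `R_{k₁}`, `R_{k₂}` are the two projections at
angle `φ` and `R_k = 0` for all other `k`. -/
noncomputable def pairQ (k₁ k₂ : Fin m) (φ : ℝ) (k : Fin m) :
    EuclideanSpace ℂ (Fin 2) →L[ℂ] EuclideanSpace ℂ (Fin 2) :=
  Matrix.toEuclideanCLM (𝕜 := ℂ)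
    (if k = k₁ then 1 - matR₁ else if k = k₂ then 1 - matR₂ φ else 1)

/-- The system corresponding to the angle `φ` (for `M_l = {k₁ < k₂}`). -/
def CorrespondsToAngle {H : Type u} [NormedAddCommGroup H] [InnerProductSpace ℂ H]
    (S : SubspaceSystem (StarVertex m r) H) (φ : ℝ) : Prop :=
  ∀ k₁ k₂ : Fin m, k₁ < k₂ → Ml θ = {k₁, k₂} → S.HasGram (gramB θ (pairQ k₁ k₂ φ))

/-- `model` is a complete irredundant list, up to unitary equivalence, of the nonzero irreducible
systems with (Ang), (Com), (Ort); the model with index `i` has generalized dimension `dim i`. -/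
structure IsClassification {I : Type} (dim : I → ℕ × ℕ)
    (model : ∀ i, SubspaceSystem (StarVertex m r) (EuclideanSpace ℂ (Fin (dim i).1))) : Prop where
  angComOrt : ∀ i, AngComOrt θ _ (model i)
  isNonzero : ∀ i, (model i).IsNonzero
  isIrreducible : ∀ i, (model i).IsIrreducible
  hasGenDim : ∀ i, (model i).HasGenDim (dim i)
  irredundant : ∀ i j, (model i).UnitarilyEquivalent (model j) → i = j
  complete : ∀ (H : Type u) [NormedAddCommGroup H] [InnerProductSpace ℂ H] [CompleteSpace H]
    (S : SubspaceSystem (StarVertex m r) H),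
    AngComOrt θ H S → S.IsNonzero → S.IsIrreducible → ∃ i, S.UnitarilyEquivalent (model i)

end Classification

/-- A pair of bounded self-adjoint operators in a Hilbert space `K`. -/
structure SelfAdjointPair (K : Type u) [NormedAddCommGroup K] [InnerProductSpace ℂ K]
    [CompleteSpace K] where
  A : K →L[ℂ] K
  B : K →L[ℂ] K
  isSelfAdjoint_A : IsSelfAdjoint A
  isSelfAdjoint_B : IsSelfAdjoint B

/-- The problem of describing the systems of a class `𝒞` up to unitary equivalence is `*`-wild: it
majorizes the problem of describing pairs `X = (A, B)` of bounded self-adjoint operators. That is,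
for some `n ≥ 1` there is a full and faithful functor from pairs to systems in `𝒞` (morphisms are
the bounded intertwining operators in both cases) which sends a pair `X` in `K` to a system in
`K^n` whose projections are `n × n` matrices over the C*-algebra generated by `A`, `B` and `1`, and
sends a morphism `C : K → K'` to `diag(C, …, C) : K^n → K'^n`. -/
def IsStarWild {ι : Type}
    (𝒞 : ∀ (H : Type u) [NormedAddCommGroup H] [InnerProductSpace ℂ H] [CompleteSpace H],
      SubspaceSystem ι H → Prop) : Prop :=
  ∃ n : ℕ, 0 < n ∧
  ∃ F : ∀ (K : Type u) [NormedAddCommGroup K] [InnerProductSpace ℂ K] [CompleteSpace K],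
      SelfAdjointPair K → SubspaceSystem ι (PiLp 2 fun _ : Fin n => K),
    (∀ (K : Type u) [NormedAddCommGroup K] [InnerProductSpace ℂ K] [CompleteSpace K]
      (X : SelfAdjointPair K),
      𝒞 _ (F K X) ∧
      ∀ i, ∃ p : Matrix (Fin n) (Fin n) (K →L[ℂ] K),
        (∀ a b, p a b ∈
          (StarAlgebra.adjoin ℂ ({X.A, X.B} : Set (K →L[ℂ] K))).topologicalClosure) ∧
        ∀ x a, (F K X).proj i x a = ∑ b, p a b (x b)) ∧
    (∀ (K K' : Type u) [NormedAddCommGroup K] [InnerProductSpace ℂ K] [CompleteSpace K]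
      [NormedAddCommGroup K'] [InnerProductSpace ℂ K'] [CompleteSpace K']
      (X : SelfAdjointPair K) (X' : SelfAdjointPair K')
      (D : (PiLp 2 fun _ : Fin n => K) →L[ℂ] (PiLp 2 fun _ : Fin n => K')),
      (∀ i, D ∘L (F K X).proj i = (F K' X').proj i ∘L D) ↔
        ∃ C : K →L[ℂ] K', C ∘L X.A = X'.A ∘L C ∧ C ∘L X.B = X'.B ∘L C ∧
          ∀ x a, D x a = C (x a))

/-! By (Ang), P_i divided by τ_i maps the central subspace H₀ = H_1 isometrically onto H_i. So a
system is a family of isometries V_i of one Hilbert space H₀ into H, and on the closed span of its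
subspaces it is determined by the Gram operators V_i^*V_j. All of these are fixed by (Ang) and
(Ort), except Q_k = V_{2k}^*V_{2k+1}, and (Com) amounts to Q_k being an orthogonal projection
(`AngComOrt.exists_isGramFamily`, `IsGramFamily.angComOrt`). Put R_k = 1 - Q_k. Eliminating the end
vertices from the Gram operator leaves the Schur complement D = ξ - ∑ τ_k² R_k, called `defect`. It
is nonnegative for every system (`IsGramFamily.re_inner_defect_nonneg`); conversely, a factorization
D = T^*T yields a system through a block triangular factorization (`gramMap`). The dimension of this
system is rank T + (m + r) dim H₀ + ∑ rank R_k. Operators intertwining two systems with dense span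
come from operators on the central subspaces intertwining the Q_k, so the problem is to describe
irreducible families of projections Q_k with D ≥ 0.

If τ_k² ≥ ξ, evaluating D on the range of R_k forces R_j R_k = 0 for every j ≠ k, so R_k commutes
with the whole family. Hence for |M_l| ≤ 2 noncommutativity can only come from the two projections
of M_l. In an irreducible commuting family every Q_k is 0 or 1 and H₀ is a line; with s the set of k
such that Q_k = 0, the condition is that the sum of τ_k² over s is at most ξ. In a noncommuting one
all other R_k vanish, (R_{k₁} - R_{k₂})² is scalar, and H₀ is a plane with two lines at an angle φ.
There D ≥ 0 says that its determinant (ξ - a)(ξ - b) - ab cos² φ is nonnegative, where a and b are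
the two values τ_k²; when the determinant vanishes, D has rank 1 and the system loses one dimension.
These are the admissible data `ProjDatum`, and the lists of the theorem enumerate them
(`OnlyScalarsCommute.exists_projDatum`, `exists_isClassification`).

If |M_l| ≥ 3, choose three indices with τ_k² < ξ. If the corresponding R_k have nearly orthogonal
ranges, then D is still positive and invertible, and three such subspaces already encode any pair
(A, B). The pair becomes the operator arctan A + i arctan B, whose norm is bounded independently of
the pair. It is placed off the diagonal in a 3 × 3 Gram operator 1 + s·`off` with small s, and the
ranges of the R_k are the ranges of the columns of its square root. An intertwiner of the three
projections is then diagonal with equal entries and intertwines A and B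
(`SelfAdjointPair.exists_eq_blockDiag`). Everything is built by continuous functional calculus,
which stays in the C*-algebra of the pair and respects intertwiners. -/

namespace SubspaceSystem

/-! ### Orthogonal projections of a system -/

section Projections

variable {ι : Type} {H : Type*} [NormedAddCommGroup H] [InnerProductSpace ℂ H] [CompleteSpace H]
  (S : SubspaceSystem ι H)

theorem proj_mem (i : ι) (x : H) : S.proj i x ∈ S.space i := by
  have : CompleteSpace (S.space i) := (S.isClosed i).completeSpace_coe
  exact (S.space i).starProjection_apply_mem x

theorem proj_eq_self {i : ι} {x : H} (hx : x ∈ S.space i) : S.proj i x = x := by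
  have : CompleteSpace (S.space i) := (S.isClosed i).completeSpace_coe
  exact Submodule.starProjection_eq_self_iff.2 hx

theorem proj_proj (i : ι) (x : H) : S.proj i (S.proj i x) = S.proj i x :=
  S.proj_eq_self (S.proj_mem i x)

theorem inner_proj_left (i : ι) (x y : H) : ⟪S.proj i x, y⟫_ℂ = ⟪x, S.proj i y⟫_ℂ := by
  have : CompleteSpace (S.space i) := (S.isClosed i).completeSpace_coe
  exact (S.space i).inner_starProjection_left_eq_right x y

theorem proj_eq_of_mem_of_inner_eq_zero {i : ι} {x v : H} (hv : v ∈ S.space i)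
    (h : ∀ w ∈ S.space i, ⟪x - v, w⟫_ℂ = 0) : S.proj i x = v := by
  have : CompleteSpace (S.space i) := (S.isClosed i).completeSpace_coe
  exact Submodule.eq_starProjection_of_mem_of_inner_eq_zero hv h

end Projections

/-- `V i` are isometries onto the subspaces of `S` with `(V i)^* V j = B i j`. -/
structure IsGramFamily {ι : Type} {H : Type*} [NormedAddCommGroup H] [InnerProductSpace ℂ H]
    {H₀ : Type*} [NormedAddCommGroup H₀] [InnerProductSpace ℂ H₀]
    (S : SubspaceSystem ι H) (B : ι → ι → H₀ →L[ℂ] H₀) (V : ι → H₀ →ₗᵢ[ℂ] H) : Prop where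
  range_eq : ∀ i, LinearMap.range (V i).toLinearMap = S.space i
  inner_eq : ∀ i j x y, ⟪V i x, V j y⟫_ℂ = ⟪x, B i j y⟫_ℂ

theorem HasGram.exists_isGramFamily {ι : Type} {H : Type u} [NormedAddCommGroup H]
    [InnerProductSpace ℂ H] {H₀ : Type v} [NormedAddCommGroup H₀] [InnerProductSpace ℂ H₀]
    {S : SubspaceSystem ι H} {B : ι → ι → H₀ →L[ℂ] H₀} (h : S.HasGram B) :
    ∃ V, S.IsGramFamily B V ∧ (⨆ i, S.space i).topologicalClosure = ⊤ := by
  obtain ⟨V, h1, h2, h3⟩ := h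
  exact ⟨V, ⟨h1, h2⟩, h3⟩

/-! ### Isometries with prescribed Gram operators -/

namespace IsGramFamily

variable {ι : Type} {H : Type*} [NormedAddCommGroup H] [InnerProductSpace ℂ H]
  {H₀ : Type*} [NormedAddCommGroup H₀] [InnerProductSpace ℂ H₀]
  {S : SubspaceSystem ι H} {B : ι → ι → H₀ →L[ℂ] H₀} {V : ι → H₀ →ₗᵢ[ℂ] H}

theorem mem (h : S.IsGramFamily B V) (i : ι) (x : H₀) : V i x ∈ S.space i := by
  rw [← h.range_eq i]; exact ⟨x, rfl⟩

theorem exists_eq (h : S.IsGramFamily B V) {i : ι} {y : H} (hy : y ∈ S.space i) :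
    ∃ x, V i x = y := by
  rw [← h.range_eq i] at hy; exact hy

/-- Two continuous linear maps which agree on all `V i x` agree, if the subspaces span. -/
theorem ext_of_dense {E : Type*} [NormedAddCommGroup E] [NormedSpace ℂ E]
    (h : S.IsGramFamily B V) (hd : (⨆ i, S.space i).topologicalClosure = ⊤)
    {f g : H →L[ℂ] E} (hfg : ∀ i x, f (V i x) = g (V i x)) : f = g := by
  have hle : (⨆ i, S.space i).topologicalClosure ≤ LinearMap.eqLocus f.toLinearMap g.toLinearMap := by
    refine Submodule.topologicalClosure_minimal _ (iSup_le fun i y hy => ?_)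
      (isClosed_eq f.continuous g.continuous)
    obtain ⟨x, rfl⟩ := h.exists_eq hy
    exact hfg i x
  ext x
  exact hle (hd ▸ Submodule.mem_top)

theorem denseRange (h : S.IsGramFamily B V) (hd : (⨆ i, S.space i).topologicalClosure = ⊤)
    {G : Type*} [AddCommGroup G] [Module ℂ G] (e : G →ₗ[ℂ] H)
    (he : ∀ i x, V i x ∈ LinearMap.range e) : DenseRange e := by
  have hle : (⨆ i, S.space i) ≤ LinearMap.range e := iSup_le fun i y hy => by
    obtain ⟨x, rfl⟩ := h.exists_eq hy
    exact he i x
  exact ((Submodule.dense_iff_topologicalClosure_eq_top).2 hd).mono hle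

variable [CompleteSpace H]

/-- Since P_i = V_i V_i^*, the projections act on the vectors V_j x through the entries of B alone;
identities between projections on the span thus become identities between entries of B. -/
theorem proj_apply (h : S.IsGramFamily B V) (i j : ι) (x : H₀) :
    S.proj i (V j x) = V i (B i j x) := by
  refine S.proj_eq_of_mem_of_inner_eq_zero (h.mem i _) fun w hw => ?_
  obtain ⟨y, rfl⟩ := h.exists_eq hw
  have := h.inner_eq i j y x
  rw [← inner_conj_symm, inner_sub_right, this, (V i).inner_map_map, sub_self, map_zero]

theorem exists_proj_eq (h : S.IsGramFamily B V) (i : ι) (z : H) : ∃ x, S.proj i z = V i x := by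
  obtain ⟨x, hx⟩ := h.exists_eq (S.proj_mem i z)
  exact ⟨x, hx.symm⟩

variable [CompleteSpace H₀]

theorem proj_eq (h : S.IsGramFamily B V) (i : ι) (z : H) :
    S.proj i z = V i ((V i).toContinuousLinearMap.adjoint z) := by
  refine S.proj_eq_of_mem_of_inner_eq_zero (h.mem i _) fun w hw => ?_
  obtain ⟨y, rfl⟩ := h.exists_eq hw
  have := ContinuousLinearMap.adjoint_inner_left (V i).toContinuousLinearMap y z
  rw [inner_sub_left, (V i).inner_map_map, this, LinearIsometry.coe_toContinuousLinearMap, sub_self]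

end IsGramFamily

/-- Two systems with the same Gram operator whose subspaces span are unitarily equivalent. -/
theorem HasGram.unitarilyEquivalent {ι : Type} [Finite ι] {H H' : Type*}
    [NormedAddCommGroup H] [InnerProductSpace ℂ H] [CompleteSpace H]
    [NormedAddCommGroup H'] [InnerProductSpace ℂ H'] [CompleteSpace H']
    {H₀ : Type*} [NormedAddCommGroup H₀] [InnerProductSpace ℂ H₀]
    {S : SubspaceSystem ι H} {S' : SubspaceSystem ι H'} {B : ι → ι → H₀ →L[ℂ] H₀}
    (h : S.HasGram B) (h' : S'.HasGram B) : S.UnitarilyEquivalent S' := by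
  classical
  cases nonempty_fintype ι
  obtain ⟨V, hV, hd⟩ := h.exists_isGramFamily
  obtain ⟨V', hV', hd'⟩ := h'.exists_isGramFamily
  -- The two synthesis maps x ↦ ∑ V_i x_i have a common domain and dense ranges, and the norm of an
  -- image depends only on B. Therefore e₁ x ↦ e₂ x extends to a unitary.
  let e₁ : (ι → H₀) →ₗ[ℂ] H := LinearMap.lsum ℂ (fun _ => H₀) ℂ fun i => (V i).toLinearMap
  let e₂ : (ι → H₀) →ₗ[ℂ] H' := LinearMap.lsum ℂ (fun _ => H₀) ℂ fun i => (V' i).toLinearMap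
  have he₁ : ∀ x, e₁ x = ∑ i, V i (x i) := fun x => by simp [e₁, LinearMap.lsum_apply]
  have he₂ : ∀ x, e₂ x = ∑ i, V' i (x i) := fun x => by simp [e₂, LinearMap.lsum_apply]
  have hs₁ : ∀ i x, e₁ (Pi.single i x) = V i x := fun i x => by
    rw [he₁, Finset.sum_eq_single i]
    · simp
    · intro j _ hj; simp [hj]
    · simp
  have hs₂ : ∀ i x, e₂ (Pi.single i x) = V' i x := fun i x => by
    rw [he₂, Finset.sum_eq_single i]
    · simp
    · intro j _ hj; simp [hj]
    · simp
  have d₁ := hV.denseRange hd e₁ fun i x => ⟨_, hs₁ i x⟩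
  have d₂ := hV'.denseRange hd' e₂ fun i x => ⟨_, hs₂ i x⟩
  have hn : ∀ x, ‖e₂ (LinearEquiv.refl ℂ _ x)‖ = ‖e₁ x‖ := fun x => by
    have : ⟪e₂ x, e₂ x⟫_ℂ = ⟪e₁ x, e₁ x⟫_ℂ := by
      simp only [he₁, he₂, sum_inner, inner_sum, hV.inner_eq, hV'.inner_eq]
    rw [LinearEquiv.refl_apply, @norm_eq_sqrt_re_inner ℂ, @norm_eq_sqrt_re_inner ℂ, this]
  let U := (LinearEquiv.refl ℂ (ι → H₀)).extendOfIsometry e₁ e₂ d₁ d₂ hn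
  have hU : ∀ i x, U (V i x) = V' i x := fun i x => by
    rw [← hs₁, ← hs₂]
    exact LinearEquiv.extendOfIsometry_eq _ _ _ d₁ d₂ hn _
  refine ⟨U, fun i => ?_⟩
  rw [← hV.range_eq, ← hV'.range_eq, ← LinearMap.range_comp]
  congr 1
  ext x
  exact hU i x

theorem HasGram.conj {ι : Type} {H : Type*} [NormedAddCommGroup H] [InnerProductSpace ℂ H]
    {H₀ H₁ : Type*} [NormedAddCommGroup H₀] [InnerProductSpace ℂ H₀]
    [NormedAddCommGroup H₁] [InnerProductSpace ℂ H₁]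
    {S : SubspaceSystem ι H} {B : ι → ι → H₀ →L[ℂ] H₀} {B' : ι → ι → H₁ →L[ℂ] H₁}
    (h : S.HasGram B) (u : H₁ ≃ₗᵢ[ℂ] H₀) (hu : ∀ i j x, B i j (u x) = u (B' i j x)) :
    S.HasGram B' := by
  obtain ⟨V, h1, h2, h3⟩ := h
  refine ⟨fun i => (V i).comp u.toLinearIsometry, fun i => ?_, fun i j x y => ?_, h3⟩
  · rw [← h1 i]
    refine SetLike.ext' ?_
    exact (u.surjective.range_comp (V i))
  · change ⟪V i (u x), V j (u y)⟫_ℂ = _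
    rw [h2, hu, u.inner_map_map]

theorem UnitarilyEquivalent.exists_comp_proj {ι : Type} {H H' : Type*}
    [NormedAddCommGroup H] [InnerProductSpace ℂ H] [CompleteSpace H]
    [NormedAddCommGroup H'] [InnerProductSpace ℂ H'] [CompleteSpace H']
    {S : SubspaceSystem ι H} {S' : SubspaceSystem ι H'} (h : S.UnitarilyEquivalent S') :
    ∃ U : H ≃ₗᵢ[ℂ] H', ∀ i x, U (S.proj i x) = S'.proj i (U x) := by
  obtain ⟨U, hU⟩ := h
  refine ⟨U, fun i x => (S'.proj_eq_of_mem_of_inner_eq_zero ?_ fun w hw => ?_).symm⟩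
  · rw [← hU i]; exact ⟨_, S.proj_mem i x, rfl⟩
  · rw [← hU i] at hw
    obtain ⟨y, hy, rfl⟩ := hw
    change ⟪U x - U (S.proj i x), U y⟫_ℂ = 0
    rw [← map_sub, U.inner_map_map, inner_sub_left, S.inner_proj_left, S.proj_eq_self hy, sub_self]

/-- The subspaces of a nonzero irreducible system span the whole space. -/
theorem IsIrreducible.topologicalClosure_iSup_eq_top {ι : Type} {H : Type*}
    [NormedAddCommGroup H] [InnerProductSpace ℂ H] [CompleteSpace H]
    {S : SubspaceSystem ι H} (h : S.IsIrreducible) (h0 : S.IsNonzero) :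
    (⨆ i, S.space i).topologicalClosure = ⊤ := by
  set W := (⨆ i, S.space i).topologicalClosure
  have : CompleteSpace W := (Submodule.isClosed_topologicalClosure _).completeSpace_coe
  have hW : ∀ i, S.space i ≤ W := fun i => (le_iSup _ i).trans (Submodule.le_topologicalClosure _)
  -- Each H_i lies in the closed span W, so the projection onto W commutes with all P_i and is a
  -- scalar; a nonzero vector of some H_i shows that the scalar is 1.
  obtain ⟨c, hc⟩ := h W.starProjection fun i => by
    ext x
    have h1 : W.starProjection (S.proj i x) = S.proj i x :=
      Submodule.starProjection_eq_self_iff.2 (hW i (S.proj_mem i x))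
    have h2 : S.proj i (W.starProjection x) = S.proj i x := by
      refine S.proj_eq_of_mem_of_inner_eq_zero (S.proj_mem i x) fun w hw => ?_
      have h3 : W.starProjection w = w := Submodule.starProjection_eq_self_iff.2 (hW i hw)
      rw [inner_sub_left, W.inner_starProjection_left_eq_right, h3, S.inner_proj_left,
        S.proj_eq_self hw, sub_self]
    simp [h1, h2]
  obtain ⟨i, hi⟩ := h0
  obtain ⟨x, hx, hx0⟩ := (Submodule.ne_bot_iff _).1 hi
  have h1 : W.starProjection x = x := Submodule.starProjection_eq_self_iff.2 (hW i hx)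
  have h2 : c = 1 := by
    rw [hc] at h1
    have : (c - 1) • x = 0 := by simpa [sub_smul, sub_eq_zero] using h1
    simpa [hx0, sub_eq_zero] using this
  refine eq_top_iff.2 fun y _ => ?_
  rw [← Submodule.starProjection_eq_self_iff (K := W), hc, h2]
  simp

/-- An operator commuting with all entries of the Gram operator of an irreducible system is
scalar. -/
theorem IsGramFamily.exists_eq_smul_of_commute {ι : Type} [Finite ι] {H H₀ : Type*}
    [NormedAddCommGroup H] [InnerProductSpace ℂ H] [CompleteSpace H]
    [NormedAddCommGroup H₀] [InnerProductSpace ℂ H₀] [CompleteSpace H₀] [Nonempty ι]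
    {S : SubspaceSystem ι H} {B : ι → ι → H₀ →L[ℂ] H₀} {V : ι → H₀ →ₗᵢ[ℂ] H}
    (hV : S.IsGramFamily B V) (hd : (⨆ i, S.space i).topologicalClosure = ⊤)
    (h : S.IsIrreducible) (A : H₀ →L[ℂ] H₀) (hA : ∀ i j x, A (B i j x) = B i j (A x))
    (hA' : ∀ i j x, A.adjoint (B i j x) = B i j (A.adjoint x)) :
    ∃ c : ℂ, ∀ x, A x = c • x := by
  classical
  cases nonempty_fintype ι
  let G := PiLp 2 fun _ : ι => H₀
  let Φ : G →L[ℂ] H := ∑ i, (V i).toContinuousLinearMap ∘L PiLp.proj 2 (fun _ : ι => H₀) i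
  have hΦ : ∀ x, Φ x = ∑ i, V i (x i) := fun x => by
    simp only [Φ, sum_apply]
    rfl
  let dg (C : H₀ →L[ℂ] H₀) : G →L[ℂ] G :=
    (PiLp.continuousLinearEquiv 2 ℂ (fun _ : ι => H₀)).symm.toContinuousLinearMap ∘L
      ContinuousLinearMap.pi fun i => C ∘L PiLp.proj 2 (fun _ : ι => H₀) i
  have hdg : ∀ C x i, dg C x i = C (x i) := fun C x i => rfl
  have hadj : ∀ C, (dg C).adjoint = dg C.adjoint := fun C => by
    symm
    rw [ContinuousLinearMap.eq_adjoint_iff]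
    intro x y
    rw [PiLp.inner_apply, PiLp.inner_apply]
    exact Finset.sum_congr rfl fun i _ => ContinuousLinearMap.adjoint_inner_left _ _ _
  -- Φ^*Φ is the Gram operator on the direct sum of copies of H₀; diagonal operators whose entry
  -- commutes with all B i j commute with it.
  have hG : ∀ x i, (Φ.adjoint (Φ x)) i = ∑ j, B i j (x j) := fun x i => by
    refine ext_inner_left ℂ fun y => ?_
    have h1 : ⟪(PiLp.single 2 i y : G), Φ.adjoint (Φ x)⟫_ℂ = ⟪y, (Φ.adjoint (Φ x)) i⟫_ℂ := by
      rw [PiLp.inner_apply, Finset.sum_eq_single i]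
      · simp
      · intro j _ hj; simp [hj]
      · simp
    rw [← h1, ContinuousLinearMap.adjoint_inner_right, hΦ, hΦ, Finset.sum_eq_single i, inner_sum,
      inner_sum]
    · simp [hV.inner_eq]
    · intro j _ hj; simp [hj]
    · simp
  have hcomm : ∀ C : H₀ →L[ℂ] H₀, (∀ i j x, C (B i j x) = B i j (C x)) →
      Commute (dg C) (Φ.adjoint ∘L Φ) := fun C hC => by
    ext x i
    change dg C (Φ.adjoint (Φ x)) i = (Φ.adjoint (Φ (dg C x))) i
    rw [hdg, hG, hG, map_sum]
    simp [hdg, hC]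
  -- The assignment V_i x ↦ V_i (A x) extends to H only if it is bounded for the seminorm ‖Φ x‖.
  -- With a = `dg A`, the operators ‖a‖² - a^*a and Φ^*Φ are nonnegative and commute, so their
  -- product is nonnegative; its quadratic form is the required bound.
  have hle : 0 ≤ (algebraMap ℝ (G →L[ℂ] G) (‖dg A‖ ^ 2) - star (dg A) * dg A) * (Φ.adjoint ∘L Φ) := by
    refine Commute.mul_nonneg (sub_nonneg.2 ?_) ?_ ?_
    · have := CStarAlgebra.star_mul_le_algebraMap_norm_sq (a := dg A)
      exact this
    · rw [ContinuousLinearMap.nonneg_iff_isPositive]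
      exact ContinuousLinearMap.isPositive_adjoint_comp_self Φ
    · refine (Commute.sub_left (Algebra.commutes _ _) (Commute.mul_left ?_ (hcomm A hA)))
      rw [ContinuousLinearMap.star_eq_adjoint, hadj]
      exact hcomm _ hA'
  have hbound : ∀ x, ‖Φ (dg A x)‖ ≤ ‖dg A‖ * ‖Φ x‖ := fun x => by
    rw [ContinuousLinearMap.nonneg_iff_isPositive] at hle
    have h1 := hle.re_inner_nonneg_right x
    have h2 : ⟪x, ((algebraMap ℝ (G →L[ℂ] G) (‖dg A‖ ^ 2) - star (dg A) * dg A) *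
        (Φ.adjoint ∘L Φ)) x⟫_ℂ = (((‖dg A‖ * ‖Φ x‖) ^ 2 : ℝ) : ℂ) - ((‖Φ (dg A x)‖ ^ 2 : ℝ) : ℂ) := by
      have h3 : (star (dg A) * dg A * (Φ.adjoint ∘L Φ)) x
          = (dg A).adjoint (Φ.adjoint (Φ (dg A x))) := by
        have := congrArg (fun T => T x) (hcomm A hA).eq
        change (dg A).adjoint (dg A (Φ.adjoint (Φ x))) = _
        congr 1
      rw [sub_mul, sub_apply, h3, inner_sub_right,
        ContinuousLinearMap.adjoint_inner_right, ContinuousLinearMap.adjoint_inner_right,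
        inner_self_eq_norm_sq_to_K]
      congr 1
      · rw [Algebra.algebraMap_eq_smul_one, smul_mul_assoc, one_mul]
        change ⟪x, (‖dg A‖ ^ 2) • Φ.adjoint (Φ x)⟫_ℂ = _
        rw [inner_smul_right_eq_smul, ContinuousLinearMap.adjoint_inner_right,
          inner_self_eq_norm_sq_to_K]
        simp [mul_pow]
      · simp
    rw [h2, ← Complex.ofReal_sub] at h1
    have h4 : 0 ≤ (‖dg A‖ * ‖Φ x‖) ^ 2 - ‖Φ (dg A x)‖ ^ 2 := h1
    exact abs_le_of_sq_le_sq' (by linarith) (by positivity) |>.2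
  have hs : ∀ i x, Φ (PiLp.single 2 i x) = V i x := fun i x => by
    rw [hΦ, Finset.sum_eq_single i]
    · simp
    · intro j _ hj; simp [hj]
    · simp
  have hdense : DenseRange Φ.toLinearMap := 
    hV.denseRange hd _ fun i x => ⟨_, hs i x⟩
  let D : H →L[ℂ] H := ((Φ ∘L dg A).toLinearMap).extendOfNorm Φ.toLinearMap
  have hD : ∀ i x, D (V i x) = V i (A x) := fun i x => by
    rw [← hs]
    have : D (Φ (PiLp.single 2 i x)) = Φ (dg A (PiLp.single 2 i x)) :=
      LinearMap.extendOfNorm_eq hdense ⟨_, hbound⟩ _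
    rw [this, hΦ, Finset.sum_eq_single i]
    · simp [hdg]
    · intro j _ hj; simp [hdg, hj]
    · simp
  obtain ⟨c, hc⟩ := h D fun i => hV.ext_of_dense hd fun j x => by
    simp [hD, hV.proj_apply, hA]
  refine ⟨c, fun x => (V (Classical.arbitrary ι)).injective ?_⟩
  rw [← hD, hc]
  simp

end SubspaceSystem

/-! ### End vertices of the star -/

namespace Ray

variable {m r : ℕ}

/-- The end vertices as a disjoint union. -/
def equivSum : Ray m r ≃ (Fin m ⊕ Fin m) ⊕ Fin r where
  toFun
    | fst k => .inl (.inl k)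
    | snd k => .inl (.inr k)
    | leaf j => .inr j
  invFun
    | .inl (.inl k) => fst k
    | .inl (.inr k) => snd k
    | .inr j => leaf j
  left_inv i := by cases i <;> rfl
  right_inv i := by rcases i with (k | k) | j <;> rfl

instance : Fintype (Ray m r) := Fintype.ofEquiv _ equivSum.symm

theorem sum_eq {M : Type*} [AddCommMonoid M] (f : Ray m r → M) :
    ∑ i, f i = ∑ k, f (fst k) + ∑ k, f (snd k) + ∑ j, f (leaf j) := by
  rw [← equivSum.symm.sum_comp f, Fintype.sum_sum_type, Fintype.sum_sum_type]
  rfl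

end Ray

namespace IsStarProjection

variable {H₀ : Type*} [NormedAddCommGroup H₀] [InnerProductSpace ℂ H₀] [CompleteSpace H₀]
  {P : H₀ →L[ℂ] H₀}

theorem apply_apply (h : IsStarProjection P) (x : H₀) : P (P x) = P x :=
  congrArg (fun T => T x) h.isIdempotentElem.eq

theorem inner_apply_left (h : IsStarProjection P) (x y : H₀) : ⟪P x, y⟫_ℂ = ⟪x, P y⟫_ℂ := by
  conv_lhs => rw [← h.isSelfAdjoint.star_eq, ContinuousLinearMap.star_eq_adjoint]
  exact ContinuousLinearMap.adjoint_inner_left _ _ _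

end IsStarProjection

/-! ### The block Gram operator and its Schur complement -/

section GramOperator

variable {m r : ℕ} {θ : Ray m r → ℝ} {H₀ : Type*} [NormedAddCommGroup H₀] [InnerProductSpace ℂ H₀]
  (Q : Fin m → H₀ →L[ℂ] H₀)

@[simp] theorem gramB_none_none : gramB θ Q none none = ContinuousLinearMap.id ℂ H₀ := rfl

@[simp] theorem gramB_none_some (i : Ray m r) :
    gramB θ Q none (some i) = (Real.cos (θ i) : ℂ) • ContinuousLinearMap.id ℂ H₀ := rfl

@[simp] theorem gramB_some_none (i : Ray m r) :
    gramB θ Q (some i) none = (Real.cos (θ i) : ℂ) • ContinuousLinearMap.id ℂ H₀ := rfl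

@[simp] theorem gramB_self (i : StarVertex m r) :
    gramB θ Q i i = ContinuousLinearMap.id ℂ H₀ := by
  rcases i with _ | (k | k | j)
  · rfl
  all_goals exact if_pos rfl

@[simp] theorem gramB_fst_snd (k : Fin m) : gramB θ Q (some (.fst k)) (some (.snd k)) = Q k :=
  if_pos rfl

@[simp] theorem gramB_snd_fst (k : Fin m) : gramB θ Q (some (.snd k)) (some (.fst k)) = Q k :=
  if_pos rfl

theorem gramB_eq_zero {i j : Ray m r} (hij : i ≠ j) (h : ¬ IsDottedPair i j) :
    gramB θ Q (some i) (some j) = 0 := by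
  cases i <;> cases j <;> first
    | exact if_neg hij
    | exact if_neg fun hk => h ⟨_, Or.inl ⟨rfl, by rw [hk]⟩⟩
    | exact if_neg fun hk => h ⟨_, Or.inr ⟨rfl, by rw [hk]⟩⟩

/-- Conjugate projections have conjugate Gram operators. -/
theorem gramB_conj {H₁ : Type*} [NormedAddCommGroup H₁] [InnerProductSpace ℂ H₁]
    (Q' : Fin m → H₁ →L[ℂ] H₁) (u : H₁ →L[ℂ] H₀) (hu : ∀ k x, Q k (u x) = u (Q' k x))
    (i j : StarVertex m r) (x : H₁) : gramB θ Q i j (u x) = u (gramB θ Q' i j x) := by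
  classical
  rcases i with _ | i
  · rcases j with _ | j <;> simp
  rcases j with _ | j
  · simp
  by_cases hij : i = j
  · subst hij; simp
  by_cases hd : IsDottedPair i j
  · obtain ⟨k, ⟨rfl, rfl⟩ | ⟨rfl, rfl⟩⟩ := hd <;> simp [hu]
  · simp [gramB_eq_zero _ hij hd]

/-- The operator `ξ - ∑ τ_k² (1 - Q_k)`: the Schur complement of the Gram operator. -/
noncomputable def defect (θ : Ray m r → ℝ) : H₀ →L[ℂ] H₀ :=
  (xi θ : ℂ) • ContinuousLinearMap.id ℂ H₀
    - ∑ k, (tauSq θ k : ℂ) • (ContinuousLinearMap.id ℂ H₀ - Q k)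

theorem defect_apply (x : H₀) :
    defect Q θ x = (xi θ : ℂ) • x - ∑ k, (tauSq θ k : ℂ) • (x - Q k x) := by
  simp [defect]

/-- The part of the subspace of an end vertex which is orthogonal to the preceding ones. -/
def rayDefect : Ray m r → H₀ →L[ℂ] H₀
  | .fst _ => ContinuousLinearMap.id ℂ H₀
  | .snd k => ContinuousLinearMap.id ℂ H₀ - Q k
  | .leaf _ => ContinuousLinearMap.id ℂ H₀

/-- `rayDefect` extended by `defect` to the centre. -/
noncomputable def vertexDefect (θ : Ray m r → ℝ) : StarVertex m r → H₀ →L[ℂ] H₀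
  | none => defect Q θ
  | some i => rayDefect Q i

/-- The two vertices of a pair have the same angle, so together they contribute τ_k²(1 + R_k), and
the R_k cancel against those in `defect`. This is the normalization V_1^*V_1 = 1 of the central
isometry in the triangular factorization. -/
theorem defect_add_sum_rayDefect (hpair : ∀ k : Fin m, θ (.fst k) = θ (.snd k)) (x : H₀) :
    defect Q θ x + ∑ i, (Real.cos (θ i) : ℂ) • (Real.cos (θ i) : ℂ) • rayDefect Q i x = x := by
  have h : (xi θ : ℂ) = 1 - ∑ k, (tauSq θ k : ℂ) - ∑ j : Fin r, (Real.cos (θ (.leaf j)) : ℂ) ^ 2 := by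
    simp [xi]
  rw [defect_apply, Ray.sum_eq, h]
  simp only [rayDefect, smul_smul, ← pow_two, ← hpair, ← Finset.sum_smul, ContinuousLinearMap.id_apply,
    sub_apply, smul_sub, Finset.sum_sub_distrib, tauSq, Complex.ofReal_pow]
  simp only [sub_smul, one_smul]
  abel

end GramOperator

/-! ### Conditions satisfied by the projections Q_k -/

namespace SubspaceSystem

variable {m r : ℕ} {θ : Ray m r → ℝ}

theorem IsGramFamily.fst_eq_snd {H H₀ : Type*}
    [NormedAddCommGroup H] [InnerProductSpace ℂ H] [NormedAddCommGroup H₀] [InnerProductSpace ℂ H₀]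
    [CompleteSpace H₀]
    {S : SubspaceSystem (StarVertex m r) H} {Q : Fin m → H₀ →L[ℂ] H₀}
    {V : StarVertex m r → H₀ →ₗᵢ[ℂ] H} (hV : S.IsGramFamily (gramB θ Q) V)
    (hQ : ∀ k, IsStarProjection (Q k)) (k : Fin m) (x : H₀) :
    V (some (.fst k)) (Q k x) = V (some (.snd k)) (Q k x) := by
  have hi : Q k (Q k x) = Q k x := (hQ k).apply_apply x
  rw [← sub_eq_zero, ← inner_self_eq_zero (𝕜 := ℂ), inner_sub_left, inner_sub_right, inner_sub_right]
  simp [hV.inner_eq, hi]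

theorem IsGramFamily.angComOrt {H H₀ : Type*}
    [NormedAddCommGroup H] [InnerProductSpace ℂ H] [CompleteSpace H]
    [NormedAddCommGroup H₀] [InnerProductSpace ℂ H₀] [CompleteSpace H₀]
    {S : SubspaceSystem (StarVertex m r) H} {Q : Fin m → H₀ →L[ℂ] H₀}
    {V : StarVertex m r → H₀ →ₗᵢ[ℂ] H} (hV : S.IsGramFamily (gramB θ Q) V)
    (hQ : ∀ k, IsStarProjection (Q k)) : AngComOrt θ H S where
  ang_center i := by
    ext z
    obtain ⟨x, hx⟩ := hV.exists_proj_eq none z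
    simp [hx, hV.proj_apply, smul_smul, pow_two]
  ang_ray i := by
    ext z
    obtain ⟨x, hx⟩ := hV.exists_proj_eq (some i) z
    simp [hx, hV.proj_apply, smul_smul, pow_two]
  com k := by
    ext z
    set f := (V (some (.fst k))).toContinuousLinearMap.adjoint z
    set s := (V (some (.snd k))).toContinuousLinearMap.adjoint z
    -- Both products of projections have the form V Q_k V^* z with V belonging to one of the two
    -- vertices. By `IsGramFamily.fst_eq_snd` and its adjoint, the choice of vertex matters neither
    -- in V Q_k nor in Q_k V^*.
    have hfs : Q k f = Q k s := by
      refine ext_inner_left ℂ fun y => ?_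
      rw [← (hQ k).inner_apply_left, ← (hQ k).inner_apply_left,
        ContinuousLinearMap.adjoint_inner_right, ContinuousLinearMap.adjoint_inner_right]
      change ⟪V _ (Q k y), z⟫_ℂ = ⟪V _ (Q k y), z⟫_ℂ
      rw [hV.fst_eq_snd hQ]
    simp only [ContinuousLinearMap.comp_apply]
    rw [hV.proj_eq (some (.fst k)) z, hV.proj_eq (some (.snd k)) z, hV.proj_apply, hV.proj_apply,
      gramB_fst_snd, gramB_snd_fst]
    change V _ (Q k s) = V _ (Q k f)
    rw [hfs, hV.fst_eq_snd hQ]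
  ort i j hij hd := by
    ext z
    obtain ⟨x, hx⟩ := hV.exists_proj_eq (some j) z
    simp [hx, hV.proj_apply, gramB_eq_zero _ hij hd]

/-- An operator intertwining the projections of two systems comes from an operator intertwining
the projections `Q k`. -/
theorem IsGramFamily.exists_intertwiner {H H' H₀ H₀' : Type*}
    [NormedAddCommGroup H] [InnerProductSpace ℂ H] [CompleteSpace H]
    [NormedAddCommGroup H'] [InnerProductSpace ℂ H'] [CompleteSpace H']
    [NormedAddCommGroup H₀] [InnerProductSpace ℂ H₀] [CompleteSpace H₀]
    [NormedAddCommGroup H₀'] [InnerProductSpace ℂ H₀'] [CompleteSpace H₀']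
    {S : SubspaceSystem (StarVertex m r) H} {Q : Fin m → H₀ →L[ℂ] H₀}
    {V : StarVertex m r → H₀ →ₗᵢ[ℂ] H} (hV : S.IsGramFamily (gramB θ Q) V)
    {S' : SubspaceSystem (StarVertex m r) H'} {Q' : Fin m → H₀' →L[ℂ] H₀'}
    {V' : StarVertex m r → H₀' →ₗᵢ[ℂ] H'} (hV' : S'.IsGramFamily (gramB θ Q') V')
    (hτ : ∀ i, Real.cos (θ i) ≠ 0) (D : H →L[ℂ] H')
    (hD : ∀ i x, D (S.proj i x) = S'.proj i (D x)) :
    ∃ C : H₀ →L[ℂ] H₀', (∀ i x, D (V i x) = V' i (C x)) ∧ ∀ k x, C (Q k x) = Q' k (C x) := by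
  -- C is D read in the central subspaces. Since P_i V_1 = τ_i V_i with τ_i ≠ 0, the relation at the
  -- centre passes to every end vertex; applying P_{2k} to V_{2k+1} then exposes Q_k.
  let C : H₀ →L[ℂ] H₀' :=
    (V' none).toContinuousLinearMap.adjoint ∘L D ∘L (V none).toContinuousLinearMap
  have h0 : ∀ x, D (V none x) = V' none (C x) := fun x => by
    have h1 := hD none (V none x)
    rw [hV.proj_apply, gramB_none_none, hV'.proj_eq] at h1
    exact h1
  have h1 : ∀ i x, D (V i x) = V' i (C x) := fun i x => by
    rcases i with _ | i
    · exact h0 x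
    have h2 := hD (some i) (V none x)
    rw [h0, hV.proj_apply, hV'.proj_apply] at h2
    refine smul_right_injective _ (Complex.ofReal_ne_zero.2 (hτ i)) ?_
    simpa using h2
  refine ⟨C, h1, fun k x => (V' (some (.fst k))).injective ?_⟩
  have h2 := hD (some (.fst k)) (V (some (.snd k)) x)
  rw [h1, hV.proj_apply, hV'.proj_apply, h1] at h2
  simpa using h2

/-- The form of `defect` at x is the squared distance from V_1 x to the sum of the subspaces of the
end vertices. -/
theorem IsGramFamily.re_inner_defect_nonneg {H H₀ : Type*}
    [NormedAddCommGroup H] [InnerProductSpace ℂ H] [NormedAddCommGroup H₀] [InnerProductSpace ℂ H₀]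
    [CompleteSpace H₀]
    {S : SubspaceSystem (StarVertex m r) H} {Q : Fin m → H₀ →L[ℂ] H₀}
    {V : StarVertex m r → H₀ →ₗᵢ[ℂ] H} (hV : S.IsGramFamily (gramB θ Q) V)
    (hpair : ∀ k : Fin m, θ (.fst k) = θ (.snd k))
    (hQ : ∀ k, IsStarProjection (Q k)) (x : H₀) : 0 ≤ (⟪x, defect Q θ x⟫_ℂ).re := by
  have hi : ∀ k y, Q k (Q k y) = Q k y := fun k => (hQ k).apply_apply
  have hs : ∀ k y z, ⟪Q k y, z⟫_ℂ = ⟪y, Q k z⟫_ℂ := fun k => (hQ k).inner_apply_left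
  let g := rayDefect (r := r) Q
  have hgg : ∀ i, ⟪g i x, g i x⟫_ℂ = ⟪x, g i x⟫_ℂ := fun i => by
    cases i <;> simp only [g, rayDefect, sub_apply, ContinuousLinearMap.id_apply, inner_sub_left,
      inner_sub_right, hs, hi, sub_self, sub_zero]
  have hgs : ∀ i, ⟪g i x, x⟫_ℂ = ⟪x, g i x⟫_ℂ := fun i => by
    cases i <;> simp only [g, rayDefect, sub_apply, ContinuousLinearMap.id_apply, inner_sub_left,
      inner_sub_right, hs]
  have hij : ∀ i j, i ≠ j → ⟪V (some i) (g i x), V (some j) (g j x)⟫_ℂ = 0 := fun i j hij => by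
    rw [hV.inner_eq]
    by_cases hd : IsDottedPair i j
    · obtain ⟨k, ⟨rfl, rfl⟩ | ⟨rfl, rfl⟩⟩ := hd <;>
        simp only [g, rayDefect, sub_apply, ContinuousLinearMap.id_apply, gramB_fst_snd,
          gramB_snd_fst, map_sub, hi, hs, inner_sub_left, sub_self, inner_zero_right]
    · simp [gramB_eq_zero _ hij hd]
  -- This is the orthogonal projection of V_1 x onto the sum of the end subspaces. Replacing x by (1
  -- - Q_k) x at the second vertex of a pair removes what the first vertex already covers, so the
  -- summands are orthogonal.
  let s : H := ∑ i, (Real.cos (θ i) : ℂ) • V (some i) (g i x)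
  have h1 : ⟪V none x, s⟫_ℂ = ∑ i, (Real.cos (θ i) : ℂ) * ((Real.cos (θ i) : ℂ) * ⟪x, g i x⟫_ℂ) := by
    simp [s, hV.inner_eq]
  have h2 : ⟪s, V none x⟫_ℂ = ∑ i, (Real.cos (θ i) : ℂ) * ((Real.cos (θ i) : ℂ) * ⟪x, g i x⟫_ℂ) := by
    simp [s, hV.inner_eq, hgs, -Complex.ofReal_cos]
  have h3 : ⟪s, s⟫_ℂ = ∑ i, (Real.cos (θ i) : ℂ) * ((Real.cos (θ i) : ℂ) * ⟪x, g i x⟫_ℂ) := by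
    simp only [s, sum_inner]
    refine Finset.sum_congr rfl fun i _ => ?_
    rw [inner_smul_left, inner_sum, Finset.sum_eq_single i]
    · rw [inner_smul_right, (V (some i)).inner_map_map, hgg, Complex.conj_ofReal]
    · intro j _ hj
      rw [inner_smul_right, hij i j hj.symm, mul_zero]
    · simp
  have h4 : ⟪V none x - s, V none x - s⟫_ℂ = ⟪x, defect Q θ x⟫_ℂ := by
    have h5 := congrArg (fun y => ⟪x, y⟫_ℂ) (defect_add_sum_rayDefect Q hpair x)
    simp only [inner_add_right, inner_sum, inner_smul_right] at h5
    rw [inner_sub_left, inner_sub_right, inner_sub_right, h1, h2, h3, (V none).inner_map_map, ← h5]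
    simp only [g]
    ring
  rw [← h4]
  exact inner_self_nonneg (𝕜 := ℂ)

end SubspaceSystem

namespace SubspaceSystem

variable {m r : ℕ} {θ : Ray m r → ℝ}

/-! ### Normal form of a system -/

section NormalForm

variable {H : Type*} [NormedAddCommGroup H] [InnerProductSpace ℂ H] [CompleteSpace H]
  {S : SubspaceSystem (StarVertex m r) H}

instance (S : SubspaceSystem (StarVertex m r) H) (i : StarVertex m r) :
    CompleteSpace (S.space i) := (S.isClosed i).completeSpace_coe

/-- A system with (Ang), (Com), (Ort) has the Gram operator `gramB θ Q` for some projections `Q k`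
in the central subspace. -/
theorem _root_.AngComOrt.exists_isGramFamily (h : AngComOrt θ H S)
    (hτ : ∀ i, Real.cos (θ i) ≠ 0) (hpair : ∀ k : Fin m, θ (.fst k) = θ (.snd k)) :
    ∃ (Q : Fin m → S.space none →L[ℂ] S.space none) (V : StarVertex m r → S.space none →ₗᵢ[ℂ] H),
      (∀ k, IsStarProjection (Q k)) ∧ S.IsGramFamily (gramB θ Q) V := by
  have hτ' : ∀ i, (Real.cos (θ i) : ℂ) ≠ 0 := fun i => Complex.ofReal_ne_zero.2 (hτ i)
  have key : ∀ c : ℂ, c ≠ 0 → ∀ z, c⁻¹ * (c⁻¹ * (c ^ 2 * z)) = z := fun c hc z => by field_simp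
  have hc : ∀ i x, S.proj none (S.proj (some i) (S.proj none x))
      = (Real.cos (θ i) : ℂ) ^ 2 • S.proj none x := fun i x => by
    rw [← Complex.ofReal_pow]; exact congrArg (fun T => T x) (h.ang_center i)
  have hr : ∀ i x, S.proj (some i) (S.proj none (S.proj (some i) x))
      = (Real.cos (θ i) : ℂ) ^ 2 • S.proj (some i) x := fun i x => by
    rw [← Complex.ofReal_pow]; exact congrArg (fun T => T x) (h.ang_ray i)
  have hcom : ∀ k x, S.proj (some (.fst k)) (S.proj (some (.snd k)) x)
      = S.proj (some (.snd k)) (S.proj (some (.fst k)) x) := fun k x =>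
    congrArg (fun T => T x) (h.com k)
  have h0 : ∀ x : S.space none, S.proj none (x : H) = x := fun x => S.proj_eq_self x.2
  have hi : ∀ i (x y : S.space none), ⟪S.proj (some i) (x : H), S.proj (some i) (y : H)⟫_ℂ
      = (Real.cos (θ i) : ℂ) ^ 2 * ⟪x, y⟫_ℂ := fun i x y => by
    rw [S.inner_proj_left, S.proj_proj, ← h0 x, S.inner_proj_left, ← h0 y, hc, h0,
      inner_smul_right, Submodule.coe_inner]
  have hi' : ∀ i (x y : S.space none), ⟪(x : H), S.proj (some i) (y : H)⟫_ℂ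
      = (Real.cos (θ i) : ℂ) ^ 2 * ⟪x, y⟫_ℂ := fun i x y => by
    rw [← hi, S.inner_proj_left, S.proj_proj]
  -- P_1P_iP_1 = τ_i²P_1 means that P_i scales norms on the central subspace by τ_i. The other half
  -- of (Ang) will give surjectivity onto H_i.
  let W : Ray m r → S.space none →ₗᵢ[ℂ] H := fun i =>
    LinearMap.isometryOfInner ((Real.cos (θ i) : ℂ)⁻¹ •
      ((S.proj (some i)).toLinearMap ∘ₗ (S.space none).subtype)) fun x y => by
        change ⟪(Real.cos (θ i) : ℂ)⁻¹ • S.proj (some i) (x : H),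
          (Real.cos (θ i) : ℂ)⁻¹ • S.proj (some i) (y : H)⟫_ℂ = _
        rw [inner_smul_left, inner_smul_right, hi, map_inv₀, Complex.conj_ofReal]
        exact key _ (hτ' i) _
  have hW : ∀ i x, W i x = (Real.cos (θ i) : ℂ)⁻¹ • S.proj (some i) (x : H) := fun i x => rfl
  -- This is V_{2k}^*V_{2k+1} for V_i = τ_i⁻¹P_i; the equality of the two angles gives the factor
  -- τ_k⁻².
  let Q : Fin m → S.space none →L[ℂ] S.space none := fun k =>
    ((Real.cos (θ (.fst k)) : ℂ) ^ 2)⁻¹ • ((S.space none).orthogonalProjectionOnto ∘L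
      S.proj (some (.fst k)) ∘L S.proj (some (.snd k)) ∘L (S.space none).subtypeL)
  have hQ : ∀ k x, (Q k x : H) = ((Real.cos (θ (.fst k)) : ℂ) ^ 2)⁻¹ •
      S.proj none (S.proj (some (.fst k)) (S.proj (some (.snd k)) (x : H))) := fun k x => rfl
  have hQi : ∀ k (x y : S.space none), ⟪x, Q k y⟫_ℂ = ((Real.cos (θ (.fst k)) : ℂ) ^ 2)⁻¹ *
      ⟪(x : H), S.proj (some (.fst k)) (S.proj (some (.snd k)) (y : H))⟫_ℂ := fun k x y => by
    rw [Submodule.coe_inner, hQ, inner_smul_right, ← S.inner_proj_left, h0]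
  have hQs : ∀ k, IsStarProjection (Q k) := fun k => by
    refine ⟨?_, ?_⟩
    · ext x
      change (Q k (Q k x) : H) = Q k x
      simp only [hQ, map_smul]
      -- Swapping the first two projections produces P_{2k}P_1P_{2k}, which (Ang) replaces by
      -- τ_k²P_{2k}. This cancels one factor τ_k⁻² in Q_k² and leaves Q_k.
      have h1 : ∀ z, S.proj (some (.fst k)) (S.proj (some (.snd k)) (S.proj none
          (S.proj (some (.fst k)) (S.proj (some (.snd k)) z)))) = (Real.cos (θ (.fst k)) : ℂ) ^ 2 •
            S.proj (some (.fst k)) (S.proj (some (.snd k)) z) := fun z => by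
        rw [hcom, hr, map_smul, ← hcom, S.proj_proj]
      rw [h1, map_smul, smul_smul, smul_smul, mul_assoc, inv_mul_cancel₀ (pow_ne_zero 2 (hτ' _)),
        mul_one]
    · rw [ContinuousLinearMap.isSelfAdjoint_iff_isSymmetric]
      intro x y
      change ⟪Q k x, y⟫_ℂ = ⟪x, Q k y⟫_ℂ
      rw [← inner_conj_symm, hQi, hQi, map_mul, inner_conj_symm, S.inner_proj_left,
        S.inner_proj_left, hcom, map_inv₀, map_pow, Complex.conj_ofReal]
  refine ⟨Q, fun i => i.elim (S.space none).subtypeₗᵢ W, hQs, fun i => ?_, fun i j x y => ?_⟩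
  · rcases i with _ | i
    · exact (S.space none).range_subtype
    refine le_antisymm ?_ fun y hy => ?_
    · rintro _ ⟨x, rfl⟩
      exact (S.space _).smul_mem _ (S.proj_mem _ _)
    · refine ⟨(Real.cos (θ i) : ℂ)⁻¹ • (S.space none).orthogonalProjectionOnto y, ?_⟩
      change W i _ = y
      rw [hW]
      change (Real.cos (θ i) : ℂ)⁻¹ • S.proj (some i) ((Real.cos (θ i) : ℂ)⁻¹ • S.proj none y) = y
      have h1 := hr i y
      rw [S.proj_eq_self hy] at h1
      rw [map_smul, h1, smul_smul, smul_smul]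
      rw [← mul_one ((Real.cos (θ i) : ℂ) ^ 2), mul_assoc, key _ (hτ' i), one_smul]
  · rcases i with _ | i
    · rcases j with _ | j
      · rfl
      · change ⟪(x : H), W j y⟫_ℂ = ⟪x, gramB θ Q none (some j) y⟫_ℂ
        rw [hW, inner_smul_right, hi']
        simp only [gramB_none_some, smul_apply, ContinuousLinearMap.id_apply,
          inner_smul_right]
        field_simp [hτ' j]
    · rcases j with _ | j
      · change ⟪W i x, (y : H)⟫_ℂ = ⟪x, gramB θ Q (some i) none y⟫_ℂ
        rw [hW, inner_smul_left, S.inner_proj_left, hi', map_inv₀, Complex.conj_ofReal]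
        simp only [gramB_some_none, smul_apply, ContinuousLinearMap.id_apply,
          inner_smul_right]
        field_simp [hτ' i]
      · change ⟪W i x, W j y⟫_ℂ = ⟪x, gramB θ Q (some i) (some j) y⟫_ℂ
        by_cases hij : i = j
        · subst hij
          rw [(W i).inner_map_map, gramB_self]
          rfl
        rw [hW, hW, inner_smul_left, inner_smul_right, S.inner_proj_left, map_inv₀,
          Complex.conj_ofReal]
        by_cases hd : IsDottedPair i j
        · obtain ⟨k, ⟨rfl, rfl⟩ | ⟨rfl, rfl⟩⟩ := hd
          · rw [gramB_fst_snd, hQi, ← hpair]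
            ring
          · rw [gramB_snd_fst, hQi, ← hpair, hcom]
            ring
        · have h1 : S.proj (some i) (S.proj (some j) (y : H)) = 0 :=
            congrArg (fun T => T (y : H)) (h.ort i j hij hd)
          rw [h1, gramB_eq_zero _ hij hd]
          simp

end NormalForm

/-! ### Triangular factorization and construction of systems -/

section Construction

variable {H H₀ : Type*} [NormedAddCommGroup H] [InnerProductSpace ℂ H]
  [NormedAddCommGroup H₀] [InnerProductSpace ℂ H₀]

/-- The maps with Gram operator `gramB θ Q` built from maps `F i` with orthogonal ranges and
`(F i)^* F i = vertexDefect Q θ i`. -/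
noncomputable def gramMap (θ : Ray m r → ℝ) (Q : Fin m → H₀ →L[ℂ] H₀)
    (F : StarVertex m r → H₀ →ₗ[ℂ] H) : StarVertex m r → H₀ →ₗ[ℂ] H
  | none => F none + ∑ i, (Real.cos (θ i) : ℂ) • F (some i)
  | some (.fst k) => F (some (.fst k))
  | some (.snd k) => F (some (.fst k)) ∘ₗ (Q k).toLinearMap + F (some (.snd k))
  | some (.leaf j) => F (some (.leaf j))

variable {Q : Fin m → H₀ →L[ℂ] H₀} {F : StarVertex m r → H₀ →ₗ[ℂ] H}

-- `gramMap` is a triangular factor of the Gram operator: the orthogonal maps F i supply its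
-- diagonal, and the remaining coefficients are those of the successive projections of the V_i. The
-- entry at the centre is `defect_add_sum_rayDefect`; the entries of a pair reduce to Q_k² = Q_k and
-- Q_k + R_k = 1.
open Classical in
theorem inner_gramMap [CompleteSpace H₀] (hpair : ∀ k : Fin m, θ (.fst k) = θ (.snd k))
    (hQ : ∀ k, IsStarProjection (Q k))
    (hF : ∀ i j x y, ⟪F i x, F j y⟫_ℂ = if i = j then ⟪x, vertexDefect Q θ i y⟫_ℂ else 0)
    (i j : StarVertex m r) (x y : H₀) :
    ⟪gramMap θ Q F i x, gramMap θ Q F j y⟫_ℂ = ⟪x, gramB θ Q i j y⟫_ℂ := by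
  have hi : ∀ k y, Q k (Q k y) = Q k y := fun k => (hQ k).apply_apply
  have hs : ∀ k y z, ⟪Q k y, z⟫_ℂ = ⟪y, Q k z⟫_ℂ := fun k => (hQ k).inner_apply_left
  have hn : ∀ x, gramMap θ Q F none x = F none x + ∑ i, (Real.cos (θ i) : ℂ) • F (some i) x :=
    fun x => by simp [gramMap]
  have hfn : ∀ i x y, ⟪F (some i) x, gramMap θ Q F none y⟫_ℂ
      = (Real.cos (θ i) : ℂ) * ⟪x, rayDefect Q i y⟫_ℂ := fun i x y => by
    simp [hn, hF, vertexDefect,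
      -Complex.ofReal_cos]
  have hsn : ∀ (i : Ray m r) x y, ⟪gramMap θ Q F (some i) x, gramMap θ Q F none y⟫_ℂ
      = (Real.cos (θ i) : ℂ) * ⟪x, y⟫_ℂ := fun i x y => by
    cases i with
    | fst k => exact hfn _ _ _
    | leaf j => exact hfn _ _ _
    | snd k =>
      change ⟪F (some (.fst k)) (Q k x) + F (some (.snd k)) x, _⟫_ℂ = _
      rw [inner_add_left, hfn, hfn, hpair]
      simp only [rayDefect, ContinuousLinearMap.id_apply, sub_apply, inner_sub_right, hs]
      ring
  rcases i with _ | i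
  · rcases j with _ | j
    · have h1 : ⟪F none x, gramMap θ Q F none y⟫_ℂ = ⟪x, defect Q θ y⟫_ℂ := by
        simp [hn, hF, vertexDefect]
      rw [hn x, inner_add_left, h1, sum_inner]
      simp only [inner_smul_left, hfn, Complex.conj_ofReal, gramB_none_none,
        ContinuousLinearMap.id_apply]
      have h5 := congrArg (fun y => ⟪x, y⟫_ℂ) (defect_add_sum_rayDefect Q hpair y)
      simp only [inner_add_right, inner_sum, inner_smul_right] at h5
      exact h5
    · rw [← inner_conj_symm, hsn, map_mul, inner_conj_symm, Complex.conj_ofReal]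
      simp
  · rcases j with _ | j
    · rw [hsn]
      simp
    · cases i <;> cases j <;>
        simp only [gramMap, LinearMap.add_apply, LinearMap.comp_apply,
          ContinuousLinearMap.coe_coe, inner_add_left, inner_add_right, hF, vertexDefect, rayDefect,
          gramB, Option.some.injEq, Ray.fst.injEq, Ray.snd.injEq, Ray.leaf.injEq, reduceCtorEq,
          if_false, add_zero, zero_add, zero_apply, inner_zero_right] <;>
        split_ifs with hk <;>
        (try subst hk) <;>
        simp only [ContinuousLinearMap.id_apply, inner_zero_right, hs, hi, sub_apply,
          inner_sub_right, zero_apply, add_zero, add_sub_cancel]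

/-- The triangular relation can be solved for the F i, first at the end vertices and then at the
centre. Hence the constructed subspaces span whenever the ranges of the F i do. -/
theorem range_le_iSup_gramMap (i : StarVertex m r) (x : H₀) :
    F i x ∈ ⨆ j, LinearMap.range (gramMap θ Q F j) := by
  have hm : ∀ j y, gramMap θ Q F j y ∈ ⨆ j, LinearMap.range (gramMap θ Q F j) := fun j y =>
    Submodule.mem_iSup_of_mem j ⟨y, rfl⟩
  have hs : ∀ (j : Ray m r) y, F (some j) y ∈ ⨆ j, LinearMap.range (gramMap θ Q F j) :=
    fun j y => by
      cases j with
      | fst k => exact hm (some (.fst k)) y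
      | leaf j => exact hm (some (.leaf j)) y
      | snd k =>
        have h1 : F (some (.snd k)) y =
            gramMap θ Q F (some (.snd k)) y - gramMap θ Q F (some (.fst k)) (Q k y) := by
          simp [gramMap]
        rw [h1]
        exact sub_mem (hm _ _) (hm _ _)
  rcases i with _ | i
  · have h1 : F none x = gramMap θ Q F none x - ∑ i, (Real.cos (θ i) : ℂ) • F (some i) x := by
      simp [gramMap]
    rw [h1]
    exact sub_mem (hm _ _) (sum_mem fun j _ => Submodule.smul_mem _ _ (hs j x))
  · exact hs i x

-- The diagonal entries of `gramB` are identities, so the maps of the factorization are isometries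
-- and their ranges are closed.
open Classical in
theorem exists_isGramFamily_gramMap [CompleteSpace H₀]
    (hpair : ∀ k : Fin m, θ (.fst k) = θ (.snd k))
    (hQ : ∀ k, IsStarProjection (Q k))
    (hF : ∀ i j x y, ⟪F i x, F j y⟫_ℂ = if i = j then ⟪x, vertexDefect Q θ i y⟫_ℂ else 0) :
    ∃ (S : SubspaceSystem (StarVertex m r) H) (V : StarVertex m r → H₀ →ₗᵢ[ℂ] H),
      S.IsGramFamily (gramB θ Q) V ∧ (∀ i x, V i x = gramMap θ Q F i x) ∧
      ∀ i x, F i x ∈ ⨆ j, S.space j := by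
  let V : StarVertex m r → H₀ →ₗᵢ[ℂ] H := fun i =>
    (gramMap θ Q F i).isometryOfInner fun x y => by
      rw [inner_gramMap hpair hQ hF, gramB_self]
      rfl
  refine ⟨⟨fun i => LinearMap.range (V i).toLinearMap, fun i => ?_⟩, V, ⟨fun i => rfl,
    inner_gramMap hpair hQ hF⟩, fun i x => rfl, range_le_iSup_gramMap⟩
  exact (V i).isometry.isClosedEmbedding.isClosed_range

end Construction

end SubspaceSystem

/-- A linear isomorphism of Hilbert spaces of the same finite dimension can be chosen isometric. -/
theorem nonempty_euclidean_linearIsometryEquiv {G : Type*} [NormedAddCommGroup G]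
    [InnerProductSpace ℂ G] [FiniteDimensional ℂ G] {d : ℕ} (h : Module.finrank ℂ G = d) :
    Nonempty (G ≃ₗᵢ[ℂ] EuclideanSpace ℂ (Fin d)) :=
  ⟨((stdOrthonormalBasis ℂ G).reindex (finCongr h)).repr⟩

theorem finrank_range_eq_one {G G' : Type*} [AddCommGroup G] [Module ℂ G] [AddCommGroup G']
    [Module ℂ G'] (f : G →ₗ[ℂ] G') (v : G') (h : ∀ x, ∃ c : ℂ, f x = c • v) (hf : f ≠ 0) :
    Module.finrank ℂ (LinearMap.range f) = 1 := by
  have hx : ∃ x, f x ≠ 0 := by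
    by_contra! hx
    exact hf (LinearMap.ext hx)
  obtain ⟨x, hx⟩ := hx
  obtain ⟨c, hc⟩ := h x
  have hc0 : c ≠ 0 := fun h0 => hx (by rw [hc, h0, zero_smul])
  have hv : v ≠ 0 := fun h0 => hx (by rw [hc, h0, smul_zero])
  have : LinearMap.range f = Submodule.span ℂ {v} := by
    refine le_antisymm ?_ ?_
    · rintro _ ⟨y, rfl⟩
      obtain ⟨b, hb⟩ := h y
      exact hb ▸ Submodule.smul_mem _ _ (Submodule.mem_span_singleton_self v)
    · rw [Submodule.span_singleton_le_iff_mem]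
      exact ⟨c⁻¹ • x, by rw [map_smul, hc, smul_smul, inv_mul_cancel₀ hc0, one_smul]⟩
  rw [this, finrank_span_singleton hv]

/-! ### Finite-dimensional realization -/

namespace SubspaceSystem

variable {m r : ℕ} {θ : Ray m r → ℝ}

/-- Existence of the finite-dimensional system with Gram operator `gramB θ Q`; `T` is a root of the
defect operator. -/
theorem exists_hasGram_euclidean {H₀ : Type*} [NormedAddCommGroup H₀] [InnerProductSpace ℂ H₀]
    [FiniteDimensional ℂ H₀] {Q : Fin m → H₀ →L[ℂ] H₀} (hQ : ∀ k, IsStarProjection (Q k))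
    (hpair : ∀ k : Fin m, θ (.fst k) = θ (.snd k)) (T : H₀ →ₗ[ℂ] H₀)
    (hT : ∀ x y, ⟪T x, T y⟫_ℂ = ⟪x, defect Q θ y⟫_ℂ) {d : ℕ}
    (hd : Module.finrank ℂ (LinearMap.range T) + (m + r) * Module.finrank ℂ H₀ +
      ∑ k, Module.finrank ℂ (LinearMap.range
        (ContinuousLinearMap.id ℂ H₀ - Q k : H₀ →L[ℂ] H₀).toLinearMap) = d) :
    ∃ S : SubspaceSystem (StarVertex m r) (EuclideanSpace ℂ (Fin d)), S.HasGram (gramB θ Q) := by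
  classical
  have : CompleteSpace H₀ := FiniteDimensional.complete ℂ H₀
  -- Each t i is a root of `vertexDefect` at i; at the end vertices the operator is a projection and
  -- its own root. Taking the ranges of the t i, instead of copies of H₀, as summands of the model
  -- space makes the subspaces span it and gives the dimension d.
  let t : StarVertex m r → H₀ →ₗ[ℂ] H₀ := fun i => i.elim T fun j => (rayDefect Q j).toLinearMap
  have ht : ∀ i x y, ⟪t i x, t i y⟫_ℂ = ⟪x, vertexDefect Q θ i y⟫_ℂ := fun i x y => by
    rcases i with _ | i
    · exact hT x y
    change ⟪rayDefect Q i x, rayDefect Q i y⟫_ℂ = ⟪x, rayDefect Q i y⟫_ℂ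
    cases i <;> simp only [rayDefect, ContinuousLinearMap.id_apply, sub_apply, inner_sub_left,
      inner_sub_right, (hQ _).inner_apply_left, (hQ _).apply_apply, sub_self, sub_zero]
  let G := PiLp 2 fun i : StarVertex m r => LinearMap.range (t i)
  have hG : Module.finrank ℂ G = d := by
    rw [(WithLp.linearEquiv 2 ℂ (∀ i : StarVertex m r, LinearMap.range (t i))).finrank_eq,
      Module.finrank_pi_fintype, Fintype.sum_option, Ray.sum_eq, ← hd]
    have hid : Module.finrank ℂ (LinearMap.range (LinearMap.id : H₀ →ₗ[ℂ] H₀))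
        = Module.finrank ℂ H₀ := by
      rw [LinearMap.range_id, finrank_top]
    have h1 : ∀ k, Module.finrank ℂ (LinearMap.range (t (some (.fst k)))) = Module.finrank ℂ H₀ :=
      fun k => hid
    have h2 : ∀ j, Module.finrank ℂ (LinearMap.range (t (some (.leaf j)))) = Module.finrank ℂ H₀ :=
      fun j => hid
    simp only [h1, h2, Finset.sum_const, Finset.card_univ, Fintype.card_fin, smul_eq_mul, add_mul]
    rw [add_assoc, add_assoc, add_assoc (m * _) (r * _), add_comm (r * _)]
    rfl
  obtain ⟨u⟩ := nonempty_euclidean_linearIsometryEquiv hG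
  let F : StarVertex m r → H₀ →ₗ[ℂ] EuclideanSpace ℂ (Fin d) := fun i =>
    u.toLinearEquiv.toLinearMap ∘ₗ
      (WithLp.linearEquiv 2 ℂ (∀ i : StarVertex m r, LinearMap.range (t i))).symm.toLinearMap ∘ₗ
      LinearMap.single ℂ _ i ∘ₗ (t i).rangeRestrict
  have hFu : ∀ i x, F i x = u (WithLp.toLp 2 (Pi.single i ((t i).rangeRestrict x))) :=
    fun i x => rfl
  have hF : ∀ i j x y, ⟪F i x, F j y⟫_ℂ = if i = j then ⟪x, vertexDefect Q θ i y⟫_ℂ else 0 := by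
    intro i j x y
    rw [hFu, hFu, u.inner_map_map, PiLp.inner_apply, Finset.sum_eq_single i]
    · by_cases hij : i = j
      · subst hij
        simp only [Pi.single_eq_same, if_true]
        exact ht i x y
      · simp [hij]
    · intro l _ hl
      simp [hl]
    · simp
  obtain ⟨S, V, hV, -, hS⟩ := exists_isGramFamily_gramMap hpair hQ hF
  refine ⟨S, V, hV.range_eq, hV.inner_eq, ?_⟩
  have htop : (⨆ i, S.space i) = ⊤ := by
    refine eq_top_iff.2 fun z _ => ?_
    have hz : z = u (u.symm z) := (u.apply_symm_apply z).symm
    have hsum : u.symm z = ∑ i, WithLp.toLp 2 (Pi.single i (u.symm z i)) := by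
      ext i
      rw [WithLp.ofLp_sum, Finset.sum_apply, Finset.sum_eq_single i]
      · simp
      · intro j _ hj
        simp [hj.symm]
      · simp
    rw [hz, hsum, map_sum]
    refine sum_mem fun i _ => ?_
    obtain ⟨x, hx⟩ := (u.symm z i).2
    have : u.symm z i = (t i).rangeRestrict x := Subtype.ext hx.symm
    rw [this, ← hFu]
    exact hS i x
  rw [htop]
  exact eq_top_iff.2 (Submodule.le_topologicalClosure _)

/-- An operator commuting with all P_i comes from an operator on H₀ commuting with all Q_k; once the
latter is scalar, density of the span makes the former the same scalar. -/
theorem HasGram.isIrreducible {H : Type u} {H₀ : Type v} [NormedAddCommGroup H]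
    [InnerProductSpace ℂ H] [CompleteSpace H] [NormedAddCommGroup H₀] [InnerProductSpace ℂ H₀]
    [CompleteSpace H₀] {S : SubspaceSystem (StarVertex m r) H} {Q : Fin m → H₀ →L[ℂ] H₀}
    (hS : S.HasGram (gramB θ Q)) (hτ : ∀ i, Real.cos (θ i) ≠ 0)
    (hirr : ∀ C : H₀ →L[ℂ] H₀, (∀ k x, C (Q k x) = Q k (C x)) → ∃ c : ℂ, ∀ x, C x = c • x) :
    S.IsIrreducible := by
  obtain ⟨V, hV, hd⟩ := hS.exists_isGramFamily
  intro D hD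
  obtain ⟨C, hC, hCQ⟩ := hV.exists_intertwiner hV hτ D fun i x => congrArg (fun T => T x) (hD i)
  obtain ⟨c, hc⟩ := hirr C hCQ
  exact ⟨c, hV.ext_of_dense hd fun i x => by simp [hC, hc]⟩

theorem HasGram.rank_space {ι : Type} {H : Type u} {H₀ : Type v} [NormedAddCommGroup H]
    [InnerProductSpace ℂ H] [NormedAddCommGroup H₀] [InnerProductSpace ℂ H₀]
    [FiniteDimensional ℂ H₀] {S : SubspaceSystem ι H} {B : ι → ι → H₀ →L[ℂ] H₀}
    (hS : S.HasGram B) (i : ι) : Module.rank ℂ (S.space i) = Module.finrank ℂ H₀ := by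
  obtain ⟨V, hV, -⟩ := hS
  have e := LinearEquiv.ofInjective (V i).toLinearMap (V i).injective
  have : FiniteDimensional ℂ (LinearMap.range (V i).toLinearMap) := e.finiteDimensional
  rw [← hV i, ← Module.finrank_eq_rank, e.finrank_eq]

end SubspaceSystem

/-! ### Two projections at an angle in the plane -/

section TwoDim

theorem isStarProjection_matR₁ : IsStarProjection matR₁ := by
  refine ⟨?_, ?_⟩
  · rw [IsIdempotentElem]
    ext i j
    fin_cases i <;> fin_cases j <;> simp [matR₁, Matrix.mul_apply, Fin.sum_univ_two]
  · rw [IsSelfAdjoint]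
    ext i j
    fin_cases i <;> fin_cases j <;> simp [matR₁, Matrix.star_apply]

theorem Complex.ofReal_cos_sq_add_sin_sq (φ : ℝ) :
    (Real.cos φ : ℂ) ^ 2 + (Real.sin φ : ℂ) ^ 2 = 1 := by
  rw [← Complex.ofReal_pow, ← Complex.ofReal_pow, ← Complex.ofReal_add, Real.cos_sq_add_sin_sq,
    Complex.ofReal_one]

theorem isStarProjection_matR₂ (φ : ℝ) : IsStarProjection (matR₂ φ) := by
  have h := Complex.ofReal_cos_sq_add_sin_sq φ
  refine ⟨?_, ?_⟩
  · rw [IsIdempotentElem]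
    ext i j
    fin_cases i <;> fin_cases j <;>
      simp [matR₂, Matrix.mul_apply, Fin.sum_univ_two, -Complex.ofReal_cos, -Complex.ofReal_sin]
    · linear_combination (Real.cos φ : ℂ) ^ 2 * h
    · linear_combination (Real.cos φ : ℂ) * (Real.sin φ : ℂ) * h
    · linear_combination (Real.cos φ : ℂ) * (Real.sin φ : ℂ) * h
    · linear_combination (Real.sin φ : ℂ) ^ 2 * h
  · rw [IsSelfAdjoint]
    ext i j
    fin_cases i <;> fin_cases j <;>
      simp [matR₂, Matrix.star_apply, -Complex.ofReal_cos, -Complex.ofReal_sin]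

variable {m : ℕ}

/-- The matrices of the projections `R_k`. -/
noncomputable def pairR (k₁ k₂ : Fin m) (φ : ℝ) (k : Fin m) : Matrix (Fin 2) (Fin 2) ℂ :=
  if k = k₁ then matR₁ else if k = k₂ then matR₂ φ else 0

theorem pairQ_eq (k₁ k₂ : Fin m) (φ : ℝ) (k : Fin m) :
    pairQ k₁ k₂ φ k = Matrix.toEuclideanCLM (𝕜 := ℂ) (1 - pairR k₁ k₂ φ k) := by
  unfold pairQ pairR
  split_ifs <;> simp

theorem isStarProjection_pairR (k₁ k₂ : Fin m) (φ : ℝ) (k : Fin m) :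
    IsStarProjection (pairR k₁ k₂ φ k) := by
  unfold pairR
  split_ifs
  · exact isStarProjection_matR₁
  · exact isStarProjection_matR₂ φ
  · exact .zero _

theorem isStarProjection_pairQ (k₁ k₂ : Fin m) (φ : ℝ) (k : Fin m) :
    IsStarProjection (pairQ k₁ k₂ φ k) := by
  rw [pairQ_eq]
  exact (isStarProjection_pairR k₁ k₂ φ k).one_sub.map
    (Matrix.toEuclideanCLM (n := Fin 2) (𝕜 := ℂ))

theorem id_sub_pairQ (k₁ k₂ : Fin m) (φ : ℝ) (k : Fin m) :
    ContinuousLinearMap.id ℂ _ - pairQ k₁ k₂ φ k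
      = Matrix.toEuclideanCLM (𝕜 := ℂ) (pairR k₁ k₂ φ k) := by
  rw [pairQ_eq, map_sub, map_one]
  exact sub_sub_cancel _ _

/-- Operators commuting with the two projections at angle `φ` are scalar. -/
theorem exists_eq_smul_of_commute_pairQ {k₁ k₂ : Fin m} (hk : k₁ ≠ k₂) {φ : ℝ}
    (hφ : φ ∈ Set.Ioo 0 (Real.pi / 2))
    (C : EuclideanSpace ℂ (Fin 2) →L[ℂ] EuclideanSpace ℂ (Fin 2))
    (hC : ∀ k x, C (pairQ k₁ k₂ φ k x) = pairQ k₁ k₂ φ k (C x)) : ∃ c : ℂ, ∀ x, C x = c • x := by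
  obtain ⟨M, rfl⟩ : ∃ M, Matrix.toEuclideanCLM (n := Fin 2) (𝕜 := ℂ) M = C :=
    (Matrix.toEuclideanCLM (n := Fin 2) (𝕜 := ℂ)).surjective C
  have hc : (Real.cos φ : ℂ) ≠ 0 := Complex.ofReal_ne_zero.2
    (Real.cos_pos_of_mem_Ioo ⟨by linarith [hφ.1, hφ.2], hφ.2⟩).ne'
  have hs : (Real.sin φ : ℂ) ≠ 0 := Complex.ofReal_ne_zero.2
    (Real.sin_pos_of_pos_of_lt_pi hφ.1 (by linarith [hφ.1, hφ.2])).ne'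
  have hM : ∀ k, M * pairR k₁ k₂ φ k = pairR k₁ k₂ φ k * M := fun k => by
    have h1 : Matrix.toEuclideanCLM (𝕜 := ℂ) M * pairQ k₁ k₂ φ k
        = pairQ k₁ k₂ φ k * Matrix.toEuclideanCLM (𝕜 := ℂ) M := by
      ext1 x; exact hC k x
    rw [pairQ_eq, ← map_mul, ← map_mul] at h1
    have h2 := (Matrix.toEuclideanCLM (n := Fin 2) (𝕜 := ℂ)).injective h1
    simpa [mul_sub, sub_mul] using h2
  have h1 := hM k₁
  have h2 := hM k₂
  simp only [pairR, if_true, hk.symm, if_false] at h1 h2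
  -- Commuting with the first projection makes M diagonal; commuting with the second then equates
  -- the diagonal entries, as cos φ sin φ ≠ 0.
  have h01 : M 0 1 = 0 := by
    have := congrFun (congrFun h1 0) 1
    simpa [matR₁, Matrix.mul_apply, Fin.sum_univ_two] using this.symm
  have h10 : M 1 0 = 0 := by
    have := congrFun (congrFun h1 1) 0
    simpa [matR₁, Matrix.mul_apply, Fin.sum_univ_two] using this
  have h00 : M 0 0 = M 1 1 := by
    have := congrFun (congrFun h2 0) 1
    simp only [matR₂, Matrix.mul_apply, Fin.sum_univ_two, h01, Matrix.of_apply, Matrix.cons_val',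
      Matrix.cons_val_zero, Matrix.cons_val_one, Matrix.cons_val_fin_one, zero_mul, mul_zero,
      add_zero, zero_add] at this
    exact mul_right_cancel₀ (mul_ne_zero hc hs) (this.trans (mul_comm _ _))
  refine ⟨M 0 0, fun x => ?_⟩
  have : M = M 0 0 • 1 := by
    ext i j
    fin_cases i <;> fin_cases j <;> simp [h01, h10, h00]
  conv_lhs => rw [this, map_smul, map_one]
  rfl

variable {r : ℕ} {θ : Ray m r → ℝ}

/-- The defect operator of the two projections at angle `φ`. -/
theorem defect_pairQ {k₁ k₂ : Fin m} (hk : k₁ ≠ k₂) (φ : ℝ) :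
    defect (pairQ k₁ k₂ φ) θ = Matrix.toEuclideanCLM (𝕜 := ℂ)
      ((xi θ : ℂ) • 1 - (tauSq θ k₁ : ℂ) • matR₁ - (tauSq θ k₂ : ℂ) • matR₂ φ) := by
  unfold defect
  simp only [id_sub_pairQ]
  rw [map_sub, map_sub, map_smul, map_one, map_smul, map_smul, sub_sub]
  congr 1
  rw [Finset.sum_eq_add k₁ k₂ hk]
  · simp only [pairR, if_true, hk.symm, if_false]
  · intro k _ h
    simp [pairR, h.1, h.2]
  · simp
  · simp

theorem re_inner_defect_pairQ {k₁ k₂ : Fin m} (hk : k₁ ≠ k₂) (φ : ℝ) (a b : ℝ) :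
    (⟪!₂[(a : ℂ), (b : ℂ)], defect (pairQ k₁ k₂ φ) θ !₂[(a : ℂ), (b : ℂ)]⟫_ℂ).re
      = (xi θ - tauSq θ k₁ - tauSq θ k₂ * Real.cos φ ^ 2) * a ^ 2
        - 2 * (tauSq θ k₂ * (Real.cos φ * Real.sin φ)) * (a * b)
        + (xi θ - tauSq θ k₂ * Real.sin φ ^ 2) * b ^ 2 := by
  rw [defect_pairQ hk, PiLp.inner_apply, Fin.sum_univ_two, Matrix.ofLp_toEuclideanCLM]
  simp only [Matrix.mulVec, dotProduct, Fin.sum_univ_two, matR₁, matR₂, Matrix.sub_apply,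
    Matrix.smul_apply, Matrix.of_apply, Matrix.cons_val', Matrix.cons_val_zero,
    Matrix.cons_val_one, Matrix.cons_val_fin_one, Matrix.one_apply, RCLike.inner_apply,
    Complex.conj_ofReal, smul_eq_mul, ← Complex.ofReal_pow, ← Complex.ofReal_mul]
  norm_num
  norm_cast
  ring

/-- Positivity of the defect restricts the angle. -/
theorem mul_cos_sq_le_of_defect_nonneg {k₁ k₂ : Fin m} (hk : k₁ ≠ k₂) {φ : ℝ}
    (h2 : tauSq θ k₂ < xi θ) (h2' : 0 ≤ tauSq θ k₂)
    (h : ∀ x, 0 ≤ (⟪x, defect (pairQ k₁ k₂ φ) θ x⟫_ℂ).re) :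
    tauSq θ k₁ * tauSq θ k₂ * Real.cos φ ^ 2
      ≤ (xi θ - tauSq θ k₁) * (xi θ - tauSq θ k₂) := by
  have hδ : 0 < xi θ - tauSq θ k₂ * Real.sin φ ^ 2 := by
    nlinarith [Real.sin_sq_le_one φ]
  -- For a form αx² - 2βxy + δy² the vector (δ, β) gives δ(αδ - β²), that is, δ times the
  -- determinant; here δ > 0.
  have h1 := h !₂[((xi θ - tauSq θ k₂ * Real.sin φ ^ 2 : ℝ) : ℂ),
    ((tauSq θ k₂ * (Real.cos φ * Real.sin φ) : ℝ) : ℂ)]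
  rw [re_inner_defect_pairQ hk] at h1
  have hcs := Real.cos_sq_add_sin_sq φ
  have h3 : 0 ≤ (xi θ - tauSq θ k₂ * Real.sin φ ^ 2) * ((xi θ - tauSq θ k₁) * (xi θ - tauSq θ k₂)
      - tauSq θ k₁ * tauSq θ k₂ * Real.cos φ ^ 2) := by
    refine h1.trans_eq ?_
    have : Real.sin φ ^ 2 = 1 - Real.cos φ ^ 2 := by linarith
    simp only [mul_pow, this]
    ring_nf
    simp only [this]
    ring
  linarith [nonneg_of_mul_nonneg_right h3 hδ]

/-- A triangular root of the defect operator of two projections at angle `φ`, with its rank. -/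
theorem exists_root_defect_pairQ {k₁ k₂ : Fin m} (hk : k₁ ≠ k₂) {φ : ℝ}
    (h2 : tauSq θ k₂ < xi θ) (h2' : 0 ≤ tauSq θ k₂)
    (h : tauSq θ k₁ * tauSq θ k₂ * Real.cos φ ^ 2
      ≤ (xi θ - tauSq θ k₁) * (xi θ - tauSq θ k₂)) :
    ∃ T : EuclideanSpace ℂ (Fin 2) →ₗ[ℂ] EuclideanSpace ℂ (Fin 2),
      (∀ x y, ⟪T x, T y⟫_ℂ = ⟪x, defect (pairQ k₁ k₂ φ) θ y⟫_ℂ) ∧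
      (tauSq θ k₁ * tauSq θ k₂ * Real.cos φ ^ 2
        < (xi θ - tauSq θ k₁) * (xi θ - tauSq θ k₂) →
          Module.finrank ℂ (LinearMap.range T) = 2) ∧
      (tauSq θ k₁ * tauSq θ k₂ * Real.cos φ ^ 2
        = (xi θ - tauSq θ k₁) * (xi θ - tauSq θ k₂) →
          Module.finrank ℂ (LinearMap.range T) = 1) := by
  set a := tauSq θ k₁ with ha
  set b := tauSq θ k₂ with hb
  set ξ := xi θ with hξ
  set δ := ξ - b * Real.sin φ ^ 2 with hδdef
  have hδ : 0 < δ := by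
    nlinarith [Real.sin_sq_le_one φ]
  set Δ := (ξ - a) * (ξ - b) - a * b * Real.cos φ ^ 2 with hΔ
  have hΔ0 : 0 ≤ Δ := sub_nonneg.2 h
  have hcs := Real.cos_sq_add_sin_sq φ
  -- The root has rows (t, 0) and (w, v): v² is the lower right entry δ of the defect, wv the
  -- off-diagonal entry, and t² = Δ/δ with Δ the determinant. Since v > 0, its rank is 1 or 2
  -- according to whether Δ vanishes.
  set t := Real.sqrt (Δ / δ) with ht
  set v := Real.sqrt δ with hv
  set w := -(b * (Real.cos φ * Real.sin φ)) / v with hw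
  have hv0 : 0 < v := Real.sqrt_pos.2 hδ
  have hv2 : v ^ 2 = δ := Real.sq_sqrt hδ.le
  have hwv : w * v = -(b * (Real.cos φ * Real.sin φ)) := by rw [hw]; field_simp
  have htw : t ^ 2 + w ^ 2 = ξ - a - b * Real.cos φ ^ 2 := by
    have ht2 : t ^ 2 * δ = Δ := by rw [ht, Real.sq_sqrt (by positivity)]; field_simp
    have hw2 : w ^ 2 * δ = (b * (Real.cos φ * Real.sin φ)) ^ 2 := by
      rw [← hv2, ← mul_pow, hwv, neg_sq]
    refine mul_right_cancel₀ hδ.ne' ?_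
    rw [add_mul, ht2, hw2]
    have : Real.sin φ ^ 2 = 1 - Real.cos φ ^ 2 := by linarith
    simp only [hΔ, hδdef, mul_pow, this]
    ring
  let M : Matrix (Fin 2) (Fin 2) ℂ := !![(t : ℂ), 0; (w : ℂ), (v : ℂ)]
  have hMM : star M * M = (ξ : ℂ) • 1 - (a : ℂ) • matR₁ - (b : ℂ) • matR₂ φ := by
    ext i j
    fin_cases i <;> fin_cases j <;>
      simp [M, matR₁, matR₂, Matrix.mul_apply, Fin.sum_univ_two, -Complex.ofReal_cos,
        -Complex.ofReal_sin] <;> norm_cast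
    · linear_combination htw
    · linear_combination hwv
    · linear_combination hv2
  have hTx : ∀ x, Matrix.toEuclideanCLM (𝕜 := ℂ) M x
      = !₂[(t : ℂ) * x 0, (w : ℂ) * x 0 + (v : ℂ) * x 1] := fun x => by
    ext i
    rw [Matrix.ofLp_toEuclideanCLM]
    fin_cases i <;> simp [M, Matrix.mulVec, dotProduct, Fin.sum_univ_two]
  refine ⟨(Matrix.toEuclideanCLM (𝕜 := ℂ) M).toLinearMap, fun x y => ?_, fun hlt => ?_,
    fun heq => ?_⟩
  · rw [defect_pairQ hk, ← hMM, map_mul, map_star, ContinuousLinearMap.star_eq_adjoint]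
    exact (ContinuousLinearMap.adjoint_inner_right _ _ _).symm
  · have ht0 : (t : ℂ) ≠ 0 :=
      Complex.ofReal_ne_zero.2 (Real.sqrt_pos.2 (div_pos (sub_pos.2 hlt) hδ)).ne'
    have hinj : Function.Injective (Matrix.toEuclideanCLM (𝕜 := ℂ) M).toLinearMap := by
      rw [← LinearMap.ker_eq_bot, LinearMap.ker_eq_bot']
      intro x hx
      have hx' : Matrix.toEuclideanCLM (𝕜 := ℂ) M x = 0 := hx
      rw [hTx] at hx'
      have h0 := congrArg (fun z : EuclideanSpace ℂ (Fin 2) => z 0) hx'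
      have h1 := congrArg (fun z : EuclideanSpace ℂ (Fin 2) => z 1) hx'
      simp [ht0] at h0
      simp [h0, hv0.ne'] at h1
      ext i
      fin_cases i <;> simp [h0, h1]
    rw [LinearMap.finrank_range_of_inj hinj, finrank_euclideanSpace, Fintype.card_fin]
  · have ht0 : t = 0 := by rw [ht, hΔ, heq, sub_self, zero_div, Real.sqrt_zero]
    refine finrank_range_eq_one _ !₂[(0 : ℂ), 1] (fun x => ?_) fun h0 => ?_
    · refine ⟨(w : ℂ) * x 0 + (v : ℂ) * x 1, ?_⟩
      refine (hTx x).trans ?_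
      ext i
      fin_cases i <;> simp [ht0]
    · have h1 := congrArg (fun f => f !₂[(0 : ℂ), 1] 1) h0
      have h2 := congrArg (fun z : EuclideanSpace ℂ (Fin 2) => z 1) (hTx !₂[(0 : ℂ), 1])
      have h3 : (v : ℂ) = 0 := by simpa using h2.symm.trans h1
      exact hv0.ne' (Complex.ofReal_eq_zero.1 h3)

theorem finrank_range_pairR {k₁ k₂ : Fin m} (hk : k₁ ≠ k₂) (φ : ℝ) :
    ∑ k, Module.finrank ℂ (LinearMap.range (ContinuousLinearMap.id ℂ _ - pairQ k₁ k₂ φ k :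
      EuclideanSpace ℂ (Fin 2) →L[ℂ] EuclideanSpace ℂ (Fin 2)).toLinearMap) = 2 := by
  have h1 : Module.finrank ℂ (LinearMap.range
      (Matrix.toEuclideanCLM (n := Fin 2) (𝕜 := ℂ) matR₁).toLinearMap) = 1 := by
    have hx : ∀ x, Matrix.toEuclideanCLM (𝕜 := ℂ) matR₁ x = x 0 • !₂[(1 : ℂ), 0] := fun x => by
      ext i
      rw [Matrix.ofLp_toEuclideanCLM]
      fin_cases i <;> simp [matR₁, Matrix.mulVec, dotProduct, Fin.sum_univ_two]
    refine finrank_range_eq_one _ !₂[(1 : ℂ), 0] (fun x => ⟨x 0, hx x⟩) fun h0 => ?_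
    have h1 := congrArg (fun f => f !₂[(1 : ℂ), 0] 0) h0
    have h2 := congrArg (fun z : EuclideanSpace ℂ (Fin 2) => z 0) (hx !₂[(1 : ℂ), 0])
    simpa using h2.symm.trans h1
  have h2 : Module.finrank ℂ (LinearMap.range
      (Matrix.toEuclideanCLM (n := Fin 2) (𝕜 := ℂ) (matR₂ φ)).toLinearMap) = 1 := by
    have hx : ∀ x, Matrix.toEuclideanCLM (𝕜 := ℂ) (matR₂ φ) x
        = ((Real.cos φ : ℂ) * x 0 + (Real.sin φ : ℂ) * x 1) •
          !₂[(Real.cos φ : ℂ), (Real.sin φ : ℂ)] := fun x => by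
      ext i
      rw [Matrix.ofLp_toEuclideanCLM]
      fin_cases i <;> simp [matR₂, Matrix.mulVec, dotProduct, Fin.sum_univ_two] <;> ring
    refine finrank_range_eq_one _ _ (fun x => ⟨_, hx x⟩) fun h0 => ?_
    have h1 := congrArg (fun f => f !₂[(Real.cos φ : ℂ), (Real.sin φ : ℂ)]) h0
    have h2 := (hx !₂[(Real.cos φ : ℂ), (Real.sin φ : ℂ)]).symm.trans h1
    have h3 := Complex.ofReal_cos_sq_add_sin_sq φ
    simp only [Matrix.cons_val_zero, Matrix.cons_val_one, Matrix.cons_val_fin_one,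
      ← pow_two, h3, one_smul] at h2
    have h4 := congrArg (fun z : EuclideanSpace ℂ (Fin 2) => z 0) h2
    have h5 := congrArg (fun z : EuclideanSpace ℂ (Fin 2) => z 1) h2
    simp [-Complex.ofReal_cos, -Complex.ofReal_sin] at h4 h5
    simp [-Complex.ofReal_cos, -Complex.ofReal_sin, h4, h5] at h3
  have h3 : ∀ k, Module.finrank ℂ (LinearMap.range (ContinuousLinearMap.id ℂ _ - pairQ k₁ k₂ φ k :
      EuclideanSpace ℂ (Fin 2) →L[ℂ] EuclideanSpace ℂ (Fin 2)).toLinearMap)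
      = if k = k₁ then 1 else if k = k₂ then 1 else 0 := fun k => by
    rw [id_sub_pairQ]
    by_cases e₁ : k = k₁
    · rw [show pairR k₁ k₂ φ k = matR₁ from if_pos e₁, if_pos e₁, h1]
    rw [if_neg e₁]
    by_cases e₂ : k = k₂
    · rw [show pairR k₁ k₂ φ k = matR₂ φ from (if_neg e₁).trans (if_pos e₂), if_pos e₂, h2]
    · rw [show pairR k₁ k₂ φ k = 0 from (if_neg e₁).trans (if_neg e₂), if_neg e₂, map_zero]
      simp
  rw [Finset.sum_congr rfl fun k _ => h3 k, Finset.sum_eq_add k₁ k₂ hk]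
  · simp [hk.symm]
  · intro k _ h
    simp [h.1, h.2]
  · simp
  · simp

end TwoDim

/-! ### Projections in a line, and invariants of the models -/

section OneDim

variable {m r : ℕ} {θ : Ray m r → ℝ}

/-- The projections in a one-dimensional space with `Q_k = 0` for `k ∈ s` and `Q_k = 1` for
`k ∉ s`. -/
noncomputable def unitQ (s : Finset (Fin m)) (k : Fin m) :
    EuclideanSpace ℂ (Fin 1) →L[ℂ] EuclideanSpace ℂ (Fin 1) :=
  if k ∈ s then 0 else ContinuousLinearMap.id ℂ _

theorem isStarProjection_unitQ (s : Finset (Fin m)) (k : Fin m) : IsStarProjection (unitQ s k) := by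
  unfold unitQ
  split_ifs
  · exact .zero _
  · exact .one _

theorem id_sub_unitQ (s : Finset (Fin m)) (k : Fin m) : ContinuousLinearMap.id ℂ _ - unitQ s k
    = if k ∈ s then ContinuousLinearMap.id ℂ (EuclideanSpace ℂ (Fin 1)) else 0 := by
  unfold unitQ
  split_ifs <;> simp

theorem defect_unitQ (s : Finset (Fin m)) (x : EuclideanSpace ℂ (Fin 1)) :
    defect (unitQ s) θ x = ((xi θ - ∑ k ∈ s, tauSq θ k : ℝ) : ℂ) • x := by
  unfold defect
  have : ∀ k, (tauSq θ k : ℂ) • (ContinuousLinearMap.id ℂ (EuclideanSpace ℂ (Fin 1)) - unitQ s k)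
      = if k ∈ s then (tauSq θ k : ℂ) • ContinuousLinearMap.id ℂ (EuclideanSpace ℂ (Fin 1))
        else 0 := fun k => by
    rw [id_sub_unitQ]
    split_ifs
    · rfl
    · ext1 y
      change (tauSq θ k : ℂ) • (0 : EuclideanSpace ℂ (Fin 1)) = 0
      rw [smul_zero]
  rw [Finset.sum_congr rfl fun k _ => this k, Finset.sum_ite_mem, Finset.univ_inter,
    ← Finset.sum_smul, ← sub_smul]
  simp

theorem finrank_range_id_sub_unitQ (s : Finset (Fin m)) :
    ∑ k, Module.finrank ℂ (LinearMap.range (ContinuousLinearMap.id ℂ _ - unitQ s k :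
      EuclideanSpace ℂ (Fin 1) →L[ℂ] EuclideanSpace ℂ (Fin 1)).toLinearMap) = s.card := by
  have h2 : ∀ k, Module.finrank ℂ (LinearMap.range (ContinuousLinearMap.id ℂ _ -
      unitQ s k : EuclideanSpace ℂ (Fin 1) →L[ℂ] EuclideanSpace ℂ (Fin 1)).toLinearMap)
      = if k ∈ s then 1 else 0 := fun k => by
    rw [id_sub_unitQ]
    by_cases hk : k ∈ s
    · rw [if_pos hk, if_pos hk]
      change Module.finrank ℂ (LinearMap.range
        (LinearMap.id : EuclideanSpace ℂ (Fin 1) →ₗ[ℂ] EuclideanSpace ℂ (Fin 1))) = 1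
      rw [LinearMap.range_id, finrank_top, finrank_euclideanSpace, Fintype.card_fin]
    · rw [if_neg hk, if_neg hk]
      change Module.finrank ℂ (LinearMap.range
        (0 : EuclideanSpace ℂ (Fin 1) →ₗ[ℂ] EuclideanSpace ℂ (Fin 1))) = 0
      rw [LinearMap.range_zero, finrank_bot]
  rw [Finset.sum_congr rfl fun k _ => h2 k]
  simp

open Classical in
theorem finrank_range_sqrt_smul_id {a : ℝ} (ha : 0 ≤ a) :
    Module.finrank ℂ (LinearMap.range ((Real.sqrt a : ℂ) •
      (LinearMap.id : EuclideanSpace ℂ (Fin 1) →ₗ[ℂ] EuclideanSpace ℂ (Fin 1))))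
      = if a = 0 then 0 else 1 := by
  split_ifs with h
  · rw [h, Real.sqrt_zero, Complex.ofReal_zero, zero_smul, LinearMap.range_zero, finrank_bot]
  · have h2 : (Real.sqrt a : ℂ) ≠ 0 :=
      Complex.ofReal_ne_zero.2 (Real.sqrt_ne_zero'.2 (lt_of_le_of_ne ha (Ne.symm h)))
    rw [LinearMap.range_smul _ _ h2, LinearMap.range_id, finrank_top, finrank_euclideanSpace,
      Fintype.card_fin]

theorem exists_eq_smul_of_dim_one (C : EuclideanSpace ℂ (Fin 1) →L[ℂ] EuclideanSpace ℂ (Fin 1)) :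
    ∃ c : ℂ, ∀ x, C x = c • x := by
  let e : EuclideanSpace ℂ (Fin 1) := EuclideanSpace.single 0 1
  have h : ∀ x : EuclideanSpace ℂ (Fin 1), x = x 0 • e := fun x => by
    ext i
    rw [Subsingleton.elim i 0]
    simp [e]
  refine ⟨(C e) 0, fun x => ?_⟩
  have h1 : C x = x 0 • C e := by
    conv_lhs => rw [h x, map_smul]
  rw [h1]
  ext i
  rw [Subsingleton.elim i 0]
  simp [mul_comm]

theorem unitQ_injective {s s' : Finset (Fin m)}
    {C : EuclideanSpace ℂ (Fin 1) →L[ℂ] EuclideanSpace ℂ (Fin 1)} (hC : Function.Injective C)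
    (hCQ : ∀ k x, C (unitQ s k x) = unitQ s' k (C x)) : s = s' := by
  have he : C (EuclideanSpace.single (0 : Fin 1) (1 : ℂ)) ≠ 0 := fun h0 => by
    have h1 := congrArg (fun z : EuclideanSpace ℂ (Fin 1) => z 0) (hC (h0.trans (map_zero C).symm))
    simp at h1
  ext k
  have h1 := hCQ k (EuclideanSpace.single (0 : Fin 1) (1 : ℂ))
  by_cases hk : k ∈ s <;> by_cases hk' : k ∈ s' <;> simp only [unitQ, hk, hk', if_true,
    if_false, ContinuousLinearMap.id_apply, zero_apply, map_zero] at h1 ⊢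
  · exact absurd h1.symm he
  · exact absurd h1 he

/-- The relation R₁R₂R₁ = cos² φ · R₁ survives intertwining, so cos² φ is an invariant; on (0, π/2)
it determines φ. -/
theorem pairQ_angle_injective {k₁ k₂ : Fin m} (hk : k₁ ≠ k₂) {φ ψ : ℝ}
    (hφ : φ ∈ Set.Ioo 0 (Real.pi / 2)) (hψ : ψ ∈ Set.Ioo 0 (Real.pi / 2))
    {C : EuclideanSpace ℂ (Fin 2) →L[ℂ] EuclideanSpace ℂ (Fin 2)} (hC : Function.Injective C)
    (hCQ : ∀ k x, C (pairQ k₁ k₂ φ k x) = pairQ k₁ k₂ ψ k (C x)) : φ = ψ := by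
  have hR : ∀ k x, C (Matrix.toEuclideanCLM (𝕜 := ℂ) (pairR k₁ k₂ φ k) x)
      = Matrix.toEuclideanCLM (𝕜 := ℂ) (pairR k₁ k₂ ψ k) (C x) := fun k x => by
    rw [← id_sub_pairQ, ← id_sub_pairQ, sub_apply, sub_apply, map_sub, hCQ]
    rfl
  have h1 := hR k₁
  have h2 := hR k₂
  simp only [pairR, if_true, hk.symm, if_false] at h1 h2
  have hmat : ∀ φ : ℝ, matR₁ * matR₂ φ * matR₁ = ((Real.cos φ : ℂ) ^ 2) • matR₁ := fun φ => by
    ext i j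
    fin_cases i <;> fin_cases j <;> simp [matR₁, matR₂, Matrix.mul_apply, Fin.sum_univ_two]
  have h3 : ∀ (φ : ℝ) x, Matrix.toEuclideanCLM (𝕜 := ℂ) matR₁ (Matrix.toEuclideanCLM (𝕜 := ℂ)
      (matR₂ φ) (Matrix.toEuclideanCLM (𝕜 := ℂ) matR₁ x))
      = (Real.cos φ : ℂ) ^ 2 • Matrix.toEuclideanCLM (𝕜 := ℂ) matR₁ x := fun φ x => by
    have := congrArg (fun M => Matrix.toEuclideanCLM (𝕜 := ℂ) M x) (hmat φ)
    simp only [map_mul, map_smul] at this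
    exact this
  let e : EuclideanSpace ℂ (Fin 2) := EuclideanSpace.single 0 1
  have he : Matrix.toEuclideanCLM (𝕜 := ℂ) matR₁ e = e := by
    ext i
    rw [Matrix.ofLp_toEuclideanCLM]
    fin_cases i <;> simp [matR₁, e]
  have hCe : C e ≠ 0 := fun h0 => by
    have := congrArg (fun z : EuclideanSpace ℂ (Fin 2) => z 0) (hC (h0.trans (map_zero C).symm))
    simp [e] at this
  have h4 := congrArg C (h3 φ e)
  rw [h1, h2, h1, h3, map_smul, ← h1, he] at h4
  have h5 : (Real.cos ψ : ℂ) ^ 2 = (Real.cos φ : ℂ) ^ 2 := smul_left_injective _ hCe h4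
  have h6 : Real.cos ψ ^ 2 = Real.cos φ ^ 2 := by exact_mod_cast h5
  have hpos : ∀ φ ∈ Set.Ioo 0 (Real.pi / 2), 0 < Real.cos φ := fun φ hφ =>
    Real.cos_pos_of_mem_Ioo ⟨by linarith [hφ.1, Real.pi_pos], hφ.2⟩
  have h7 : Real.cos φ = Real.cos ψ :=
    (pow_left_inj₀ (hpos _ hφ).le (hpos _ hψ).le two_ne_zero).1 h6.symm
  exact Real.injOn_cos ⟨hφ.1.le, by linarith [hφ.2, Real.pi_pos]⟩
    ⟨hψ.1.le, by linarith [hψ.2, Real.pi_pos]⟩ h7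

end OneDim

/-- Parameters of the irreducible families of projections `Q k`: one-dimensional families, and
families containing a pair of projections at an angle `φ` in the plane. -/
inductive ProjDatum (m : ℕ) : Type
  | one (s : Finset (Fin m))
  | two (k₁ k₂ : Fin m) (φ : ℝ)

/-! ### Admissible data and their models -/

namespace ProjDatum

variable {m r : ℕ}

/-- The dimension of the central subspace. -/
def dim : ProjDatum m → ℕ
  | one _ => 1
  | two _ _ _ => 2

/-- The projections `Q k`. -/
noncomputable def proj :
    (d : ProjDatum m) → Fin m → EuclideanSpace ℂ (Fin d.dim) →L[ℂ] EuclideanSpace ℂ (Fin d.dim)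
  | one s => unitQ s
  | two k₁ k₂ φ => pairQ k₁ k₂ φ

/-- The families with a nonnegative defect operator. -/
def Admissible (θ : Ray m r → ℝ) : ProjDatum m → Prop
  | one s => ∑ k ∈ s, tauSq θ k ≤ xi θ
  | two k₁ k₂ φ => k₁ < k₂ ∧ Ml θ = {k₁, k₂} ∧ φ ∈ Set.Ioo 0 (Real.pi / 2) ∧
      tauSq θ k₁ * tauSq θ k₂ * Real.cos φ ^ 2 ≤ (xi θ - tauSq θ k₁) * (xi θ - tauSq θ k₂)

open Classical in
/-- The dimension of the system. -/
noncomputable def spaceDim (θ : Ray m r → ℝ) : ProjDatum m → ℕ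
  -- The last summand is the rank of the defect. Before it come (m + r) dim H₀ and the sum of the
  -- ranks of the 1 - Q_k, which is `s.card` here and 2 for a pair in the plane.
  | one s => m + r + s.card + if ∑ k ∈ s, tauSq θ k = xi θ then 0 else 1
  | two k₁ k₂ φ => 2 * m + 2 * r + 2 +
      if tauSq θ k₁ * tauSq θ k₂ * Real.cos φ ^ 2 = (xi θ - tauSq θ k₁) * (xi θ - tauSq θ k₂)
        then 1 else 2

theorem isStarProjection_proj (d : ProjDatum m) (k : Fin m) : IsStarProjection (d.proj k) := by
  cases d with
  | one s => exact isStarProjection_unitQ s k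
  | two k₁ k₂ φ => exact isStarProjection_pairQ k₁ k₂ φ k

theorem mem_Ml {θ : Ray m r → ℝ} {k : Fin m} : k ∈ Ml θ ↔ tauSq θ k < xi θ := by simp [Ml]

theorem tauSq_nonneg (θ : Ray m r → ℝ) (k : Fin m) : 0 ≤ tauSq θ k := sq_nonneg _

theorem exists_hasGram {θ : Ray m r → ℝ} (hpair : ∀ k : Fin m, θ (.fst k) = θ (.snd k))
    (d : ProjDatum m) (hd : d.Admissible θ) :
    ∃ S : SubspaceSystem (StarVertex m r) (EuclideanSpace ℂ (Fin (d.spaceDim θ))),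
      S.HasGram (gramB θ d.proj) := by
  classical
  cases d with
  | one s =>
    have hd' : 0 ≤ xi θ - ∑ k ∈ s, tauSq θ k := sub_nonneg.2 hd
    refine SubspaceSystem.exists_hasGram_euclidean (isStarProjection_unitQ s) hpair
      ((Real.sqrt (xi θ - ∑ k ∈ s, tauSq θ k) : ℂ) • LinearMap.id) (fun x y => ?_) ?_
    · rw [defect_unitQ]
      simp only [LinearMap.smul_apply, LinearMap.id_apply, inner_smul_left, inner_smul_right,
        Complex.conj_ofReal]
      rw [← mul_assoc, ← Complex.ofReal_mul, Real.mul_self_sqrt hd']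
    · rw [finrank_range_sqrt_smul_id hd', finrank_range_id_sub_unitQ, finrank_euclideanSpace,
        Fintype.card_fin]
      simp only [spaceDim, sub_eq_zero, eq_comm (a := xi θ)]
      ring
  | two k₁ k₂ φ =>
    obtain ⟨hk, hM, hφ, h⟩ := hd
    have h2 : tauSq θ k₂ < xi θ := mem_Ml.1 (by rw [hM]; simp)
    obtain ⟨T, hT, hlt, heq⟩ := exists_root_defect_pairQ hk.ne h2 (tauSq_nonneg θ k₂) h
    refine SubspaceSystem.exists_hasGram_euclidean (isStarProjection_pairQ k₁ k₂ φ) hpair T hT ?_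
    rw [finrank_range_pairR hk.ne, finrank_euclideanSpace, Fintype.card_fin]
    simp only [spaceDim]
    split_ifs with h3
    · rw [heq h3]; ring
    · rw [hlt (lt_of_le_of_ne h h3)]; ring

theorem exists_eq_smul_of_commute {θ : Ray m r → ℝ} {d : ProjDatum m} (hd : d.Admissible θ)
    (C : EuclideanSpace ℂ (Fin d.dim) →L[ℂ] EuclideanSpace ℂ (Fin d.dim))
    (hC : ∀ k x, C (d.proj k x) = d.proj k (C x)) : ∃ c : ℂ, ∀ x, C x = c • x := by
  cases d with
  | one s => exact exists_eq_smul_of_dim_one C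
  | two k₁ k₂ φ => exact exists_eq_smul_of_commute_pairQ hd.1.ne hd.2.2.1 C hC

/-- C is the restriction of the unitary to the central subspaces and inherits its injectivity. It
transfers unitary equivalence of systems to their projections Q_k. -/
theorem exists_injective_intertwiner {θ : Ray m r → ℝ} (hτ : ∀ i, Real.cos (θ i) ≠ 0)
    {H H' : Type*} [NormedAddCommGroup H] [InnerProductSpace ℂ H] [CompleteSpace H]
    [NormedAddCommGroup H'] [InnerProductSpace ℂ H'] [CompleteSpace H'] {d d' : ProjDatum m}
    {S : SubspaceSystem (StarVertex m r) H} {S' : SubspaceSystem (StarVertex m r) H'}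
    (hS : S.HasGram (gramB θ d.proj)) (hS' : S'.HasGram (gramB θ d'.proj))
    (h : S.UnitarilyEquivalent S') :
    ∃ C : EuclideanSpace ℂ (Fin d.dim) →L[ℂ] EuclideanSpace ℂ (Fin d'.dim),
      Function.Injective C ∧ ∀ k x, C (d.proj k x) = d'.proj k (C x) := by
  obtain ⟨U, hU⟩ := h.exists_comp_proj
  obtain ⟨V, hV, -⟩ := hS.exists_isGramFamily
  obtain ⟨V', hV', -⟩ := hS'.exists_isGramFamily
  obtain ⟨C, hC, hCQ⟩ := hV.exists_intertwiner hV' hτ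
    (U.toContinuousLinearEquiv : H →L[ℂ] H') hU
  refine ⟨C, fun x y hxy => (V none).injective (U.injective ?_), hCQ⟩
  exact (hC none x).trans ((congrArg _ hxy).trans (hC none y).symm)

theorem dim_eq_of_unitarilyEquivalent {θ : Ray m r → ℝ} {H H' : Type u} [NormedAddCommGroup H]
    [InnerProductSpace ℂ H] [NormedAddCommGroup H'] [InnerProductSpace ℂ H'] {d d' : ProjDatum m}
    {S : SubspaceSystem (StarVertex m r) H} {S' : SubspaceSystem (StarVertex m r) H'}
    (hS : S.HasGram (gramB θ d.proj)) (hS' : S'.HasGram (gramB θ d'.proj))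
    (h : S.UnitarilyEquivalent S') : d.dim = d'.dim := by
  obtain ⟨U, hU⟩ := h
  have h1 := U.toLinearEquiv.rank_map_eq (S.space none)
  have h2 : Module.rank ℂ (S'.space none) = Module.rank ℂ (S.space none) := by
    rw [← hU none]; exact h1
  rw [hS.rank_space, hS'.rank_space, finrank_euclideanSpace, finrank_euclideanSpace,
    Fintype.card_fin, Fintype.card_fin] at h2
  exact_mod_cast h2.symm

theorem eq_and_eq_of_pair_eq {α : Type*} [LinearOrder α] {k₁ k₂ l₁ l₂ : α} (hk : k₁ < k₂)
    (hl : l₁ < l₂) (h : ({k₁, k₂} : Finset α) = {l₁, l₂}) : k₁ = l₁ ∧ k₂ = l₂ := by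
  have h1 : k₁ ∈ ({l₁, l₂} : Finset α) := by rw [← h]; simp
  have h2 : k₂ ∈ ({l₁, l₂} : Finset α) := by rw [← h]; simp
  simp only [Finset.mem_insert, Finset.mem_singleton] at h1 h2
  rcases h1 with rfl | rfl <;> rcases h2 with rfl | rfl
  · exact absurd hk (lt_irrefl _)
  · exact ⟨rfl, rfl⟩
  · exact absurd (hk.trans hl) (lt_irrefl _)
  · exact absurd hk (lt_irrefl _)

theorem eq_of_unitarilyEquivalent {θ : Ray m r → ℝ} (hτ : ∀ i, Real.cos (θ i) ≠ 0)
    {H H' : Type u} [NormedAddCommGroup H] [InnerProductSpace ℂ H] [CompleteSpace H]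
    [NormedAddCommGroup H'] [InnerProductSpace ℂ H'] [CompleteSpace H']
    {d d' : ProjDatum m} (hd : d.Admissible θ) (hd' : d'.Admissible θ)
    {S : SubspaceSystem (StarVertex m r) H} {S' : SubspaceSystem (StarVertex m r) H'}
    (hS : S.HasGram (gramB θ d.proj)) (hS' : S'.HasGram (gramB θ d'.proj))
    (h : S.UnitarilyEquivalent S') : d = d' := by
  have hdim := dim_eq_of_unitarilyEquivalent hS hS' h
  obtain ⟨C, hC, hCQ⟩ := exists_injective_intertwiner hτ hS hS' h
  cases d with
  | one s =>
    cases d' with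
    | two k₁ k₂ φ => simp [dim] at hdim
    | one s' =>
      rw [unitQ_injective hC hCQ]
  | two k₁ k₂ φ =>
    cases d' with
    | one s' => simp [dim] at hdim
    | two l₁ l₂ ψ =>
      obtain ⟨hk, hM, hφ, -⟩ := hd
      obtain ⟨hl, hM', hψ, -⟩ := hd'
      obtain ⟨rfl, rfl⟩ := eq_and_eq_of_pair_eq hk hl (hM.symm.trans hM')
      rw [pairQ_angle_injective hk.ne hφ hψ hC hCQ]

end ProjDatum

/-! ### Irreducible families of projections with nonnegative defect -/

section IrreducibleProjections

variable {m r : ℕ} {θ : Ray m r → ℝ} {H₀ : Type*} [NormedAddCommGroup H₀] [InnerProductSpace ℂ H₀]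
  [CompleteSpace H₀] {Q : Fin m → H₀ →L[ℂ] H₀}

/-- Only scalars commute with all the operators `Q k`. -/
def OnlyScalarsCommute (Q : Fin m → H₀ →L[ℂ] H₀) : Prop :=
  ∀ A : H₀ →L[ℂ] H₀, (∀ k x, A (Q k x) = Q k (A x)) → ∃ c : ℂ, ∀ x, A x = c • x

/-- An operator on H₀ lifts to H only if its adjoint also commutes with the Gram operator; this is
automatic here because the Q_k are self-adjoint. -/
theorem SubspaceSystem.IsGramFamily.onlyScalarsCommute {H : Type*} [NormedAddCommGroup H]
    [InnerProductSpace ℂ H] [CompleteSpace H] {S : SubspaceSystem (StarVertex m r) H}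
    {V : StarVertex m r → H₀ →ₗᵢ[ℂ] H} (hV : S.IsGramFamily (gramB θ Q) V)
    (hQ : ∀ k, IsStarProjection (Q k)) (h0 : S.IsNonzero) (h : S.IsIrreducible) :
    OnlyScalarsCommute Q := by
  intro A hA
  refine hV.exists_eq_smul_of_commute (h.topologicalClosure_iSup_eq_top h0) h A
    (fun i j x => (gramB_conj Q Q A (fun k x => (hA k x).symm) i j x).symm) fun i j x =>
      (gramB_conj Q Q A.adjoint (fun k x => ?_) i j x).symm
  refine ext_inner_left ℂ fun y => ?_
  rw [ContinuousLinearMap.adjoint_inner_right, ← (hQ k).inner_apply_left, ← (hQ k).inner_apply_left,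
    ContinuousLinearMap.adjoint_inner_right, hA]

theorem re_inner_defect (hQ : ∀ k, IsStarProjection (Q k)) (x : H₀) :
    (⟪x, defect Q θ x⟫_ℂ).re = xi θ * ‖x‖ ^ 2 - ∑ k, tauSq θ k * ‖x - Q k x‖ ^ 2 := by
  have h1 : ∀ k, ⟪x, x - Q k x⟫_ℂ = ((‖x - Q k x‖ ^ 2 : ℝ) : ℂ) := fun k => by
    have h2 := inner_self_eq_norm_sq_to_K (𝕜 := ℂ) (x - Q k x)
    rw [Complex.ofReal_pow]
    refine Eq.trans ?_ h2
    simp only [inner_sub_left, inner_sub_right, (hQ k).inner_apply_left, (hQ k).apply_apply,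
      sub_self, sub_zero]
  have h0 : ⟪x, x⟫_ℂ = ((‖x‖ ^ 2 : ℝ) : ℂ) := by
    rw [Complex.ofReal_pow]; exact inner_self_eq_norm_sq_to_K x
  rw [defect_apply, inner_sub_right, inner_smul_right, inner_sum, h0]
  simp only [inner_smul_right, h1]
  rw [← Complex.ofReal_re (xi θ * ‖x‖ ^ 2 - ∑ k, tauSq θ k * ‖x - Q k x‖ ^ 2)]
  push_cast
  rfl

/-- The Q_k are self-adjoint, so the orthogonal complement of W is invariant too and the projection
onto W commutes with them. It is a scalar fixing x ≠ 0. -/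
theorem OnlyScalarsCommute.eq_top_of_invariant (hirr : OnlyScalarsCommute Q)
    (hQ : ∀ k, IsStarProjection (Q k)) {W : Submodule ℂ H₀} [FiniteDimensional ℂ W]
    (hW : ∀ k, ∀ x ∈ W, Q k x ∈ W) {x : H₀} (hx : x ∈ W) (hx0 : x ≠ 0) : W = ⊤ := by
  obtain ⟨c, hc⟩ := hirr W.starProjection fun k y => by
    refine Submodule.eq_starProjection_of_mem_of_inner_eq_zero
      (hW k _ (W.starProjection_apply_mem y)) fun w hw => ?_
    rw [← map_sub, (hQ k).inner_apply_left]
    exact W.starProjection_inner_eq_zero y _ (hW k w hw)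
  have h1 : c • x = x := by
    rw [← hc]; exact Submodule.starProjection_eq_self_iff.2 hx
  have h2 : c = 1 := smul_left_injective ℂ hx0 (h1.trans (one_smul ℂ x).symm)
  refine eq_top_iff.2 fun y _ => ?_
  rw [← Submodule.starProjection_eq_self_iff, hc, h2, one_smul]

/-- An irreducible commuting family of projections acts in a line. -/
theorem OnlyScalarsCommute.exists_one [Nontrivial H₀] (hirr : OnlyScalarsCommute Q)
    (hQ : ∀ k, IsStarProjection (Q k)) (hpos : ∀ x, 0 ≤ (⟪x, defect Q θ x⟫_ℂ).re)
    (hcomm : ∀ j k x, Q j (Q k x) = Q k (Q j x)) :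
    ∃ s : Finset (Fin m), (ProjDatum.one s).Admissible θ ∧
      ∃ u : EuclideanSpace ℂ (Fin 1) ≃ₗᵢ[ℂ] H₀, ∀ k x, Q k (u x) = u (unitQ s k x) := by
  classical
  obtain ⟨e, he⟩ := exists_ne (0 : H₀)
  -- Each Q_k commutes with the whole family, hence is scalar, and an idempotent scalar is 0 or 1.
  -- Then every line is invariant.
  have hc : ∀ k, (∀ x, Q k x = 0) ∨ ∀ x, Q k x = x := fun k => by
    obtain ⟨c, hc⟩ := hirr (Q k) fun j x => hcomm k j x
    have h1 : c • c • e = c • e := by rw [← hc e, ← hc]; exact (hQ k).apply_apply e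
    rw [smul_smul] at h1
    have h2 : c * c = c := smul_left_injective ℂ he h1
    rcases IsIdempotentElem.iff_eq_zero_or_one.1 h2 with rfl | rfl
    · exact Or.inl fun x => by rw [hc, zero_smul]
    · exact Or.inr fun x => by rw [hc, one_smul]
  have htop : Submodule.span ℂ {e} = ⊤ := by
    refine hirr.eq_top_of_invariant hQ (fun k x hx => ?_) (Submodule.mem_span_singleton_self e) he
    rcases hc k with h | h <;> rw [h]
    · exact Submodule.zero_mem _
    · exact hx
  have hfin : FiniteDimensional ℂ H₀ := by
    refine Module.finite_def.2 (htop ▸ Submodule.fg_span_singleton e)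
  have hrank : Module.finrank ℂ H₀ = 1 := by
    rw [← finrank_top, ← htop, finrank_span_singleton he]
  obtain ⟨u⟩ := nonempty_euclidean_linearIsometryEquiv hrank
  refine ⟨Finset.univ.filter fun k => ∀ x, Q k x = 0, ?_, u.symm, fun k x => ?_⟩
  · have h1 := hpos e
    rw [re_inner_defect hQ] at h1
    have h2 : ∀ k, tauSq θ k * ‖e - Q k e‖ ^ 2
        = (if ∀ x, Q k x = 0 then tauSq θ k else 0) * ‖e‖ ^ 2 := fun k => by
      split_ifs with h
      · rw [h, sub_zero]
      · rw [(hc k).resolve_left h, sub_self, norm_zero]; simp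
    rw [Finset.sum_congr rfl fun k _ => h2 k, ← Finset.sum_mul, ← sub_mul] at h1
    have h3 : 0 < ‖e‖ ^ 2 := by positivity
    have h4 := nonneg_of_mul_nonneg_left h1 h3
    rw [sub_nonneg, ← Finset.sum_filter] at h4
    exact h4
  · unfold unitQ
    split_ifs with h
    · rw [Finset.mem_filter] at h
      simp [h.2]
    · rw [Finset.mem_filter] at h
      have h1 : ¬ ∀ x, Q k x = 0 := fun h2 => h ⟨Finset.mem_univ _, h2⟩
      rw [(hc k).resolve_left h1]
      rfl

/-- If `τ_k² ≥ ξ` then `1 - Q_k` is orthogonal to all the other `1 - Q_j`. -/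
theorem apply_sub_apply_of_le (hQ : ∀ k, IsStarProjection (Q k))
    (hpos : ∀ x, 0 ≤ (⟪x, defect Q θ x⟫_ℂ).re) (hτ : ∀ k, 0 < tauSq θ k)
    {j k : Fin m} (hk : xi θ ≤ tauSq θ k) (hjk : j ≠ k) (x : H₀) :
    Q j (x - Q k x) = x - Q k x := by
  set y := x - Q k x with hy
  have hky : Q k y = 0 := by rw [hy, map_sub, (hQ k).apply_apply, sub_self]
  have h1 := hpos y
  rw [re_inner_defect hQ] at h1
  -- On the range of R_k the term of index k alone is τ_k²‖y‖² ≥ ξ‖y‖², so nonnegativity of the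
  -- defect leaves no room for the term of index j.
  have h2 : tauSq θ k * ‖y - Q k y‖ ^ 2 + tauSq θ j * ‖y - Q j y‖ ^ 2
      ≤ ∑ k, tauSq θ k * ‖y - Q k y‖ ^ 2 := by
    refine (Finset.sum_pair (f := fun k => tauSq θ k * ‖y - Q k y‖ ^ 2) hjk.symm).symm.le.trans ?_
    exact Finset.sum_le_sum_of_subset_of_nonneg (Finset.subset_univ _) fun i _ _ =>
      mul_nonneg (hτ i).le (sq_nonneg _)
  rw [hky, sub_zero] at h2
  have h3 : xi θ * ‖y‖ ^ 2 ≤ tauSq θ k * ‖y‖ ^ 2 :=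
    mul_le_mul_of_nonneg_right hk (sq_nonneg _)
  have h4 : tauSq θ j * ‖y - Q j y‖ ^ 2 ≤ 0 := by linarith
  have h5 : ‖y - Q j y‖ ^ 2 ≤ 0 := nonpos_of_mul_nonpos_right h4 (hτ j)
  have h6 : ‖y - Q j y‖ = 0 := by
    exact pow_eq_zero_iff two_ne_zero |>.1 (le_antisymm h5 (sq_nonneg _))
  exact (sub_eq_zero.1 (norm_eq_zero.1 h6)).symm

/-- R_jR_k = 0 implies R_kR_j = 0 by taking adjoints, and then Q_j and Q_k commute. -/
theorem commute_of_le (hQ : ∀ k, IsStarProjection (Q k))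
    (hpos : ∀ x, 0 ≤ (⟪x, defect Q θ x⟫_ℂ).re) (hτ : ∀ k, 0 < tauSq θ k)
    {k : Fin m} (hk : xi θ ≤ tauSq θ k) (j : Fin m) (x : H₀) :
    Q j (Q k x) = Q k (Q j x) := by
  rcases eq_or_ne j k with rfl | hjk
  · rfl
  have h1 : ∀ x, Q j (x - Q k x) = x - Q k x := apply_sub_apply_of_le hQ hpos hτ hk hjk
  have h2 : Q k (x - Q j x) = x - Q j x := by
    refine ext_inner_right ℂ fun y => ?_
    have h3 := congrArg (fun z => ⟪x, z⟫_ℂ) (h1 y)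
    simp only [map_sub, inner_sub_right] at h3
    simp only [map_sub, inner_sub_left, (hQ _).inner_apply_left]
    linear_combination h3
  have h3 := h1 x
  rw [map_sub] at h2 h3
  have h4 : Q j (Q k x) = Q j x - (x - Q k x) := by rw [← h3]; abel
  have h5 : Q k (Q j x) = Q k x - (x - Q j x) := by rw [← h2]; abel
  rw [h4, h5]
  abel

/-- Two noncommuting irreducible projections are the pair of projections at some angle. -/
theorem OnlyScalarsCommute.exists_two (hirr : OnlyScalarsCommute Q)
    (hQ : ∀ k, IsStarProjection (Q k)) {k₁ k₂ : Fin m} (hk : k₁ ≠ k₂)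
    (hother : ∀ k, k ≠ k₁ → k ≠ k₂ → ∀ x, Q k x = x)
    (hne : ∃ x, Q k₁ (Q k₂ x) ≠ Q k₂ (Q k₁ x)) :
    ∃ φ ∈ Set.Ioo 0 (Real.pi / 2), ∃ u : EuclideanSpace ℂ (Fin 2) ≃ₗᵢ[ℂ] H₀,
      ∀ k x, Q k (u x) = u (pairQ k₁ k₂ φ k x) := by
  let R₁ : H₀ →L[ℂ] H₀ := 1 - Q k₁
  let R₂ : H₀ →L[ℂ] H₀ := 1 - Q k₂
  have hR₁ : IsStarProjection R₁ := (hQ k₁).one_sub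
  have hR₂ : IsStarProjection R₂ := (hQ k₂).one_sub
  have hQR₁ : ∀ x, Q k₁ x = x - R₁ x := fun x => by simp [R₁]
  have hQR₂ : ∀ x, Q k₂ x = x - R₂ x := fun x => by simp [R₂]
  have hne' : ∃ x, R₁ (R₂ x) ≠ R₂ (R₁ x) := by
    obtain ⟨x, hx⟩ := hne
    refine ⟨x, fun h => hx ?_⟩
    simp only [hQR₁, hQR₂, map_sub, h]
    abel
  have hinv : ∀ W : Submodule ℂ H₀, (∀ x ∈ W, R₁ x ∈ W) → (∀ x ∈ W, R₂ x ∈ W) →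
      ∀ k, ∀ x ∈ W, Q k x ∈ W := fun W h1 h2 k x hx => by
    by_cases e1 : k = k₁
    · rw [e1, hQR₁]; exact W.sub_mem hx (h1 x hx)
    by_cases e2 : k = k₂
    · rw [e2, hQR₂]; exact W.sub_mem hx (h2 x hx)
    rwa [hother k e1 e2]
  -- The square of the difference of two projections commutes with both of them, which is why the
  -- irreducible pairs live in dimension at most 2.
  obtain ⟨s, hs⟩ := hirr ((R₁ - R₂) * (R₁ - R₂)) fun k x => by
    by_cases e1 : k = k₁
    · subst e1
      simp only [hQR₁, mul_apply_eq_comp, sub_apply, map_sub, hR₁.apply_apply,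
        hR₂.apply_apply]
      abel
    by_cases e2 : k = k₂
    · subst e2
      simp only [hQR₂, mul_apply_eq_comp, sub_apply, map_sub, hR₁.apply_apply,
        hR₂.apply_apply]
      abel
    rw [hother k e1 e2, hother k e1 e2]
  obtain ⟨x, hx1, hxn⟩ : ∃ x, R₁ x = x ∧ ‖x‖ = 1 := by
    obtain ⟨z, hz⟩ : ∃ z, R₁ z ≠ 0 := by
      by_contra! h
      obtain ⟨x, hx⟩ := hne'
      exact hx (by rw [h, h, map_zero])
    refine ⟨((‖R₁ z‖⁻¹ : ℝ) : ℂ) • R₁ z, by rw [map_smul, hR₁.apply_apply], ?_⟩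
    rw [norm_smul, Complex.norm_real, norm_inv, norm_norm, inv_mul_cancel₀ (norm_ne_zero_iff.2 hz)]
  have hx0 : x ≠ 0 := fun h => by simp [h] at hxn
  set c2 : ℝ := ‖R₂ x‖ ^ 2 with hc2
  have hxx : ⟪x, x⟫_ℂ = 1 := by rw [inner_self_eq_norm_sq_to_K, hxn]; simp
  have hxR : ⟪x, R₂ x⟫_ℂ = c2 := by
    rw [← hR₂.apply_apply x, ← hR₂.inner_apply_left, inner_self_eq_norm_sq_to_K, hc2]
    simp
  -- Applying R₁ to the scalar relation at a vector x fixed by R₁ gives x - R₁R₂x = s x; pairing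
  -- with x identifies 1 - s with ‖R₂x‖².
  have hRR : R₁ (R₂ x) = (c2 : ℂ) • x := by
    have h1 := congrArg R₁ (hs x)
    simp only [mul_apply_eq_comp, sub_apply, map_sub, hR₁.apply_apply,
      hR₂.apply_apply, hx1, map_smul] at h1
    have h2 : R₁ (R₂ x) = (1 - s) • x := by
      rw [sub_smul, one_smul, ← h1]; abel
    have h3 : ⟪x, R₁ (R₂ x)⟫_ℂ = c2 := by rw [← hR₁.inner_apply_left, hx1, hxR]
    rw [h2, inner_smul_right, hxx, mul_one] at h3
    rw [h2, h3]
  set y := R₂ x - (c2 : ℂ) • x with hy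
  have hxy : ⟪x, y⟫_ℂ = 0 := by
    rw [hy, inner_sub_right, inner_smul_right, hxx, hxR, mul_one, sub_self]
  have hR1y : R₁ y = 0 := by rw [hy, map_sub, map_smul, hx1, hRR, sub_self]
  have hR2x : R₂ x = (c2 : ℂ) • x + y := by rw [hy]; abel
  have hR2y : R₂ y = ((1 - c2 : ℝ) : ℂ) • R₂ x := by
    rw [hy, map_sub, map_smul, hR₂.apply_apply, Complex.ofReal_sub, Complex.ofReal_one, sub_smul,
      one_smul]
  have hyn : ‖y‖ ^ 2 = c2 * (1 - c2) := by
    have h1 : ⟪y, y⟫_ℂ = ((c2 * (1 - c2) : ℝ) : ℂ) := by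
      conv_lhs => rw [hy]
      rw [inner_sub_left, hR₂.inner_apply_left, hR2y, inner_smul_right, hxR, inner_smul_left, hxy]
      push_cast
      ring
    have h0 : ⟪y, y⟫_ℂ = ((‖y‖ ^ 2 : ℝ) : ℂ) := by
      rw [Complex.ofReal_pow]; exact inner_self_eq_norm_sq_to_K y
    exact Complex.ofReal_injective (h0.symm.trans h1)
  -- If y = 0, the line through x is invariant under both projections, hence is the whole space,
  -- where they commute.
  have hy0 : y ≠ 0 := fun h0 => by
    have htop : Submodule.span ℂ {x} = ⊤ := by
      refine hirr.eq_top_of_invariant hQ (hinv _ (fun z hz => ?_) fun z hz => ?_)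
        (Submodule.mem_span_singleton_self x) hx0
      · obtain ⟨a, rfl⟩ := Submodule.mem_span_singleton.1 hz
        rwa [map_smul, hx1]
      · obtain ⟨a, rfl⟩ := Submodule.mem_span_singleton.1 hz
        rw [map_smul, hR2x, h0, add_zero]
        exact Submodule.smul_mem _ _ (Submodule.smul_mem _ _ (Submodule.mem_span_singleton_self x))
    obtain ⟨z, hz⟩ := hne'
    obtain ⟨a, rfl⟩ := Submodule.mem_span_singleton.1 (htop ▸ Submodule.mem_top : z ∈ _)
    exact hz (by rw [map_smul, map_smul, map_smul, map_smul, hx1, hR2x, h0, add_zero, map_smul,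
      hx1])
  have hc2pos : 0 < c2 * (1 - c2) := by rw [← hyn]; positivity
  have hc0 : 0 < c2 := by
    rcases (sq_nonneg ‖R₂ x‖).lt_or_eq with h | h
    · exact h
    · rw [hc2, ← h, zero_mul] at hc2pos; exact absurd hc2pos (lt_irrefl _)
  have hc1 : 0 < 1 - c2 := pos_of_mul_pos_right hc2pos hc0.le
  -- cos² φ = ‖R₂x‖² for the unit vector x in the range of R₁. In the orthonormal basis formed by x
  -- and the normalization of y, the two projections have the matrices `matR₁` and `matR₂ φ`.
  set φ := Real.arccos (Real.sqrt c2) with hφ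
  have hcos : Real.cos φ = Real.sqrt c2 :=
    Real.cos_arccos (by linarith [Real.sqrt_nonneg c2]) (Real.sqrt_le_one.2 (by linarith))
  have hsin : Real.sin φ = Real.sqrt (1 - c2) := by
    rw [hφ, Real.sin_arccos, Real.sq_sqrt hc0.le]
  have hcp : 0 < Real.cos φ := by rw [hcos]; exact Real.sqrt_pos.2 hc0
  have hsp : 0 < Real.sin φ := by rw [hsin]; exact Real.sqrt_pos.2 hc1
  have hc2' : Real.cos φ ^ 2 = c2 := by rw [hcos, Real.sq_sqrt hc0.le]
  have hs2' : Real.sin φ ^ 2 = 1 - c2 := by rw [hsin, Real.sq_sqrt hc1.le]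
  have hynorm : ‖y‖ = Real.cos φ * Real.sin φ := by
    refine (pow_left_inj₀ (norm_nonneg y) (mul_pos hcp hsp).le two_ne_zero).1 ?_
    rw [hyn, mul_pow, hc2', hs2']
  set p : ℂ := (Real.cos φ : ℂ) * (Real.sin φ : ℂ) with hp
  have hp0 : p ≠ 0 := mul_ne_zero (Complex.ofReal_ne_zero.2 hcp.ne')
    (Complex.ofReal_ne_zero.2 hsp.ne')
  set e := p⁻¹ • y with he
  have hye : y = p • e := by rw [he, smul_smul, mul_inv_cancel₀ hp0, one_smul]
  have hen : ‖e‖ = 1 := by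
    rw [he, norm_smul, hynorm, hp, norm_inv, norm_mul, Complex.norm_real, Complex.norm_real,
      Real.norm_of_nonneg hcp.le, Real.norm_of_nonneg hsp.le]
    exact inv_mul_cancel₀ (mul_pos hcp hsp).ne'
  have hxe : ⟪x, e⟫_ℂ = 0 := by rw [he, inner_smul_right, hxy, mul_zero]
  have hR1e : R₁ e = 0 := by rw [he, map_smul, hR1y, smul_zero]
  have hR2x' : R₂ x = (Real.cos φ : ℂ) ^ 2 • x + p • e := by
    rw [hR2x, ← hye, ← hc2', Complex.ofReal_pow]
  have hR2e : R₂ e = p • x + (Real.sin φ : ℂ) ^ 2 • e := by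
    have h1 : p • R₂ e = p • (p • x + (Real.sin φ : ℂ) ^ 2 • e) := calc
      p • R₂ e = R₂ y := by rw [← map_smul, ← hye]
      _ = ((Real.sin φ ^ 2 : ℝ) : ℂ) • ((Real.cos φ : ℂ) ^ 2 • x + p • e) := by
        rw [hR2y, hR2x', hs2']
      _ = p • (p • x + (Real.sin φ : ℂ) ^ 2 • e) := by
        rw [hp, Complex.ofReal_pow]; module
    exact smul_right_injective H₀ hp0 h1
  have hon : Orthonormal ℂ ![x, e] := by
    rw [orthonormal_iff_ite]
    have hex : ⟪e, x⟫_ℂ = 0 := by rw [← inner_conj_symm, hxe, map_zero]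
    intro i j
    fin_cases i <;> fin_cases j <;> simp [hxe, hex, hxn, hen]
  have hspan : Submodule.span ℂ (Set.range ![x, e]) = ⊤ := by
    have : FiniteDimensional ℂ (Submodule.span ℂ (Set.range ![x, e])) :=
      FiniteDimensional.span_of_finite ℂ (Set.finite_range _)
    have hr : Set.range ![x, e] = {x, e} := by simp [Set.pair_comm]
    have hxm : x ∈ Submodule.span ℂ (Set.range ![x, e]) :=
      Submodule.subset_span (by rw [hr]; simp)
    have hem : e ∈ Submodule.span ℂ (Set.range ![x, e]) :=
      Submodule.subset_span (by rw [hr]; simp)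
    refine hirr.eq_top_of_invariant hQ (hinv _ (fun z hz => ?_) fun z hz => ?_) hxm hx0
    · rw [hr] at hz
      obtain ⟨a, b, rfl⟩ := Submodule.mem_span_pair.1 hz
      rw [map_add, map_smul, map_smul, hx1, hR1e, smul_zero, add_zero]
      exact Submodule.smul_mem _ _ hxm
    · rw [hr] at hz
      obtain ⟨a, b, rfl⟩ := Submodule.mem_span_pair.1 hz
      rw [map_add, map_smul, map_smul, hR2x', hR2e]
      exact add_mem (Submodule.smul_mem _ _ (add_mem (Submodule.smul_mem _ _ hxm)
        (Submodule.smul_mem _ _ hem))) (Submodule.smul_mem _ _ (add_mem (Submodule.smul_mem _ _ hxm)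
        (Submodule.smul_mem _ _ hem)))
  let b := OrthonormalBasis.mk hon hspan.ge
  have hb : ∀ v : EuclideanSpace ℂ (Fin 2), b.repr.symm v = v 0 • x + v 1 • e := fun v => by
    rw [← b.sum_repr_symm, Fin.sum_univ_two]
    simp [b]
  refine ⟨φ, ⟨Real.arccos_pos.2 ?_, ?_⟩, b.repr.symm, fun k v => ?_⟩
  · rw [Real.sqrt_lt' one_pos]; linarith
  · rw [hφ, Real.arccos_lt_pi_div_two]
    exact Real.sqrt_pos.2 hc0
  · by_cases e1 : k = k₁
    · subst e1
      rw [hb, hb, hQR₁, map_add, map_smul, map_smul, hx1, hR1e, pairQ_eq, Matrix.ofLp_toEuclideanCLM]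
      simp [pairR, matR₁, Matrix.mulVec, dotProduct, Fin.sum_univ_two]
    by_cases e2 : k = k₂
    · subst e2
      rw [hb, hb, hQR₂, map_add, map_smul, map_smul, hR2x', hR2e, pairQ_eq,
        Matrix.ofLp_toEuclideanCLM]
      simp only [pairR, hk.symm, if_false, if_true, matR₂, Matrix.mulVec, dotProduct,
        Fin.sum_univ_two, Matrix.sub_apply, Matrix.one_apply, Matrix.of_apply, Matrix.cons_val',
        Matrix.cons_val_zero, Matrix.cons_val_one, Matrix.cons_val_fin_one, zero_ne_one,
        one_ne_zero, ← hp, smul_add, smul_smul]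
      module
    · rw [hother k e1 e2, pairQ_eq]
      have : pairR k₁ k₂ φ k = 0 := (if_neg e1).trans (if_neg e2)
      rw [this, sub_zero, map_one]
      rfl

/-- A noncommuting pair of indices must lie in M_l and, by cardinality, exhausts it. Every other Q_k
commutes with the family and is therefore scalar; it has to be 1. -/
theorem OnlyScalarsCommute.exists_projDatum [Nontrivial H₀] (hirr : OnlyScalarsCommute Q)
    (hQ : ∀ k, IsStarProjection (Q k)) (hpos : ∀ x, 0 ≤ (⟪x, defect Q θ x⟫_ℂ).re)
    (hτ : ∀ k, 0 < tauSq θ k) (hcard : (Ml θ).card ≤ 2) :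
    ∃ d : ProjDatum m, d.Admissible θ ∧
      ∃ u : EuclideanSpace ℂ (Fin d.dim) ≃ₗᵢ[ℂ] H₀, ∀ k x, Q k (u x) = u (d.proj k x) := by
  classical
  by_cases hcomm : ∀ j k x, Q j (Q k x) = Q k (Q j x)
  · obtain ⟨s, hs, hu⟩ := hirr.exists_one hQ hpos hcomm
    exact ⟨.one s, hs, hu⟩
  have key : ∃ k₁ k₂, k₁ < k₂ ∧ ∃ x, Q k₁ (Q k₂ x) ≠ Q k₂ (Q k₁ x) := by
    push Not at hcomm
    obtain ⟨j, k, x, hx⟩ := hcomm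
    rcases lt_trichotomy j k with h | rfl | h
    · exact ⟨j, k, h, x, hx⟩
    · exact absurd rfl hx
    · exact ⟨k, j, h, x, hx.symm⟩
  obtain ⟨k₁, k₂, hk, hne⟩ := key
  have hl : ∀ {k}, (∃ j x, Q j (Q k x) ≠ Q k (Q j x)) → tauSq θ k < xi θ := fun ⟨j, x, hx⟩ =>
    lt_of_not_ge fun hle => hx (commute_of_le hQ hpos hτ hle j x)
  have hl₁ : tauSq θ k₁ < xi θ := hl ⟨k₂, hne.imp fun _ hx => hx.symm⟩
  have hl₂ : tauSq θ k₂ < xi θ := hl ⟨k₁, hne⟩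
  have hM : Ml θ = {k₁, k₂} := by
    refine (Finset.eq_of_subset_of_card_le (fun k hk' => ?_) ?_).symm
    · rw [Finset.mem_insert, Finset.mem_singleton] at hk'
      rcases hk' with rfl | rfl
      · exact ProjDatum.mem_Ml.2 hl₁
      · exact ProjDatum.mem_Ml.2 hl₂
    · rwa [Finset.card_pair hk.ne]
  have hother : ∀ k, k ≠ k₁ → k ≠ k₂ → ∀ x, Q k x = x := fun k h₁ h₂ => by
    have hle : xi θ ≤ tauSq θ k := by
      refine le_of_not_gt fun h => ?_
      have h3 := ProjDatum.mem_Ml.2 h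
      rw [hM, Finset.mem_insert, Finset.mem_singleton] at h3
      exact h3.elim h₁ h₂
    obtain ⟨c, hc⟩ := hirr (Q k) fun j x => (commute_of_le hQ hpos hτ hle j x).symm
    obtain ⟨x, hx⟩ := hne
    intro z
    -- If the scalar c is not 1, the range of 1 - Q_k is all of H₀. Since Q_{k₁} fixes this range,
    -- it is the identity and commutes with Q_{k₂}.
    by_contra hz
    have hc1 : (1 - c) ≠ 0 := fun h0 => hz (by rw [hc, ← sub_eq_zero.1 h0, one_smul])
    have h4 : ∀ y, Q k₁ y = y := fun y => by
      have h5 := apply_sub_apply_of_le hQ hpos hτ hle h₁.symm y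
      have h6 : y - Q k y = (1 - c) • y := by rw [hc, sub_smul, one_smul]
      rw [h6, map_smul] at h5
      exact smul_right_injective H₀ hc1 h5
    exact hx (by rw [h4, h4])
  obtain ⟨φ, hφ, u, hu⟩ := hirr.exists_two hQ hk.ne hother hne
  refine ⟨.two k₁ k₂ φ, ⟨hk, hM, hφ, ?_⟩, u, hu⟩
  refine mul_cos_sq_le_of_defect_nonneg hk.ne hl₂ (ProjDatum.tauSq_nonneg θ k₂) fun x => ?_
  have h1 : defect Q θ (u x) = u (defect (pairQ k₁ k₂ φ) θ x) := by
    simp only [defect_apply, map_sub, map_sum, map_smul, hu]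
  have h2 := hpos (u x)
  rwa [h1, u.inner_map_map] at h2

end IrreducibleProjections

/-! ### From admissible data to classifications -/

section Lists

variable {m r : ℕ} {θ : Ray m r → ℝ}

theorem SubspaceSystem.HasGram.isNonzero {ι : Type} [Nonempty ι] {H H₀ : Type*}
    [NormedAddCommGroup H] [InnerProductSpace ℂ H] [NormedAddCommGroup H₀] [InnerProductSpace ℂ H₀]
    [Nontrivial H₀] {S : SubspaceSystem ι H} {B : ι → ι → H₀ →L[ℂ] H₀} (hS : S.HasGram B) :
    S.IsNonzero := by
  obtain ⟨V, hV, -⟩ := hS.exists_isGramFamily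
  obtain ⟨e, he⟩ := exists_ne (0 : H₀)
  let i := Classical.arbitrary ι
  refine ⟨i, fun h => he ?_⟩
  have h1 : V i e ∈ S.space i := hV.mem i e
  rw [h, Submodule.mem_bot] at h1
  exact (V i).injective (h1.trans (map_zero _).symm)

theorem SubspaceSystem.IsGramFamily.nontrivial {ι : Type} {H H₀ : Type*}
    [NormedAddCommGroup H] [InnerProductSpace ℂ H] [NormedAddCommGroup H₀] [InnerProductSpace ℂ H₀]
    {S : SubspaceSystem ι H} {B : ι → ι → H₀ →L[ℂ] H₀} {V : ι → H₀ →ₗᵢ[ℂ] H}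
    (hV : S.IsGramFamily B V) (h0 : S.IsNonzero) : Nontrivial H₀ := by
  obtain ⟨i, hi⟩ := h0
  obtain ⟨x, hx, hx0⟩ := Submodule.exists_mem_ne_zero_of_ne_bot hi
  obtain ⟨z, rfl⟩ := hV.exists_eq hx
  exact ⟨z, 0, fun h => hx0 (by rw [h, map_zero])⟩

/-- If `ξ(τ) < 0` there are no nonzero systems. -/
theorem AngComOrt.not_isNonzero (hτ : ∀ i, Real.cos (θ i) ≠ 0)
    (hpair : ∀ k : Fin m, θ (.fst k) = θ (.snd k)) (hξ : xi θ < 0) {H : Type*}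
    [NormedAddCommGroup H] [InnerProductSpace ℂ H] [CompleteSpace H]
    {S : SubspaceSystem (StarVertex m r) H} (hS : AngComOrt θ H S) : ¬ S.IsNonzero := fun h0 => by
  obtain ⟨Q, V, hQ, hV⟩ := hS.exists_isGramFamily hτ hpair
  obtain ⟨e, he⟩ := @exists_ne _ (hV.nontrivial h0) (0 : S.space none)
  have h1 := hV.re_inner_defect_nonneg hpair hQ e
  rw [re_inner_defect hQ] at h1
  have h2 : 0 ≤ ∑ k, tauSq θ k * ‖e - Q k e‖ ^ 2 := Finset.sum_nonneg fun k _ =>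
    mul_nonneg (ProjDatum.tauSq_nonneg θ k) (sq_nonneg _)
  have h3 : 0 < ‖e‖ ^ 2 := by positivity
  nlinarith

/-- A list of all admissible data without repetitions gives a classification. -/
theorem exists_isClassification (hτ : ∀ i, Real.cos (θ i) ≠ 0)
    (hpair : ∀ k : Fin m, θ (.fst k) = θ (.snd k)) (hcard : (Ml θ).card ≤ 2) {I : Type}
    {f : I → ProjDatum m} (hf : Function.Injective f)
    (hadm : ∀ d : ProjDatum m, d.Admissible θ ↔ ∃ i, f i = d) {dim : I → ℕ × ℕ}
    (hdim : ∀ i, dim i = ((f i).spaceDim θ, (f i).dim)) :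
    ∃ model, IsClassification.{u} θ dim model ∧
      ∀ i, (model i).HasGram (gramB θ (f i).proj) := by
  obtain rfl : dim = fun i => ((f i).spaceDim θ, (f i).dim) := funext hdim
  have ha : ∀ i, (f i).Admissible θ := fun i => (hadm _).2 ⟨i, rfl⟩
  choose model hmodel using fun i => (f i).exists_hasGram hpair (ha i)
  have hnt : ∀ d : ProjDatum m, Nontrivial (EuclideanSpace ℂ (Fin d.dim)) := fun d => by
    have : Nonempty (Fin d.dim) := by cases d <;> exact ⟨⟨0, by simp [ProjDatum.dim]⟩⟩
    infer_instance
  refine ⟨model, ?_, hmodel⟩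
  constructor
  · intro i
    obtain ⟨V, hV, -⟩ := (hmodel i).exists_isGramFamily
    exact hV.angComOrt (f i).isStarProjection_proj
  · intro i
    have := hnt (f i)
    exact (hmodel i).isNonzero
  · exact fun i => (hmodel i).isIrreducible hτ fun C hC =>
      ProjDatum.exists_eq_smul_of_commute (ha i) C hC
  · refine fun i => ⟨?_, fun j => ?_⟩
    · rw [← Module.finrank_eq_rank, finrank_euclideanSpace, Fintype.card_fin]
    · rw [(hmodel i).rank_space, finrank_euclideanSpace, Fintype.card_fin]
  · exact fun i j h => hf (ProjDatum.eq_of_unitarilyEquivalent hτ (ha i) (ha j) (hmodel i)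
      (hmodel j) h)
  · intro H _ _ _ S hS h0 hirr
    obtain ⟨Q, V, hQ, hV⟩ := hS.exists_isGramFamily hτ hpair
    have := hV.nontrivial h0
    obtain ⟨d, hd, u, hu⟩ := (hV.onlyScalarsCommute hQ h0 hirr).exists_projDatum hQ
      (hV.re_inner_defect_nonneg hpair hQ) (fun k => sq_pos_of_ne_zero (hτ (.fst k))) hcard
    obtain ⟨i, rfl⟩ := (hadm d).1 hd
    have hS' : S.HasGram (gramB θ Q) :=
      ⟨V, hV.range_eq, hV.inner_eq, hirr.topologicalClosure_iSup_eq_top h0⟩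
    have hS'' : S.HasGram (gramB θ (f i).proj) :=
      hS'.conj u (gramB_conj Q (f i).proj (u.toContinuousLinearEquiv : _ →L[ℂ] _) hu)
    exact ⟨i, hS''.unitarilyEquivalent (hmodel i)⟩

end Lists

/-! ### Enumeration of the admissible data -/

namespace ProjDatum

variable {m r : ℕ} {θ : Ray m r → ℝ}

/-- Used with s = M_e: these are the |M_e| + 1 systems of dimension (m + r + 1; 1) common to all
cases with ξ > 0. -/
theorem exists_list_empty_singleton (s : Finset (Fin m)) :
    ∃ g : Fin (s.card + 1) → ProjDatum m, Function.Injective g ∧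
      ∀ d, (∃ i, g i = d) ↔ d = one ∅ ∨ ∃ k ∈ s, d = one {k} := by
  refine ⟨Fin.cons (one ∅) fun j => one {(s.equivFin.symm j : Fin m)}, ?_, fun d => ?_⟩
  · rw [Fin.cons_injective_iff]
    refine ⟨?_, fun i j h => ?_⟩
    · rintro ⟨i, hi⟩
      simp at hi
    · simpa [Subtype.ext_iff] using h
  · rw [Fin.exists_fin_succ]
    simp only [Fin.cons_zero, Fin.cons_succ]
    refine or_congr eq_comm ⟨?_, ?_⟩
    · rintro ⟨j, rfl⟩
      exact ⟨_, (s.equivFin.symm j).2, rfl⟩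
    · rintro ⟨k, hk, rfl⟩
      exact ⟨s.equivFin ⟨k, hk⟩, by simp⟩

/-- In a set with at least two elements every τ_k² is strictly less than the sum, because the other
terms are positive. An admissible set of that size therefore lies in M_l. -/
theorem admissible_one_iff (hτ : ∀ k, 0 < tauSq θ k) (hξ : 0 < xi θ) (s : Finset (Fin m)) :
    (one s).Admissible θ ↔ s = ∅ ∨ (∃ k ∈ Me θ, s = {k}) ∨ (∃ k ∈ Ml θ, s = {k}) ∨
      (1 < s.card ∧ s ⊆ Ml θ ∧ ∑ k ∈ s, tauSq θ k ≤ xi θ) := by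
  change ∑ k ∈ s, tauSq θ k ≤ xi θ ↔ _
  constructor
  · intro h
    rcases s.eq_empty_or_nonempty with h0 | h0
    · exact Or.inl h0
    rcases (Finset.one_le_card.2 h0).eq_or_lt with h1 | h1
    · obtain ⟨k, rfl⟩ := Finset.card_eq_one.1 h1.symm
      rw [Finset.sum_singleton] at h
      rcases h.eq_or_lt with h | h
      · exact Or.inr (Or.inl ⟨k, by simpa [Me] using h, rfl⟩)
      · exact Or.inr (Or.inr (Or.inl ⟨k, mem_Ml.2 h, rfl⟩))
    · refine Or.inr (Or.inr (Or.inr ⟨h1, fun k hk => mem_Ml.2 (lt_of_lt_of_le ?_ h), h⟩))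
      obtain ⟨j, hj, hjk⟩ := Finset.exists_mem_ne h1 k
      exact Finset.single_lt_sum hjk hk hj (hτ j) fun i _ _ => (hτ i).le
  · rintro (rfl | ⟨k, hk, rfl⟩ | ⟨k, hk, rfl⟩ | ⟨-, -, h⟩)
    · simpa using hξ.le
    · rw [Finset.sum_singleton]
      exact le_of_eq (by simpa [Me] using hk)
    · rw [Finset.sum_singleton]
      exact (mem_Ml.1 hk).le
    · exact h

theorem spaceDim_empty (hξ : 0 < xi θ) : (one ∅ : ProjDatum m).spaceDim θ = m + r + 1 := by
  simp [spaceDim, hξ.ne]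

theorem spaceDim_singleton_of_mem_Me {k : Fin m} (hk : k ∈ Me θ) :
    (one {k}).spaceDim θ = m + r + 1 := by
  have : tauSq θ k = xi θ := by simpa [Me] using hk
  simp [spaceDim, this]

theorem spaceDim_singleton_of_mem_Ml {k : Fin m} (hk : k ∈ Ml θ) :
    (one {k}).spaceDim θ = m + r + 2 := by
  simp [spaceDim, (mem_Ml.1 hk).ne]

end ProjDatum

namespace ProjDatum

variable {m r : ℕ} {θ : Ray m r → ℝ}

/-- (ξ - a)(ξ - b) - ab = ξ(ξ - a - b) ≥ 0 and cos² φ < 1. So when a + b ≤ ξ every angle in (0, π/2)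
is admissible, with a defect of full rank. -/
theorem mul_cos_sq_lt {a b ξ φ : ℝ} (ha : 0 < a) (hb : 0 < b) (hξ : 0 < ξ) (h : a + b ≤ ξ)
    (hφ : φ ∈ Set.Ioo 0 (Real.pi / 2)) : a * b * Real.cos φ ^ 2 < (ξ - a) * (ξ - b) := by
  have h1 : Real.cos φ ^ 2 < 1 := by
    rw [Real.cos_sq']
    have := Real.sin_pos_of_pos_of_lt_pi hφ.1 (by linarith [hφ.2, Real.pi_pos])
    have := pow_pos this 2
    linarith
  have h2 : 0 < a * b := mul_pos ha hb
  nlinarith [mul_nonneg hξ.le (sub_nonneg.2 h)]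

/-- The same identity, now with a + b > ξ, gives 0 < η < 1. So φ(τ) is an interior angle, and it is
the one at which the determinant of the defect vanishes. -/
theorem phi_mem_and_mul_cos_sq_eq (hτ : ∀ k, 0 < tauSq θ k) (hξ : 0 < xi θ) {k₁ k₂ : Fin m}
    (hk : k₁ ≠ k₂) (hM : Ml θ = {k₁, k₂}) (h : xi θ < tauSq θ k₁ + tauSq θ k₂) :
    phi θ ∈ Set.Ioo 0 (Real.pi / 2) ∧
      tauSq θ k₁ * tauSq θ k₂ * Real.cos (phi θ) ^ 2
        = (xi θ - tauSq θ k₁) * (xi θ - tauSq θ k₂) := by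
  have h1 : tauSq θ k₁ < xi θ := mem_Ml.1 (by rw [hM]; simp)
  have h2 : tauSq θ k₂ < xi θ := mem_Ml.1 (by rw [hM]; simp)
  have hab : 0 < tauSq θ k₁ * tauSq θ k₂ := mul_pos (hτ _) (hτ _)
  set η := ((xi θ - tauSq θ k₁) * (xi θ - tauSq θ k₂)) / (tauSq θ k₁ * tauSq θ k₂) with hη
  have hphi : phi θ = Real.arccos (Real.sqrt η) := by
    rw [phi, hM, Finset.prod_pair hk, hη, div_mul_div_comm]
  have hη0 : 0 < η := div_pos (mul_pos (sub_pos.2 h1) (sub_pos.2 h2)) hab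
  have hη1 : η < 1 := by
    rw [hη, div_lt_one hab]
    nlinarith
  rw [hphi]
  refine ⟨⟨Real.arccos_pos.2 ?_, Real.arccos_lt_pi_div_two.2 (Real.sqrt_pos.2 hη0)⟩, ?_⟩
  · rwa [Real.sqrt_lt' one_pos, one_pow]
  · rw [Real.cos_arccos (by linarith [Real.sqrt_nonneg η]) (Real.sqrt_le_one.2 hη1.le),
      Real.sq_sqrt hη0.le, hη, mul_div_cancel₀ _ hab.ne']

theorem admissible_two_iff_of_le (hτ : ∀ k, 0 < tauSq θ k) (hξ : 0 < xi θ) {k₁ k₂ : Fin m}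
    (hk : k₁ < k₂) (hM : Ml θ = {k₁, k₂}) (h : tauSq θ k₁ + tauSq θ k₂ ≤ xi θ) (l₁ l₂ : Fin m)
    (φ : ℝ) : (two l₁ l₂ φ).Admissible θ ↔ k₁ = l₁ ∧ k₂ = l₂ ∧ φ ∈ Set.Ioo 0 (Real.pi / 2) := by
  constructor
  · rintro ⟨hl, hM', hφ, -⟩
    obtain ⟨h1, h2⟩ := eq_and_eq_of_pair_eq hk hl (hM.symm.trans hM')
    exact ⟨h1, h2, hφ⟩
  · rintro ⟨rfl, rfl, hφ⟩
    exact ⟨hk, hM, hφ, (mul_cos_sq_lt (hτ _) (hτ _) hξ h hφ).le⟩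

theorem spaceDim_two_of_le (hτ : ∀ k, 0 < tauSq θ k) (hξ : 0 < xi θ) {k₁ k₂ : Fin m}
    (h : tauSq θ k₁ + tauSq θ k₂ ≤ xi θ) {φ : ℝ} (hφ : φ ∈ Set.Ioo 0 (Real.pi / 2)) :
    (two k₁ k₂ φ).spaceDim θ = 2 * m + 2 * r + 4 := by
  rw [spaceDim, if_neg (mul_cos_sq_lt (hτ _) (hτ _) hξ h hφ).ne]

theorem mul_cos_sq_lt_iff {c φ ψ : ℝ} (hc : 0 < c) (hφ : φ ∈ Set.Ioo 0 (Real.pi / 2))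
    (hψ : ψ ∈ Set.Ioo 0 (Real.pi / 2)) :
    c * Real.cos φ ^ 2 < c * Real.cos ψ ^ 2 ↔ ψ < φ := by
  have hpos : ∀ φ ∈ Set.Ioo 0 (Real.pi / 2), 0 ≤ Real.cos φ := fun φ hφ =>
    Real.cos_nonneg_of_mem_Icc ⟨by linarith [hφ.1, Real.pi_pos], hφ.2.le⟩
  rw [mul_lt_mul_iff_right₀ hc, pow_lt_pow_iff_left₀ (hpos φ hφ) (hpos ψ hψ) two_ne_zero]
  exact Real.strictAntiOn_cos.lt_iff_gt ⟨hφ.1.le, by linarith [hφ.2, Real.pi_pos]⟩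
    ⟨hψ.1.le, by linarith [hψ.2, Real.pi_pos]⟩

/-- By the choice of φ(τ), admissibility reads cos² φ ≤ cos² φ(τ), and the cosine decreases on this
interval. -/
theorem admissible_two_iff_of_lt (hτ : ∀ k, 0 < tauSq θ k) (hξ : 0 < xi θ) {k₁ k₂ : Fin m}
    (hk : k₁ < k₂) (hM : Ml θ = {k₁, k₂}) (h : xi θ < tauSq θ k₁ + tauSq θ k₂) (l₁ l₂ : Fin m)
    (φ : ℝ) : (two l₁ l₂ φ).Admissible θ ↔
      k₁ = l₁ ∧ k₂ = l₂ ∧ (φ ∈ Set.Ioo (phi θ) (Real.pi / 2) ∨ φ = phi θ) := by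
  obtain ⟨hphi, heq⟩ := phi_mem_and_mul_cos_sq_eq hτ hξ hk.ne hM h
  have hab : 0 < tauSq θ k₁ * tauSq θ k₂ := mul_pos (hτ _) (hτ _)
  constructor
  · rintro ⟨hl, hM', hφ, h3⟩
    obtain ⟨rfl, rfl⟩ := eq_and_eq_of_pair_eq hk hl (hM.symm.trans hM')
    rw [← heq, ← not_lt, mul_cos_sq_lt_iff hab hphi hφ, not_lt] at h3
    exact ⟨rfl, rfl, h3.lt_or_eq.imp (fun h => ⟨h, hφ.2⟩) Eq.symm⟩
  · rintro ⟨rfl, rfl, hφ | rfl⟩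
    · have hφ' : φ ∈ Set.Ioo 0 (Real.pi / 2) := ⟨hphi.1.trans hφ.1, hφ.2⟩
      refine ⟨hk, hM, hφ', ?_⟩
      rw [← heq]
      exact ((mul_cos_sq_lt_iff hab hφ' hphi).2 hφ.1).le
    · exact ⟨hk, hM, hphi, heq.le⟩

theorem spaceDim_two_of_lt (hτ : ∀ k, 0 < tauSq θ k) (hξ : 0 < xi θ) {k₁ k₂ : Fin m}
    (hk : k₁ < k₂) (hM : Ml θ = {k₁, k₂}) (h : xi θ < tauSq θ k₁ + tauSq θ k₂) {φ : ℝ}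
    (hφ : φ ∈ Set.Ioo (phi θ) (Real.pi / 2)) :
    (two k₁ k₂ φ).spaceDim θ = 2 * m + 2 * r + 4 := by
  obtain ⟨hphi, heq⟩ := phi_mem_and_mul_cos_sq_eq hτ hξ hk.ne hM h
  have h1 := (mul_cos_sq_lt_iff (mul_pos (hτ k₁) (hτ k₂)) ⟨hphi.1.trans hφ.1, hφ.2⟩ hphi).2 hφ.1
  rw [spaceDim, if_neg (by rw [← heq]; exact h1.ne)]

theorem admissible_one_iff_of_pair (hτ : ∀ k, 0 < tauSq θ k) (hξ : 0 < xi θ) {k₁ k₂ : Fin m}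
    (hk : k₁ < k₂) (hM : Ml θ = {k₁, k₂}) (s : Finset (Fin m)) :
    (one s).Admissible θ ↔ (s = ∅ ∨ ∃ k ∈ Me θ, s = {k}) ∨ s = {k₁} ∨ s = {k₂} ∨
      (s = {k₁, k₂} ∧ tauSq θ k₁ + tauSq θ k₂ ≤ xi θ) := by
  rw [admissible_one_iff hτ hξ, hM, or_assoc]
  refine or_congr_right (or_congr_right ?_)
  simp only [Finset.mem_insert, Finset.mem_singleton, exists_eq_or_imp, exists_eq_left, or_assoc]
  refine or_congr_right (or_congr_right ⟨?_, ?_⟩)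
  · rintro ⟨h1, h2, h3⟩
    have h4 := Finset.eq_of_subset_of_card_le h2 (by rwa [Finset.card_pair hk.ne])
    rw [h4, Finset.sum_pair hk.ne] at h3
    exact ⟨h4, h3⟩
  · rintro ⟨rfl, h⟩
    rw [Finset.card_pair hk.ne, Finset.sum_pair hk.ne]
    exact ⟨one_lt_two, subset_rfl, h⟩

/-- For k in M_e the additional dimension from R_k ≠ 0 is compensated by the vanishing of the
defect, so both kinds of data give the same dimension. -/
theorem spaceDim_list (hξ : 0 < xi θ) {g : Fin ((Me θ).card + 1) → ProjDatum m}
    (hg : ∀ d, (∃ i, g i = d) ↔ d = one ∅ ∨ ∃ k ∈ Me θ, d = one {k})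
    (i : Fin ((Me θ).card + 1)) :
    ((m + r + 1, 1) : ℕ × ℕ) = ((g i).spaceDim θ, (g i).dim) := by
  rcases (hg _).1 ⟨i, rfl⟩ with h | ⟨k, hk, h⟩
  · rw [h, spaceDim_empty hξ]; rfl
  · rw [h, spaceDim_singleton_of_mem_Me hk]; rfl

theorem list_ne_one {g : Fin ((Me θ).card + 1) → ProjDatum m}
    (hg : ∀ d, (∃ i, g i = d) ↔ d = one ∅ ∨ ∃ k ∈ Me θ, d = one {k})
    (i : Fin ((Me θ).card + 1)) {s : Finset (Fin m)} (hs : s.Nonempty) (hM : s ⊆ Ml θ) :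
    g i ≠ one s := fun h => by
  rcases (hg _).1 ⟨i, h⟩ with h | ⟨k, hk, h⟩
  · exact hs.ne_empty (one.inj h)
  · have h1 : k ∈ s := by rw [one.inj h]; simp
    have h2 : tauSq θ k = xi θ := by simpa [Me] using hk
    exact (mem_Ml.1 (hM h1)).ne h2

theorem list_ne_two {g : Fin ((Me θ).card + 1) → ProjDatum m}
    (hg : ∀ d, (∃ i, g i = d) ↔ d = one ∅ ∨ ∃ k ∈ Me θ, d = one {k})
    (i : Fin ((Me θ).card + 1)) {k₁ k₂ : Fin m} {φ : ℝ} : g i ≠ two k₁ k₂ φ := fun h => by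
  rcases (hg _).1 ⟨i, h⟩ with h | ⟨k, hk, h⟩ <;> cases h

end ProjDatum

/-! ### The lists of the theorem -/

section Cases

open ProjDatum

variable {m r : ℕ} {θ : Ray m r → ℝ}

theorem exists_isClassification_of_xi_eq_zero (hτ : ∀ i, Real.cos (θ i) ≠ 0)
    (hpair : ∀ k : Fin m, θ (.fst k) = θ (.snd k)) (hξ : xi θ = 0) :
    ∃ model, IsClassification.{u} θ (I := Unit) (fun _ => (m + r, 1)) model := by
  have hτ' : ∀ k, 0 < tauSq θ k := fun k => sq_pos_of_ne_zero (hτ (.fst k))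
  have hM : Ml θ = ∅ := Finset.eq_empty_of_forall_notMem fun k hk => by
    have := mem_Ml.1 hk
    linarith [hτ' k]
  refine (exists_isClassification.{u} (θ := θ) hτ hpair (by simp [hM])
    (f := fun _ : Unit => one ∅) (fun _ _ _ => rfl) (fun d => ?_) (dim := fun _ => (m + r, 1))
    (fun _ => by simp [spaceDim, hξ, dim])).imp fun model h => h.1
  · cases d with
    | one s =>
      simp only [exists_const, one.injEq]
      change ∑ k ∈ s, tauSq θ k ≤ xi θ ↔ _
      rw [hξ]
      constructor
      · intro h
        by_contra hs
        exact absurd h (not_le.2 (Finset.sum_pos (fun k _ => hτ' k)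
          (Finset.nonempty_iff_ne_empty.2 (Ne.symm hs))))
      · rintro rfl
        simp
    | two k₁ k₂ φ => simp [Admissible, hM, eq_comm (a := (∅ : Finset (Fin m)))]

theorem exists_isClassification_of_Ml_eq_empty (hτ : ∀ i, Real.cos (θ i) ≠ 0)
    (hpair : ∀ k : Fin m, θ (.fst k) = θ (.snd k)) (hξ : 0 < xi θ) (hM : Ml θ = ∅) :
    ∃ model, IsClassification.{u} θ (I := Fin ((Me θ).card + 1))
        (fun _ => (m + r + 1, 1)) model := by
  have hτ' : ∀ k, 0 < tauSq θ k := fun k => sq_pos_of_ne_zero (hτ (.fst k))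
  obtain ⟨g, hgi, hg⟩ := exists_list_empty_singleton (Me θ)
  refine (exists_isClassification.{u} (θ := θ) hτ hpair (by simp [hM])
    hgi (fun d => ?_) (dim := fun _ => (m + r + 1, 1)) (spaceDim_list hξ hg)).imp fun model h => h.1
  · rw [hg]
    cases d with
    | one s =>
      rw [admissible_one_iff hτ' hξ, hM]
      simp only [one.injEq]
      refine or_congr_right (or_iff_left ?_)
      rintro (⟨k, hk, -⟩ | ⟨h1, h2, -⟩)
      · simp at hk
      · simp [Finset.subset_empty.1 h2] at h1
    | two k₁ k₂ φ => simp [Admissible, hM, eq_comm (a := (∅ : Finset (Fin m)))]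

theorem exists_isClassification_of_card_Ml_eq_one (hτ : ∀ i, Real.cos (θ i) ≠ 0)
    (hpair : ∀ k : Fin m, θ (.fst k) = θ (.snd k)) (hξ : 0 < xi θ) (hM : (Ml θ).card = 1) :
    ∃ model, IsClassification.{u} θ (I := Fin ((Me θ).card + 1) ⊕ Unit)
        (Sum.elim (fun _ => (m + r + 1, 1)) (fun _ => (m + r + 2, 1))) model := by
  have hτ' : ∀ k, 0 < tauSq θ k := fun k => sq_pos_of_ne_zero (hτ (.fst k))
  obtain ⟨g, hgi, hg⟩ := exists_list_empty_singleton (Me θ)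
  obtain ⟨k, hk⟩ := Finset.card_eq_one.1 hM
  refine (exists_isClassification.{u} (θ := θ) hτ hpair (by simp [hM])
    (f := Sum.elim g fun _ : Unit => one {k})
    (hgi.sumElim (fun _ _ _ => rfl) fun i _ => list_ne_one hg i (by simp) hk.ge)
    (fun d => ?_) (dim := Sum.elim (fun _ => (m + r + 1, 1)) (fun _ => (m + r + 2, 1))) ?_).imp fun model h => h.1
  · rw [Sum.exists]
    simp only [Sum.elim_inl, Sum.elim_inr, hg, exists_const]
    cases d with
    | one s =>
      rw [admissible_one_iff hτ' hξ, hk, or_assoc]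
      simp only [one.injEq, Finset.mem_singleton, exists_eq_left]
      refine or_congr_right (or_congr_right ?_)
      rw [or_iff_left, eq_comm]
      rintro ⟨h1, h2, -⟩
      exact absurd (Finset.card_le_card h2) (by simpa using h1)
    | two k₁ k₂ φ =>
      simp only [Admissible, reduceCtorEq, and_false, exists_false, or_false, iff_false]
      rintro ⟨h1, h2, -⟩
      rw [h2, Finset.card_pair h1.ne] at hM
      exact absurd hM (by norm_num)
  · rintro (i | i)
    · exact spaceDim_list hξ hg i
    · simp only [Sum.elim_inr]
      rw [spaceDim_singleton_of_mem_Ml (by simp [hk])]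
      rfl

theorem exists_lt_of_card_eq_two {α : Type*} [LinearOrder α] {s : Finset α} (h : s.card = 2) :
    ∃ k₁ k₂, k₁ < k₂ ∧ s = {k₁, k₂} := by
  obtain ⟨x, y, hxy, rfl⟩ := Finset.card_eq_two.1 h
  rcases hxy.lt_or_gt with h | h
  · exact ⟨x, y, h, rfl⟩
  · exact ⟨y, x, h, Finset.pair_comm x y⟩

theorem correspondsToAngle_of_hasGram {H : Type*} [NormedAddCommGroup H] [InnerProductSpace ℂ H]
    {S : SubspaceSystem (StarVertex m r) H} {k₁ k₂ : Fin m} (hk : k₁ < k₂) (hM : Ml θ = {k₁, k₂})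
    {φ : ℝ} (h : S.HasGram (gramB θ (pairQ k₁ k₂ φ))) : CorrespondsToAngle θ S φ := by
  intro l₁ l₂ hl hM'
  obtain ⟨rfl, rfl⟩ := eq_and_eq_of_pair_eq hk hl (hM.symm.trans hM')
  exact h

theorem pair_injective {k₁ k₂ : Fin m} (hk : k₁ ≠ k₂) :
    Function.Injective (![one {k₁}, one {k₂}] : Fin 2 → ProjDatum m) := by
  intro i j h
  fin_cases i <;> fin_cases j <;> simp_all [eq_comm]

theorem exists_isClassification_of_lt_sum (hτ : ∀ i, Real.cos (θ i) ≠ 0)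
    (hpair : ∀ k : Fin m, θ (.fst k) = θ (.snd k)) (hξ : 0 < xi θ) (hM : (Ml θ).card = 2)
    (hsum : xi θ < ∑ k ∈ Ml θ, tauSq θ k) :
    phi θ ∈ Set.Ioo 0 (Real.pi / 2) ∧
      ∃ model, IsClassification.{u} θ
        (I := Fin ((Me θ).card + 1) ⊕ Fin 2 ⊕ Set.Ioo (phi θ) (Real.pi / 2) ⊕ Unit)
        (Sum.elim (fun _ => (m + r + 1, 1)) <| Sum.elim (fun _ => (m + r + 2, 1)) <|
          Sum.elim (fun _ => (2 * m + 2 * r + 4, 2)) (fun _ => (2 * m + 2 * r + 3, 2))) model ∧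
        (∀ φ, CorrespondsToAngle θ (model (.inr (.inr (.inl φ)))) φ) ∧
        CorrespondsToAngle θ (model (.inr (.inr (.inr ())))) (phi θ) := by
  have hτ' : ∀ k, 0 < tauSq θ k := fun k => sq_pos_of_ne_zero (hτ (.fst k))
  obtain ⟨g, hgi, hg⟩ := exists_list_empty_singleton (Me θ)
  obtain ⟨k₁, k₂, hk, hMk⟩ := exists_lt_of_card_eq_two hM
  rw [hMk, Finset.sum_pair hk.ne] at hsum
  obtain ⟨hphi, heq⟩ := phi_mem_and_mul_cos_sq_eq hτ' hξ hk.ne hMk hsum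
  refine ⟨hphi, ?_⟩
  refine (exists_isClassification.{u} (θ := θ) hτ hpair hM.le
    -- The set {k₁, k₂} is missing because its sum exceeds ξ; the angles take their place only from
    -- φ(τ) onwards.
    (f := Sum.elim g <| Sum.elim ![one {k₁}, one {k₂}] <|
      Sum.elim (fun φ : Set.Ioo (phi θ) (Real.pi / 2) => two k₁ k₂ φ)
        fun _ : Unit => two k₁ k₂ (phi θ))
    (hgi.sumElim ((pair_injective hk.ne).sumElim (Function.Injective.sumElim ?_ ?_ ?_) ?_) ?_)
    (fun d => ?_) (dim := Sum.elim (fun _ => (m + r + 1, 1)) <|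
      Sum.elim (fun _ => (m + r + 2, 1)) <|
        Sum.elim (fun _ => (2 * m + 2 * r + 4, 2)) (fun _ => (2 * m + 2 * r + 3, 2))) ?_).imp fun model h => ⟨h.1, fun φ => correspondsToAngle_of_hasGram hk hMk (h.2 (.inr (.inr (.inl φ)))),
      correspondsToAngle_of_hasGram hk hMk (h.2 (.inr (.inr (.inr ()))))⟩
  · exact fun φ ψ h => Subtype.ext (two.inj h).2.2
  · exact fun _ _ _ => rfl
  · exact fun φ _ h => φ.2.1.ne' (two.inj h).2.2
  · rintro i (φ | φ) <;> fin_cases i <;> simp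
  · rintro i (j | φ | φ)
    · fin_cases j <;> exact list_ne_one hg i (by simp) (by simp [hMk])
    · exact list_ne_two hg i
    · exact list_ne_two hg i
  · simp only [Sum.exists, Sum.elim_inl, Sum.elim_inr, hg, exists_const, Fin.exists_fin_two,
      Matrix.cons_val_zero, Matrix.cons_val_one, Matrix.cons_val_fin_one]
    cases d with
    | one s =>
      rw [admissible_one_iff_of_pair hτ' hξ hk hMk]
      simp only [one.injEq, reduceCtorEq, exists_false, or_false, not_le.2 hsum, and_false,
        eq_comm (a := s)]
    | two l₁ l₂ φ =>
      rw [admissible_two_iff_of_lt hτ' hξ hk hMk hsum]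
      simp only [reduceCtorEq, two.injEq, and_false, exists_false, or_false, false_or,
        Subtype.exists, exists_prop]
      constructor
      · rintro ⟨rfl, rfl, h | h⟩
        · exact Or.inl ⟨φ, h, rfl, rfl, rfl⟩
        · exact Or.inr ⟨rfl, rfl, h.symm⟩
      · rintro (⟨ψ, h, rfl, rfl, rfl⟩ | ⟨rfl, rfl, rfl⟩)
        · exact ⟨rfl, rfl, Or.inl h⟩
        · exact ⟨rfl, rfl, Or.inr rfl⟩
  · rintro (i | j | φ | φ)
    · exact spaceDim_list hξ hg i
    · fin_cases j
      · exact Prod.ext (spaceDim_singleton_of_mem_Ml (by simp [hMk])).symm rfl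
      · exact Prod.ext (spaceDim_singleton_of_mem_Ml (by simp [hMk])).symm rfl
    · exact Prod.ext (spaceDim_two_of_lt hτ' hξ hk hMk hsum φ.2).symm rfl
    · refine Prod.ext (Eq.symm ?_) rfl
      -- At the extreme angle the defect is degenerate of rank 1, which costs one dimension.
      change (two k₁ k₂ (phi θ)).spaceDim θ = _
      rw [spaceDim, if_pos heq]
      rfl

theorem exists_isClassification_of_sum_eq (hτ : ∀ i, Real.cos (θ i) ≠ 0)
    (hpair : ∀ k : Fin m, θ (.fst k) = θ (.snd k)) (hξ : 0 < xi θ) (hM : (Ml θ).card = 2)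
    (hsum : ∑ k ∈ Ml θ, tauSq θ k = xi θ) :
    ∃ model, IsClassification.{u} θ
        (I := Fin ((Me θ).card + 1) ⊕ Fin 3 ⊕ Set.Ioo (0 : ℝ) (Real.pi / 2))
        (Sum.elim (fun _ => (m + r + 1, 1)) <| Sum.elim (fun _ => (m + r + 2, 1)) <|
          (fun _ => (2 * m + 2 * r + 4, 2))) model ∧
        ∀ φ, CorrespondsToAngle θ (model (.inr (.inr φ))) φ := by
  have hτ' : ∀ k, 0 < tauSq θ k := fun k => sq_pos_of_ne_zero (hτ (.fst k))
  obtain ⟨g, hgi, hg⟩ := exists_list_empty_singleton (Me θ)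
  obtain ⟨k₁, k₂, hk, hMk⟩ := exists_lt_of_card_eq_two hM
  have hsum' := hsum
  rw [hMk, Finset.sum_pair hk.ne] at hsum
  refine (exists_isClassification.{u} (θ := θ) hτ hpair hM.le
    -- The third system has Q_{k₁} = Q_{k₂} = 0. The two ranks add 2 to m + r, and the defect
    -- vanishes since the sum is exactly ξ.
    (f := Sum.elim g <| Sum.elim (Fin.cons (one {k₁, k₂}) ![one {k₁}, one {k₂}]) <|
      fun φ : Set.Ioo 0 (Real.pi / 2) => two k₁ k₂ φ)
    (hgi.sumElim ((Fin.cons_injective_iff.2 ⟨?_, pair_injective hk.ne⟩).sumElim ?_ ?_) ?_)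
    (fun d => ?_) (dim := Sum.elim (fun _ => (m + r + 1, 1)) <|
      Sum.elim (fun _ => (m + r + 2, 1)) <| fun _ => (2 * m + 2 * r + 4, 2)) ?_).imp fun model h => ⟨h.1, fun φ => correspondsToAngle_of_hasGram hk hMk (h.2 (.inr (.inr φ)))⟩
  · rintro ⟨i, hi⟩
    have h1 : (Ml θ).card = 1 := by
      fin_cases i <;> simp only [one.injEq, Fin.zero_eta, Fin.mk_one, Matrix.cons_val_zero,
        Matrix.cons_val_one, Matrix.cons_val_fin_one] at hi <;> simp [hMk, ← hi]
    omega
  · exact fun φ ψ h => Subtype.ext (two.inj h).2.2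
  · rintro i φ
    fin_cases i <;> exact fun h => nomatch h
  · rintro i (j | φ)
    · fin_cases j <;> exact list_ne_one hg i (by simp) (by simp [hMk])
    · exact list_ne_two hg i
  · simp only [Sum.exists, Sum.elim_inl, Sum.elim_inr, hg, Fin.exists_fin_succ, Fin.cons_zero,
      Fin.cons_succ, Matrix.cons_val_zero, Matrix.cons_val_succ, IsEmpty.exists_iff, or_false]
    cases d with
    | one s =>
      rw [admissible_one_iff_of_pair hτ' hξ hk hMk]
      simp only [one.injEq, reduceCtorEq, exists_false, or_false, hsum.le, and_true,
        eq_comm (a := s)]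
      exact or_congr_right (by rw [← or_assoc]; exact or_comm)
    | two l₁ l₂ φ =>
      rw [admissible_two_iff_of_le hτ' hξ hk hMk hsum.le]
      simp only [reduceCtorEq, two.injEq, and_false, exists_false, or_false, false_or,
        Subtype.exists, exists_prop]
      constructor
      · rintro ⟨rfl, rfl, h⟩
        exact ⟨φ, h, rfl, rfl, rfl⟩
      · rintro ⟨ψ, h, rfl, rfl, rfl⟩
        exact ⟨rfl, rfl, h⟩
  · rintro (i | j | φ)
    · exact spaceDim_list hξ hg i
    · fin_cases j
      · refine Prod.ext (Eq.symm ?_) rfl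
        change (one {k₁, k₂}).spaceDim θ = _
        rw [← hMk, spaceDim, if_pos hsum', hM]
        rfl
      · exact Prod.ext (spaceDim_singleton_of_mem_Ml (by simp [hMk])).symm rfl
      · exact Prod.ext (spaceDim_singleton_of_mem_Ml (by simp [hMk])).symm rfl
    · exact Prod.ext (spaceDim_two_of_le hτ' hξ hsum.le φ.2).symm rfl

theorem exists_isClassification_of_sum_lt (hτ : ∀ i, Real.cos (θ i) ≠ 0)
    (hpair : ∀ k : Fin m, θ (.fst k) = θ (.snd k)) (hξ : 0 < xi θ) (hM : (Ml θ).card = 2)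
    (hsum : ∑ k ∈ Ml θ, tauSq θ k < xi θ) :
    ∃ model, IsClassification.{u} θ
        (I := Fin ((Me θ).card + 1) ⊕ Fin 2 ⊕ Unit ⊕ Set.Ioo (0 : ℝ) (Real.pi / 2))
        (Sum.elim (fun _ => (m + r + 1, 1)) <| Sum.elim (fun _ => (m + r + 2, 1)) <|
          Sum.elim (fun _ => (m + r + 3, 1)) (fun _ => (2 * m + 2 * r + 4, 2))) model ∧
        ∀ φ, CorrespondsToAngle θ (model (.inr (.inr (.inr φ)))) φ := by
  have hτ' : ∀ k, 0 < tauSq θ k := fun k => sq_pos_of_ne_zero (hτ (.fst k))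
  obtain ⟨g, hgi, hg⟩ := exists_list_empty_singleton (Me θ)
  obtain ⟨k₁, k₂, hk, hMk⟩ := exists_lt_of_card_eq_two hM
  have hsum' := hsum
  rw [hMk, Finset.sum_pair hk.ne] at hsum
  refine (exists_isClassification.{u} (θ := θ) hτ hpair hM.le
    (f := Sum.elim g <| Sum.elim ![one {k₁}, one {k₂}] <|
      -- The same set as in the case of equality, but its defect is now positive and contributes the
      -- additional dimension.
      Sum.elim (fun _ : Unit => one {k₁, k₂})
        fun φ : Set.Ioo 0 (Real.pi / 2) => two k₁ k₂ φ)
    (hgi.sumElim ((pair_injective hk.ne).sumElim (Function.Injective.sumElim ?_ ?_ ?_) ?_) ?_)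
    (fun d => ?_) (dim := Sum.elim (fun _ => (m + r + 1, 1)) <|
      Sum.elim (fun _ => (m + r + 2, 1)) <|
        Sum.elim (fun _ => (m + r + 3, 1)) (fun _ => (2 * m + 2 * r + 4, 2))) ?_).imp fun model h => ⟨h.1, fun φ => correspondsToAngle_of_hasGram hk hMk (h.2 (.inr (.inr (.inr φ))))⟩
  · exact fun _ _ _ => rfl
  · exact fun φ ψ h => Subtype.ext (two.inj h).2.2
  · exact fun φ _ h => nomatch h
  · rintro i (φ | φ)
    · intro h0
      have h1 : (Ml θ).card = 1 := by
        fin_cases i <;> simp only [Sum.elim_inl, one.injEq, Fin.zero_eta, Fin.mk_one,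
          Matrix.cons_val_zero, Matrix.cons_val_one, Matrix.cons_val_fin_one] at h0 <;>
          simp [hMk, ← h0]
      omega
    · fin_cases i <;> simp
  · rintro i (j | φ | φ)
    · fin_cases j <;> exact list_ne_one hg i (by simp) (by simp [hMk])
    · exact list_ne_one hg i (by simp) hMk.ge
    · exact list_ne_two hg i
  · simp only [Sum.exists, Sum.elim_inl, Sum.elim_inr, hg, exists_const, Fin.exists_fin_two,
      Matrix.cons_val_zero, Matrix.cons_val_one, Matrix.cons_val_fin_one]
    cases d with
    | one s =>
      rw [admissible_one_iff_of_pair hτ' hξ hk hMk]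
      simp only [one.injEq, reduceCtorEq, exists_false, or_false, hsum.le, and_true,
        eq_comm (a := s), or_assoc]
    | two l₁ l₂ φ =>
      rw [admissible_two_iff_of_le hτ' hξ hk hMk hsum.le]
      simp only [reduceCtorEq, two.injEq, and_false, exists_false, or_false, false_or,
        Subtype.exists, exists_prop]
      constructor
      · rintro ⟨rfl, rfl, h⟩
        exact ⟨φ, h, rfl, rfl, rfl⟩
      · rintro ⟨ψ, h, rfl, rfl, rfl⟩
        exact ⟨rfl, rfl, h⟩
  · rintro (i | j | φ | φ)
    · exact spaceDim_list hξ hg i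
    · fin_cases j
      · exact Prod.ext (spaceDim_singleton_of_mem_Ml (by simp [hMk])).symm rfl
      · exact Prod.ext (spaceDim_singleton_of_mem_Ml (by simp [hMk])).symm rfl
    · refine Prod.ext (Eq.symm ?_) rfl
      change (one {k₁, k₂}).spaceDim θ = _
      rw [← hMk, spaceDim, if_neg hsum'.ne, hM]
      rfl
    · exact Prod.ext (spaceDim_two_of_le hτ' hξ hsum.le φ.2).symm rfl

end Cases

/-! ### Intertwiners and functional calculus -/

section Intertwiners

variable {K K' : Type*} [NormedAddCommGroup K] [InnerProductSpace ℂ K] [CompleteSpace K]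
  [NormedAddCommGroup K'] [InnerProductSpace ℂ K'] [CompleteSpace K']

/-- The pairs of operators intertwined by `C` together with their adjoints. -/
def intertwinedPairs (C : K →L[ℂ] K') : StarSubalgebra ℂ ((K →L[ℂ] K) × (K' →L[ℂ] K')) where
  carrier := {N | C ∘L N.1 = N.2 ∘L C ∧ C ∘L star N.1 = star N.2 ∘L C}
  mul_mem' {M N} hM hN := by
    refine ⟨?_, ?_⟩
    · change C ∘L (M.1 ∘L N.1) = (M.2 ∘L N.2) ∘L C
      rw [← ContinuousLinearMap.comp_assoc, hM.1, ContinuousLinearMap.comp_assoc, hN.1,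
        ContinuousLinearMap.comp_assoc]
    · change C ∘L star (M.1 * N.1) = star (M.2 * N.2) ∘L C
      rw [star_mul, star_mul]
      change C ∘L (star N.1 ∘L star M.1) = (star N.2 ∘L star M.2) ∘L C
      rw [← ContinuousLinearMap.comp_assoc, hN.2, ContinuousLinearMap.comp_assoc, hM.2,
        ContinuousLinearMap.comp_assoc]
  add_mem' {M N} hM hN := by
    refine ⟨?_, ?_⟩
    · change C ∘L (M.1 + N.1) = (M.2 + N.2) ∘L C
      rw [ContinuousLinearMap.comp_add, ContinuousLinearMap.add_comp, hM.1, hN.1]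
    · change C ∘L star (M.1 + N.1) = star (M.2 + N.2) ∘L C
      rw [star_add, star_add, ContinuousLinearMap.comp_add, ContinuousLinearMap.add_comp, hM.2, hN.2]
  algebraMap_mem' c := by
    refine ⟨?_, ?_⟩
    · ext x
      change C (c • x) = c • C x
      rw [map_smul]
    · change C ∘L star (algebraMap ℂ (K →L[ℂ] K) c) = star (algebraMap ℂ (K' →L[ℂ] K') c) ∘L C
      rw [← algebraMap_star_comm, ← algebraMap_star_comm]
      ext x
      change C (star c • x) = star c • C x
      rw [map_smul]
  star_mem' {N} hN := by
    refine ⟨hN.2, ?_⟩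
    change C ∘L star (star N.1) = star (star N.2) ∘L C
    rw [star_star, star_star, hN.1]

theorem isClosed_intertwinedPairs (C : K →L[ℂ] K') : 
    IsClosed (intertwinedPairs C : Set ((K →L[ℂ] K) × (K' →L[ℂ] K'))) := by
  have h1 : Continuous fun N : (K →L[ℂ] K) × (K' →L[ℂ] K') => C ∘L N.1 := by fun_prop
  have h2 : Continuous fun N : (K →L[ℂ] K) × (K' →L[ℂ] K') => N.2 ∘L C := by fun_prop
  have h3 : Continuous fun N : (K →L[ℂ] K) × (K' →L[ℂ] K') => C ∘L star N.1 := by fun_prop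
  have h4 : Continuous fun N : (K →L[ℂ] K) × (K' →L[ℂ] K') => star N.2 ∘L C := by fun_prop
  exact (isClosed_eq h1 h2).inter (isClosed_eq h3 h4)

/-- An operator intertwining self-adjoint operators intertwines functions of them. -/
theorem comp_cfc {C : K →L[ℂ] K'} {A : K →L[ℂ] K} {A' : K' →L[ℂ] K'} (hA : IsSelfAdjoint A)
    (hA' : IsSelfAdjoint A') (h : C ∘L A = A' ∘L C) (f : ℝ → ℝ)
    (hf : ContinuousOn f (spectrum ℝ A ∪ spectrum ℝ A')) : C ∘L cfc f A = cfc f A' ∘L C := by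
  -- The calculus is applied to the single self-adjoint element (A, A') of the product algebra: its
  -- functions stay in the closed star-subalgebra of intertwined pairs and are computed
  -- componentwise.
  have hmem : (A, A') ∈ intertwinedPairs C := ⟨h, by
    change C ∘L star A = star A' ∘L C
    rw [hA.star_eq, hA'.star_eq, h]⟩
  have hp : IsSelfAdjoint (A, A') := Prod.ext hA hA'
  have : ContinuousFunctionalCalculus ℝ ((K →L[ℂ] K) × (K' →L[ℂ] K')) IsSelfAdjoint :=
    IsSelfAdjoint.instContinuousFunctionalCalculus
  have hcl : IsClosed (intertwinedPairs C : Set ((K →L[ℂ] K) × (K' →L[ℂ] K'))) :=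
    isClosed_intertwinedPairs C
  have h1 : cfc f (A, A') ∈ intertwinedPairs C := cfc_mem (𝕜' := ℂ) f hmem
  rw [cfc_map_prod (S := ℂ) f A A' hf hp hA hA'] at h1
  exact h1.1

theorem abs_le_norm_of_mem_spectrum {N : K →L[ℂ] K} {x : ℝ} (hx : x ∈ spectrum ℝ N) :
    |x| ≤ ‖N‖ := by
  rcases subsingleton_or_nontrivial (K →L[ℂ] K) with hs | hs
  · rw [spectrum.of_subsingleton] at hx
    exact hx.elim
  · exact spectrum.norm_le_norm_of_mem hx

/-- The square root of `ξ - N`. -/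
noncomputable def sqrtSub (ξ : ℝ) (N : K →L[ℂ] K) : K →L[ℂ] K :=
  cfc (fun x : ℝ => Real.sqrt (ξ - x)) N

theorem isSelfAdjoint_sqrtSub (ξ : ℝ) (N : K →L[ℂ] K) : IsSelfAdjoint (sqrtSub ξ N) :=
  cfc_predicate _ _

theorem sqrtSub_mul_self {ξ : ℝ} {N : K →L[ℂ] K} (hN : IsSelfAdjoint N) (h : ‖N‖ ≤ ξ) :
    sqrtSub ξ N * sqrtSub ξ N = algebraMap ℝ (K →L[ℂ] K) ξ - N := by
  have hc : ContinuousOn (fun x : ℝ => Real.sqrt (ξ - x)) (spectrum ℝ N) := by fun_prop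
  have h1 : ∀ x ∈ spectrum ℝ N, Real.sqrt (ξ - x) * Real.sqrt (ξ - x) = ξ - x := fun x hx =>
    Real.mul_self_sqrt (sub_nonneg.2 ((le_abs_self x).trans
      ((abs_le_norm_of_mem_spectrum hx).trans h)))
  rw [sqrtSub, ← cfc_mul _ _ N hc hc, cfc_congr h1, cfc_sub (fun _ => ξ) (fun x => x) N,
    cfc_const ξ N, cfc_id' ℝ N]

theorem sqrtSub_sqrtSub_apply {ξ : ℝ} {N : K →L[ℂ] K} (hN : IsSelfAdjoint N) (h : ‖N‖ ≤ ξ)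
    (x : K) : sqrtSub ξ N (sqrtSub ξ N x) = (ξ : ℂ) • x - N x :=
  congrArg (fun M : K →L[ℂ] K => M x) (sqrtSub_mul_self hN h)

/-- The square of the root is ξ - N, and ξ lies outside the spectrum of N because it exceeds the
norm. -/
theorem isUnit_sqrtSub {ξ : ℝ} {N : K →L[ℂ] K} (hN : IsSelfAdjoint N) (h : ‖N‖ < ξ) :
    IsUnit (sqrtSub ξ N) := by
  rw [← isUnit_mul_self_iff, sqrtSub_mul_self hN h.le, ← spectrum.notMem_iff]
  exact fun hx => absurd ((le_abs_self ξ).trans (abs_le_norm_of_mem_spectrum hx)) (not_le.2 h)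

theorem comp_sqrtSub {C : K →L[ℂ] K'} {N : K →L[ℂ] K} {N' : K' →L[ℂ] K'} (hN : IsSelfAdjoint N)
    (hN' : IsSelfAdjoint N') (h : C ∘L N = N' ∘L C) (ξ : ℝ) :
    C ∘L sqrtSub ξ N = sqrtSub ξ N' ∘L C :=
  comp_cfc hN hN' h _ (by fun_prop)

theorem norm_sqrtSub_le (ξ : ℝ) (N : K →L[ℂ] K) : ‖sqrtSub ξ N‖ ≤ Real.sqrt (ξ + ‖N‖) :=
  norm_cfc_le (Real.sqrt_nonneg _) fun x hx => by
    rw [Real.norm_of_nonneg (Real.sqrt_nonneg _)]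
    exact Real.sqrt_le_sqrt
      (by linarith [neg_le_abs x, abs_le_norm_of_mem_spectrum hx])

/-- |arctan| < π/2 ≤ 2. The bound does not depend on A, so one small parameter s will serve all
pairs simultaneously. -/
theorem norm_cfc_arctan_le (A : K →L[ℂ] K) : ‖cfc Real.arctan A‖ ≤ 2 :=
  norm_cfc_le zero_le_two fun x _ => by
    rw [Real.norm_eq_abs, abs_le]
    constructor <;> linarith [Real.neg_pi_div_two_lt_arctan x, Real.arctan_lt_pi_div_two x,
      Real.pi_le_four]

/-- No information is lost under arctan: the spectra of the images lie in (-π/2, π/2), where tan is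
continuous and recovers the operators. -/
theorem comp_eq_of_comp_cfc_arctan {C : K →L[ℂ] K'} {A : K →L[ℂ] K} {A' : K' →L[ℂ] K'}
    (hA : IsSelfAdjoint A) (hA' : IsSelfAdjoint A')
    (h : C ∘L cfc Real.arctan A = cfc Real.arctan A' ∘L C) : C ∘L A = A' ∘L C := by
  have himg : ∀ s : Set ℝ, ContinuousOn Real.tan (Real.arctan '' s) := fun s =>
    Real.continuousOn_tan_Ioo.mono (by
      rintro _ ⟨x, -, rfl⟩
      exact ⟨Real.neg_pi_div_two_lt_arctan x, Real.arctan_lt_pi_div_two x⟩)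
  have hc : ∀ s, ContinuousOn Real.arctan s := fun s => Real.continuous_arctan.continuousOn
  have h1 := comp_cfc (cfc_predicate Real.arctan A) (cfc_predicate Real.arctan A') h Real.tan (by
    rw [cfc_map_spectrum Real.arctan A hA (hc _), cfc_map_spectrum Real.arctan A' hA' (hc _),
      ← Set.image_union]
    exact himg _)
  rwa [← cfc_comp Real.tan Real.arctan A hA (himg _) (hc _),
    ← cfc_comp Real.tan Real.arctan A' hA' (himg _) (hc _),
    show Real.tan ∘ Real.arctan = id from funext Real.tan_arctan, cfc_id ℝ A hA,
    cfc_id ℝ A' hA'] at h1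

end Intertwiners

/-! ### Operators as block matrices -/

section Blocks

set_option linter.unusedSectionVars false

variable {K K' K'' : Type*} [NormedAddCommGroup K] [InnerProductSpace ℂ K]
  [NormedAddCommGroup K'] [InnerProductSpace ℂ K'] [NormedAddCommGroup K'']
  [InnerProductSpace ℂ K''] {α β γ : Type*} [Fintype α] [Fintype β] [Fintype γ]
  [DecidableEq α] [DecidableEq β] [DecidableEq γ]

/-- The embedding of a summand. -/
noncomputable def blockIncl (K : Type*) [NormedAddCommGroup K] [InnerProductSpace ℂ K] (a : α) :
    K →L[ℂ] PiLp 2 fun _ : α => K :=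
  LinearMap.mkContinuous
    { toFun := fun x => PiLp.single 2 a x
      map_add' := fun x y => PiLp.single_add 2 a
      map_smul' := fun c x => by
        ext b
        by_cases h : b = a
        · subst h; simp
        · simp [h] } 1 fun x => by
    rw [one_mul]
    exact (PiLp.norm_single 2 (fun _ : α => K) a x).le

theorem blockIncl_apply (a b : α) (x : K) : blockIncl K a x b = if b = a then x else 0 := by
  change (PiLp.single 2 a x : PiLp 2 fun _ : α => K) b = _
  split_ifs with h
  · subst h; simp
  · simp [h]

theorem norm_blockIncl_apply (a : α) (x : K) : ‖blockIncl K a x‖ = ‖x‖ :=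
  PiLp.norm_single 2 (fun _ : α => K) a x

theorem sum_blockIncl (x : PiLp 2 fun _ : α => K) : ∑ a, blockIncl K a (x a) = x := by
  ext b
  simp [blockIncl_apply]

theorem block_ext {E : Type*} [NormedAddCommGroup E] [NormedSpace ℂ E]
    {f g : (PiLp 2 fun _ : α => K) →L[ℂ] E} (h : ∀ a x, f (blockIncl K a x) = g (blockIncl K a x)) :
    f = g := by
  ext x
  rw [← sum_blockIncl x, map_sum, map_sum]
  exact Finset.sum_congr rfl fun a _ => h a _

theorem inner_blockIncl_left (a : α) (x : K) (y : PiLp 2 fun _ : α => K) :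
    ⟪blockIncl K a x, y⟫_ℂ = ⟪x, y a⟫_ℂ := by
  rw [PiLp.inner_apply, Finset.sum_eq_single a]
  · rw [blockIncl_apply, if_pos rfl]
  · intro b _ hb
    rw [blockIncl_apply, if_neg hb, inner_zero_left]
  · exact fun h => absurd (Finset.mem_univ a) h

/-- The operator with given matrix entries. -/
noncomputable def blockOp (M : β → α → K →L[ℂ] K') : (PiLp 2 fun _ : α => K) →L[ℂ] PiLp 2 fun _ : β => K' :=
  ∑ b, ∑ a, blockIncl K' b ∘L M b a ∘L PiLp.proj 2 (fun _ => K) a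

theorem blockOp_apply (M : β → α → K →L[ℂ] K') (x : PiLp 2 fun _ : α => K) (b : β) :
    blockOp M x b = ∑ a, M b a (x a) := by
  simp only [blockOp, sum_apply, ContinuousLinearMap.comp_apply,
    PiLp.proj_apply, WithLp.ofLp_sum, Finset.sum_apply, blockIncl_apply]
  rw [Finset.sum_eq_single b]
  · simp
  · intro c _ hc
    simp [hc.symm]
  · exact fun h => absurd (Finset.mem_univ b) h

theorem blockOp_blockIncl (M : β → α → K →L[ℂ] K') (a : α) (x : K) (b : β) :
    blockOp M (blockIncl K a x) b = M b a x := by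
  rw [blockOp_apply, Finset.sum_eq_single a]
  · rw [blockIncl_apply, if_pos rfl]
  · intro c _ hc
    rw [blockIncl_apply, if_neg hc, map_zero]
  · exact fun h => absurd (Finset.mem_univ a) h

theorem norm_sum_sum_le {E : Type*} [SeminormedAddCommGroup E] {f : β → α → E} {c : β → α → ℝ}
    (h : ∀ b a, ‖f b a‖ ≤ c b a) : ‖∑ b, ∑ a, f b a‖ ≤ ∑ b, ∑ a, c b a :=
  (norm_sum_le _ _).trans (Finset.sum_le_sum fun b _ =>
    (norm_sum_le _ _).trans (Finset.sum_le_sum fun a _ => h b a))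

theorem norm_blockOp_le (M : β → α → K →L[ℂ] K') : ‖blockOp M‖ ≤ ∑ b, ∑ a, ‖M b a‖ := by
  refine ContinuousLinearMap.opNorm_le_bound _
    (Finset.sum_nonneg fun b _ => Finset.sum_nonneg fun a _ => norm_nonneg _) fun x => ?_
  have h1 : blockOp M x = ∑ b, ∑ a, blockIncl K' b (M b a (x a)) := by simp [blockOp]
  have h2 : ∀ b a, ‖blockIncl K' b (M b a (x a))‖ ≤ ‖M b a‖ * ‖x‖ := fun b a => by
    rw [norm_blockIncl_apply]
    exact ((M b a).le_opNorm _).trans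
      (mul_le_mul_of_nonneg_left (PiLp.norm_apply_le x a) (norm_nonneg _))
  rw [h1]
  refine (norm_sum_sum_le h2).trans_eq ?_
  simp only [Finset.sum_mul]

/-- The diagonal operator with given entries. -/
noncomputable def blockDiag (M : α → K →L[ℂ] K') : (PiLp 2 fun _ : α => K) →L[ℂ] PiLp 2 fun _ : α => K' :=
  blockOp fun b a => if b = a then M a else 0

theorem blockDiag_apply (M : α → K →L[ℂ] K') (x : PiLp 2 fun _ : α => K) (a : α) :
    blockDiag M x a = M a (x a) := by
  rw [blockDiag, blockOp_apply, Finset.sum_eq_single a]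
  · rw [if_pos rfl]
  · intro b _ hb
    rw [if_neg hb.symm, zero_apply]
  · exact fun h => absurd (Finset.mem_univ a) h

theorem blockDiag_blockIncl (M : α → K →L[ℂ] K') (a : α) (x : K) :
    blockDiag M (blockIncl K a x) = blockIncl K' a (M a x) := by
  ext b
  rw [blockDiag_apply, blockIncl_apply, blockIncl_apply]
  split_ifs with h
  · rw [h]
  · rw [map_zero]

theorem norm_blockDiag_le {M : α → K →L[ℂ] K'} {c : ℝ} (hc : 0 ≤ c) (h : ∀ a, ‖M a‖ ≤ c) :
    ‖blockDiag M‖ ≤ c := by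
  refine ContinuousLinearMap.opNorm_le_bound _ hc fun x => ?_
  refine le_of_sq_le_sq ?_ (by positivity)
  rw [mul_pow, PiLp.norm_sq_eq_of_L2, PiLp.norm_sq_eq_of_L2, Finset.mul_sum]
  refine Finset.sum_le_sum fun a _ => ?_
  rw [blockDiag_apply, ← mul_pow]
  exact pow_le_pow_left₀ (norm_nonneg _) (((M a).le_opNorm _).trans
    (mul_le_mul_of_nonneg_right (h a) (norm_nonneg _))) 2

/-- A matrix entry of an operator. -/
noncomputable def entry (N : (PiLp 2 fun _ : α => K) →L[ℂ] PiLp 2 fun _ : β => K') (b : β) (a : α) : K →L[ℂ] K' :=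
  PiLp.proj 2 (fun _ => K') b ∘L N ∘L blockIncl K a

theorem entry_apply (N : (PiLp 2 fun _ : α => K) →L[ℂ] PiLp 2 fun _ : β => K') (b : β) (a : α)
    (x : K) : entry N b a x = N (blockIncl K a x) b := rfl

theorem apply_eq_sum_entry (N : (PiLp 2 fun _ : α => K) →L[ℂ] PiLp 2 fun _ : β => K')
    (x : PiLp 2 fun _ : α => K) (b : β) : N x b = ∑ a, entry N b a (x a) := by
  conv_lhs => rw [← sum_blockIncl x, map_sum]
  simp [entry_apply]

theorem entry_blockOp (M : β → α → K →L[ℂ] K') (b : β) (a : α) : entry (blockOp M) b a = M b a := by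
  ext x
  rw [entry_apply, blockOp_blockIncl]

theorem entry_comp (M : (PiLp 2 fun _ : β => K') →L[ℂ] PiLp 2 fun _ : γ => K'')
    (N : (PiLp 2 fun _ : α => K) →L[ℂ] PiLp 2 fun _ : β => K') (c : γ) (a : α) :
    entry (M ∘L N) c a = ∑ b, entry M c b ∘L entry N b a := by
  ext x
  rw [entry_apply, ContinuousLinearMap.comp_apply, apply_eq_sum_entry]
  simp [entry_apply]

theorem entry_adjoint [CompleteSpace K] [CompleteSpace K']
    (N : (PiLp 2 fun _ : α => K) →L[ℂ] PiLp 2 fun _ : β => K') (b : β) (a : α) :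
    entry N.adjoint a b = (entry N b a).adjoint := by
  refine ContinuousLinearMap.ext fun x => ext_inner_left ℂ fun y => ?_
  rw [ContinuousLinearMap.adjoint_inner_right, entry_apply, entry_apply, ← inner_blockIncl_left,
    ContinuousLinearMap.adjoint_inner_right, ← inner_conj_symm, inner_blockIncl_left,
    inner_conj_symm]

theorem adjoint_blockOp [CompleteSpace K] [CompleteSpace K'] (M : β → α → K →L[ℂ] K') :
    (blockOp M).adjoint = blockOp fun a b => (M b a).adjoint := by
  refine block_ext fun b x => ?_
  ext a
  rw [blockOp_blockIncl, ← entry_apply, entry_adjoint, entry_blockOp]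

end Blocks

/-! ### Block matrices over a star-subalgebra -/

section Entries

set_option linter.unusedSectionVars false

variable {K : Type*} [NormedAddCommGroup K] [InnerProductSpace ℂ K] [CompleteSpace K]
  {α β γ : Type*} [Fintype α] [Fintype β] [Fintype γ] [DecidableEq α] [DecidableEq β]
  [DecidableEq γ] (𝒜 : StarSubalgebra ℂ (K →L[ℂ] K))

/-- The matrix entries of the operator are in `𝒜`. -/
def EntriesMem (N : (PiLp 2 fun _ : α => K) →L[ℂ] PiLp 2 fun _ : β => K) : Prop :=
  ∀ b a, entry N b a ∈ 𝒜

variable {𝒜}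

theorem EntriesMem.comp {M : (PiLp 2 fun _ : β => K) →L[ℂ] PiLp 2 fun _ : γ => K}
    {N : (PiLp 2 fun _ : α => K) →L[ℂ] PiLp 2 fun _ : β => K} (hM : EntriesMem 𝒜 M)
    (hN : EntriesMem 𝒜 N) : EntriesMem 𝒜 (M ∘L N) := fun c a => by
  rw [entry_comp]
  exact sum_mem fun b _ => mul_mem (hM c b) (hN b a)

theorem EntriesMem.adjoint {N : (PiLp 2 fun _ : α => K) →L[ℂ] PiLp 2 fun _ : β => K}
    (hN : EntriesMem 𝒜 N) : EntriesMem 𝒜 N.adjoint := fun a b => by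
  rw [entry_adjoint]
  exact star_mem (hN b a)

theorem EntriesMem.add {M N : (PiLp 2 fun _ : α => K) →L[ℂ] PiLp 2 fun _ : β => K}
    (hM : EntriesMem 𝒜 M) (hN : EntriesMem 𝒜 N) : EntriesMem 𝒜 (M + N) := fun b a => by
  have : entry (M + N) b a = entry M b a + entry N b a := by ext x; rfl
  rw [this]
  exact add_mem (hM b a) (hN b a)

theorem EntriesMem.smul {N : (PiLp 2 fun _ : α => K) →L[ℂ] PiLp 2 fun _ : β => K}
    (hN : EntriesMem 𝒜 N) (c : ℂ) : EntriesMem 𝒜 (c • N) := fun b a => by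
  have : entry (c • N) b a = c • entry N b a := by ext x; rfl
  rw [this]
  exact SMulMemClass.smul_mem c (hN b a)

theorem entriesMem_zero : EntriesMem 𝒜
    (0 : (PiLp 2 fun _ : α => K) →L[ℂ] PiLp 2 fun _ : β => K) := fun b a => by
  have : entry (0 : (PiLp 2 fun _ : α => K) →L[ℂ] PiLp 2 fun _ : β => K) b a = 0 := by ext x; rfl
  rw [this]
  exact zero_mem _

theorem entriesMem_blockOp {M : β → α → K →L[ℂ] K} (hM : ∀ b a, M b a ∈ 𝒜) :
    EntriesMem 𝒜 (blockOp M) := fun b a => by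
  rw [entry_blockOp]
  exact hM b a

theorem entriesMem_blockDiag {M : α → K →L[ℂ] K} (hM : ∀ a, M a ∈ 𝒜) :
    EntriesMem 𝒜 (blockDiag M) := entriesMem_blockOp fun b a => by
  split_ifs
  · exact hM a
  · exact zero_mem _

variable (α 𝒜) in
/-- The algebra of operators with matrix entries in `𝒜`. -/
def blockAlgebra : StarSubalgebra ℂ ((PiLp 2 fun _ : α => K) →L[ℂ] PiLp 2 fun _ : α => K) where
  carrier := {N | EntriesMem 𝒜 N}
  mul_mem' hM hN := EntriesMem.comp hM hN
  add_mem' hM hN := EntriesMem.add hM hN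
  algebraMap_mem' c := by
    have : algebraMap ℂ ((PiLp 2 fun _ : α => K) →L[ℂ] PiLp 2 fun _ : α => K) c
        = blockDiag fun _ => algebraMap ℂ (K →L[ℂ] K) c := by
      refine block_ext fun a x => ?_
      rw [blockDiag_blockIncl]
      exact ((blockIncl K a).map_smul c x).symm
    rw [this]
    exact entriesMem_blockDiag fun _ => algebraMap_mem _ c
  star_mem' hN := EntriesMem.adjoint hN

theorem isClosed_blockAlgebra (h : IsClosed (𝒜 : Set (K →L[ℂ] K))) :
    IsClosed (blockAlgebra α 𝒜 : Set ((PiLp 2 fun _ : α => K) →L[ℂ] PiLp 2 fun _ : α => K)) := by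
  have : (blockAlgebra α 𝒜 : Set ((PiLp 2 fun _ : α => K) →L[ℂ] PiLp 2 fun _ : α => K))
      = ⋂ b, ⋂ a, (fun N => entry N b a) ⁻¹' (𝒜 : Set (K →L[ℂ] K)) := by
    ext N
    simp only [Set.mem_iInter]
    rfl
  rw [this]
  refine isClosed_iInter fun b => isClosed_iInter fun a => h.preimage ?_
  unfold entry
  fun_prop

/-- Matrices over a closed star-subalgebra form a closed star-subalgebra, which is stable under
continuous functional calculus. -/
theorem EntriesMem.sqrtSub (h : IsClosed (𝒜 : Set (K →L[ℂ] K)))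
    {N : (PiLp 2 fun _ : α => K) →L[ℂ] PiLp 2 fun _ : α => K} (hN : EntriesMem 𝒜 N) (ξ : ℝ) :
    EntriesMem 𝒜 (sqrtSub ξ N) := by
  have hcl : IsClosed (blockAlgebra α 𝒜 :
    Set ((PiLp 2 fun _ : α => K) →L[ℂ] PiLp 2 fun _ : α => K)) := isClosed_blockAlgebra h
  exact cfc_mem (𝕜' := ℂ) (s := blockAlgebra α 𝒜) _ hN

end Entries

/-! ### Encoding a pair by one bounded operator -/

section PairOperator

variable {K K' : Type*} [NormedAddCommGroup K] [InnerProductSpace ℂ K] [CompleteSpace K]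
  [NormedAddCommGroup K'] [InnerProductSpace ℂ K'] [CompleteSpace K']

namespace SelfAdjointPair

/-- A bounded operator encoding the pair, with norm bounded independently of the pair. -/
noncomputable def op (X : SelfAdjointPair K) : K →L[ℂ] K :=
  cfc Real.arctan X.A + Complex.I • cfc Real.arctan X.B

/-- The C*-algebra generated by the pair. -/
noncomputable def algebra (X : SelfAdjointPair K) : StarSubalgebra ℂ (K →L[ℂ] K) :=
  (StarAlgebra.adjoin ℂ ({X.A, X.B} : Set (K →L[ℂ] K))).topologicalClosure

theorem isClosed_algebra (X : SelfAdjointPair K) : IsClosed (X.algebra : Set (K →L[ℂ] K)) :=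
  StarSubalgebra.isClosed_topologicalClosure _

theorem star_op (X : SelfAdjointPair K) :
    star X.op = cfc Real.arctan X.A - Complex.I • cfc Real.arctan X.B := by
  have h1 : IsSelfAdjoint (cfc Real.arctan X.A) := cfc_predicate _ _
  have h2 : IsSelfAdjoint (cfc Real.arctan X.B) := cfc_predicate _ _
  rw [op, star_add, star_smul, h1.star_eq, h2.star_eq, Complex.star_def, Complex.conj_I, neg_smul,
    sub_eq_add_neg]

theorem norm_op_le (X : SelfAdjointPair K) : ‖X.op‖ ≤ 4 := by
  refine (norm_add_le _ _).trans ?_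
  rw [norm_smul, Complex.norm_I, one_mul]
  linarith [norm_cfc_arctan_le X.A, norm_cfc_arctan_le X.B]

theorem op_mem_algebra (X : SelfAdjointPair K) : X.op ∈ X.algebra := by
  have hcl : IsClosed (X.algebra : Set (K →L[ℂ] K)) := X.isClosed_algebra
  have h : ∀ A ∈ ({X.A, X.B} : Set (K →L[ℂ] K)), cfc Real.arctan A ∈ X.algebra := fun A hA =>
    cfc_mem (𝕜' := ℂ) (s := X.algebra) Real.arctan
      (StarSubalgebra.le_topologicalClosure _ (StarAlgebra.subset_adjoin ℂ _ hA))
  exact add_mem (h _ (by simp)) (SMulMemClass.smul_mem _ (h _ (by simp)))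

variable {X : SelfAdjointPair K} {X' : SelfAdjointPair K'} {C : K →L[ℂ] K'}

theorem comp_op (hA : C ∘L X.A = X'.A ∘L C) (hB : C ∘L X.B = X'.B ∘L C) :
    C ∘L X.op = X'.op ∘L C ∧ C ∘L star X.op = star X'.op ∘L C := by
  have h1 := comp_cfc X.isSelfAdjoint_A X'.isSelfAdjoint_A hA Real.arctan
    Real.continuous_arctan.continuousOn
  have h2 := comp_cfc X.isSelfAdjoint_B X'.isSelfAdjoint_B hB Real.arctan
    Real.continuous_arctan.continuousOn
  rw [star_op, star_op, op, op]
  simp only [ContinuousLinearMap.comp_add, ContinuousLinearMap.add_comp,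
    ContinuousLinearMap.comp_sub, ContinuousLinearMap.sub_comp, ContinuousLinearMap.comp_smul,
    ContinuousLinearMap.smul_comp, h1, h2, and_self]

/-- The sum and the difference of the relations for `op` and for its adjoint separate arctan A from
arctan B. -/
theorem comp_eq_of_comp_op (h : ∀ x, C (X.op x) = X'.op (C x))
    (h' : ∀ x, C (star X.op x) = star X'.op (C x)) :
    C ∘L X.A = X'.A ∘L C ∧ C ∘L X.B = X'.B ∘L C := by
  have h1 : ∀ x, C (cfc Real.arctan X.A x) + Complex.I • C (cfc Real.arctan X.B x)
      = cfc Real.arctan X'.A (C x) + Complex.I • cfc Real.arctan X'.B (C x) := fun x => by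
    have := h x
    rw [op, op] at this
    simpa using this
  have h2 : ∀ x, C (cfc Real.arctan X.A x) - Complex.I • C (cfc Real.arctan X.B x)
      = cfc Real.arctan X'.A (C x) - Complex.I • cfc Real.arctan X'.B (C x) := fun x => by
    have := h' x
    rw [star_op, star_op] at this
    simpa using this
  refine ⟨comp_eq_of_comp_cfc_arctan X.isSelfAdjoint_A X'.isSelfAdjoint_A ?_,
    comp_eq_of_comp_cfc_arctan X.isSelfAdjoint_B X'.isSelfAdjoint_B ?_⟩
  · ext x
    have h3 : (2 : ℂ) • C (cfc Real.arctan X.A x) = (2 : ℂ) • cfc Real.arctan X'.A (C x) := by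
      have := congrArg₂ (· + ·) (h1 x) (h2 x)
      simp only [add_add_sub_cancel] at this
      rwa [two_smul, two_smul]
    exact smul_right_injective K' (two_ne_zero (α := ℂ)) h3
  · ext x
    have h3 : (2 * Complex.I) • C (cfc Real.arctan X.B x)
        = (2 * Complex.I) • cfc Real.arctan X'.B (C x) := by
      have := congrArg₂ (· - ·) (h1 x) (h2 x)
      simp only [add_sub_sub_cancel] at this
      rwa [mul_smul, mul_smul, two_smul, two_smul]
    exact smul_right_injective K' (mul_ne_zero two_ne_zero Complex.I_ne_zero) h3

end SelfAdjointPair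

end PairOperator

/-! ### Scalar diagonal operators -/

section ScalarDiag

variable {K K' : Type*} [NormedAddCommGroup K] [InnerProductSpace ℂ K]
  [NormedAddCommGroup K'] [InnerProductSpace ℂ K']
  {α : Type*} [Fintype α] [DecidableEq α]

/-- The diagonal operator with given scalar entries. -/
noncomputable def scalarDiag (K : Type*) [NormedAddCommGroup K] [InnerProductSpace ℂ K]
    (c : α → ℝ) : (PiLp 2 fun _ : α => K) →L[ℂ] PiLp 2 fun _ : α => K :=
  blockDiag fun a => (c a : ℂ) • ContinuousLinearMap.id ℂ K

theorem scalarDiag_apply (c : α → ℝ) (x : PiLp 2 fun _ : α => K) (a : α) :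
    scalarDiag K c x a = (c a : ℂ) • x a := by
  rw [scalarDiag, blockDiag_apply]
  rfl

theorem scalarDiag_scalarDiag (c d : α → ℝ) (x : PiLp 2 fun _ : α => K) :
    scalarDiag K c (scalarDiag K d x) = scalarDiag K (fun a => c a * d a) x := by
  ext a
  simp only [scalarDiag_apply, smul_smul, Complex.ofReal_mul]

theorem inner_scalarDiag_left (c : α → ℝ) (x y : PiLp 2 fun _ : α => K) :
    ⟪scalarDiag K c x, y⟫_ℂ = ⟪x, scalarDiag K c y⟫_ℂ := by
  simp only [PiLp.inner_apply, scalarDiag_apply, inner_smul_left, inner_smul_right,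
    Complex.conj_ofReal]

theorem norm_scalarDiag_le {c : α → ℝ} {μ : ℝ} (hμ : 0 ≤ μ) (h : ∀ a, |c a| ≤ μ) :
    ‖scalarDiag K c‖ ≤ μ := norm_blockDiag_le hμ fun a => by
  rw [norm_smul, Complex.norm_real, Real.norm_eq_abs]
  exact (mul_le_of_le_one_right (abs_nonneg _) ContinuousLinearMap.norm_id_le).trans (h a)

theorem blockDiag_scalarDiag (C : K →L[ℂ] K') (c : α → ℝ) (x : PiLp 2 fun _ : α => K) :
    blockDiag (fun _ => C) (scalarDiag K c x) = scalarDiag K' c (blockDiag (fun _ => C) x) := by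
  ext a
  simp only [scalarDiag_apply, blockDiag_apply, map_smul]

theorem entriesMem_scalarDiag [CompleteSpace K] {𝒜 : StarSubalgebra ℂ (K →L[ℂ] K)} (c : α → ℝ) :
    EntriesMem 𝒜 (scalarDiag K c) :=
  entriesMem_blockDiag fun _ => SMulMemClass.smul_mem _ (one_mem 𝒜)

end ScalarDiag

/-! ### Three nearly orthogonal subspaces encoding a pair -/

namespace SelfAdjointPair

variable {K K' : Type*} [NormedAddCommGroup K] [InnerProductSpace ℂ K] [CompleteSpace K]
  [NormedAddCommGroup K'] [InnerProductSpace ℂ K'] [CompleteSpace K']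

/-- The off-diagonal part of a Gram operator of three subspaces encoding the pair. -/
noncomputable def off (X : SelfAdjointPair K) :
    (PiLp 2 fun _ : Fin 3 => K) →L[ℂ] PiLp 2 fun _ : Fin 3 => K :=
  -- The units linking index 0 to 1 and 2 will force the three diagonal entries of an intertwiner to
  -- coincide; the remaining entries carry the pair.
  blockOp ![![0, 1, 1], ![1, 0, X.op], ![1, star X.op, 0]]

theorem isSelfAdjoint_off (X : SelfAdjointPair K) : IsSelfAdjoint X.off := by
  change X.off.adjoint = X.off
  rw [off, adjoint_blockOp]
  congr 1
  funext i j
  have h1 : (1 : K →L[ℂ] K).adjoint = 1 := star_one (K →L[ℂ] K)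
  have h0 : (0 : K →L[ℂ] K).adjoint = 0 := star_zero (K →L[ℂ] K)
  fin_cases i <;> fin_cases j
  · exact h0
  · exact h1
  · exact h1
  · exact h1
  · exact h0
  · exact star_star X.op
  · exact h1
  · rfl
  · exact h0

/-- The bound is the sum of the norms of the entries: four units and two operators of norm at most
4. -/
theorem norm_off_le (X : SelfAdjointPair K) : ‖X.off‖ ≤ 12 := by
  refine (norm_blockOp_le _).trans ?_
  have h1 : ‖(1 : K →L[ℂ] K)‖ ≤ 1 := ContinuousLinearMap.norm_id_le
  simp only [Fin.sum_univ_three, Matrix.cons_val_zero, Matrix.cons_val_one, Matrix.cons_val,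
    norm_zero, norm_star]
  linarith [X.norm_op_le]

theorem entriesMem_off (X : SelfAdjointPair K) : EntriesMem X.algebra X.off := by
  refine entriesMem_blockOp fun i j => ?_
  fin_cases i <;> fin_cases j
  · exact zero_mem X.algebra
  · exact one_mem X.algebra
  · exact one_mem X.algebra
  · exact one_mem X.algebra
  · exact zero_mem X.algebra
  · exact X.op_mem_algebra
  · exact one_mem X.algebra
  · exact star_mem X.op_mem_algebra
  · exact zero_mem X.algebra

theorem blockDiag_off {X : SelfAdjointPair K} {X' : SelfAdjointPair K'} {C : K →L[ℂ] K'}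
    (hA : C ∘L X.A = X'.A ∘L C) (hB : C ∘L X.B = X'.B ∘L C) :
    blockDiag (fun _ => C) ∘L X.off = X'.off ∘L blockDiag fun _ => C := by
  obtain ⟨h1, h2⟩ := comp_op hA hB
  have h1' : ∀ x, C (X.op x) = X'.op (C x) := fun x => congrArg (fun T => T x) h1
  have h2' : ∀ x, C (star X.op x) = star X'.op (C x) := fun x => congrArg (fun T => T x) h2
  refine block_ext fun j x => ?_
  ext i
  rw [ContinuousLinearMap.comp_apply, ContinuousLinearMap.comp_apply, blockDiag_apply,
    blockDiag_blockIncl, off, off, blockOp_blockIncl, blockOp_blockIncl]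
  fin_cases i <;> fin_cases j
  · exact map_zero C
  · rfl
  · rfl
  · rfl
  · exact map_zero C
  · exact h1' x
  · rfl
  · exact h2' x
  · exact map_zero C

end SelfAdjointPair

namespace SelfAdjointPair

variable {K K' : Type*} [NormedAddCommGroup K] [InnerProductSpace ℂ K] [CompleteSpace K]
  [NormedAddCommGroup K'] [InnerProductSpace ℂ K'] [CompleteSpace K']

theorem isSelfAdjoint_smul_off (X : SelfAdjointPair K) (s : ℝ) :
    IsSelfAdjoint ((-(s : ℂ)) • X.off) := by
  refine IsSelfAdjoint.smul ?_ X.isSelfAdjoint_off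
  rw [IsSelfAdjoint, star_neg, Complex.star_def, Complex.conj_ofReal]

theorem norm_smul_off_le (X : SelfAdjointPair K) {s : ℝ} (hs : 0 ≤ s) :
    ‖(-(s : ℂ)) • X.off‖ ≤ 12 * s := by
  rw [norm_smul, norm_neg, Complex.norm_real, Real.norm_of_nonneg hs, mul_comm]
  exact mul_le_mul_of_nonneg_right X.norm_off_le hs

/-- An operator whose columns are isometries with off-diagonal Gram operator `s • off`. -/
noncomputable def frame (X : SelfAdjointPair K) (s : ℝ) :
    (PiLp 2 fun _ : Fin 3 => K) →L[ℂ] PiLp 2 fun _ : Fin 3 => K :=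
  sqrtSub 1 ((-(s : ℂ)) • X.off)

variable {X : SelfAdjointPair K} {X' : SelfAdjointPair K'} {s : ℝ}

theorem inner_frame_left (x y : PiLp 2 fun _ : Fin 3 => K) :
    ⟪X.frame s x, y⟫_ℂ = ⟪x, X.frame s y⟫_ℂ := by
  have h : IsSelfAdjoint (X.frame s) := isSelfAdjoint_sqrtSub _ _
  rw [← ContinuousLinearMap.adjoint_inner_right, h.adjoint_eq]

theorem frame_frame_apply (hs : 0 ≤ s) (hs1 : 12 * s < 1) (x : PiLp 2 fun _ : Fin 3 => K) :
    X.frame s (X.frame s x) = x + (s : ℂ) • X.off x := by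
  rw [frame, sqrtSub_sqrtSub_apply (X.isSelfAdjoint_smul_off s)
    ((X.norm_smul_off_le hs).trans hs1.le)]
  change ((1 : ℝ) : ℂ) • x - (-(s : ℂ)) • X.off x = _
  rw [Complex.ofReal_one, one_smul, neg_smul, sub_neg_eq_add]

theorem isUnit_frame (hs : 0 ≤ s) (hs1 : 12 * s < 1) : IsUnit (X.frame s) :=
  isUnit_sqrtSub (X.isSelfAdjoint_smul_off s) ((X.norm_smul_off_le hs).trans_lt hs1)

theorem norm_frame_le (hs : 0 ≤ s) : ‖X.frame s‖ ≤ Real.sqrt (1 + 12 * s) :=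
  (norm_sqrtSub_le _ _).trans (Real.sqrt_le_sqrt (by linarith [X.norm_smul_off_le hs]))

theorem entriesMem_frame (X : SelfAdjointPair K) (s : ℝ) : EntriesMem X.algebra (X.frame s) :=
  (X.entriesMem_off.smul _).sqrtSub X.isClosed_algebra 1

theorem blockDiag_frame {C : K →L[ℂ] K'} (hA : C ∘L X.A = X'.A ∘L C) (hB : C ∘L X.B = X'.B ∘L C)
    (s : ℝ) : blockDiag (fun _ => C) ∘L X.frame s = X'.frame s ∘L blockDiag fun _ => C :=
  comp_sqrtSub (X.isSelfAdjoint_smul_off s) (X'.isSelfAdjoint_smul_off s) (by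
    rw [ContinuousLinearMap.comp_smul, ContinuousLinearMap.smul_comp, blockDiag_off hA hB]) 1

theorem off_blockIncl_apply_self (X : SelfAdjointPair K) (j : Fin 3) (x : K) :
    X.off (blockIncl K j x) j = 0 := by
  rw [off, blockOp_blockIncl]
  fin_cases j <;> rfl

/-- The square of the frame is 1 + s·`off`, and `off` has zero diagonal. So the columns of the frame
are isometries, and their ranges are the three subspaces. -/
theorem frame_frame_blockIncl_apply_self (hs : 0 ≤ s) (hs1 : 12 * s < 1) (j : Fin 3) (x : K) :
    X.frame s (X.frame s (blockIncl K j x)) j = x := by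
  rw [frame_frame_apply hs hs1]
  change blockIncl K j x j + (s : ℂ) • X.off (blockIncl K j x) j = x
  rw [off_blockIncl_apply_self, smul_zero, add_zero, blockIncl_apply, if_pos rfl]

theorem frame_frame_blockIncl_apply_of_ne (hs : 0 ≤ s) (hs1 : 12 * s < 1) {i j : Fin 3}
    (hij : i ≠ j) (x : K) :
    X.frame s (X.frame s (blockIncl K j x)) i = (s : ℂ) • X.off (blockIncl K j x) i := by
  rw [frame_frame_apply hs hs1]
  change blockIncl K j x i + (s : ℂ) • X.off (blockIncl K j x) i = _
  rw [blockIncl_apply, if_neg hij, zero_add]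

theorem frame_injective (hs : 0 ≤ s) (hs1 : 12 * s < 1) : Function.Injective (X.frame s) := by
  obtain ⟨w, hw⟩ := isUnit_frame (X := X) hs hs1
  intro x y hxy
  have h : ∀ z, (↑w⁻¹ : (PiLp 2 fun _ : Fin 3 => K) →L[ℂ] _) (X.frame s z) = z := fun z => by
    rw [← hw]
    exact congrArg (fun T : (PiLp 2 fun _ : Fin 3 => K) →L[ℂ] _ => T z) w.inv_mul
  rw [← h x, hxy, h]

theorem frame_surjective (hs : 0 ≤ s) (hs1 : 12 * s < 1) : Function.Surjective (X.frame s) := by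
  obtain ⟨w, hw⟩ := isUnit_frame (X := X) hs hs1
  intro y
  refine ⟨(↑w⁻¹ : (PiLp 2 fun _ : Fin 3 => K) →L[ℂ] _) y, ?_⟩
  rw [← hw]
  exact congrArg (fun T : (PiLp 2 fun _ : Fin 3 => K) →L[ℂ] _ => T y) w.mul_inv

/-- Operators intertwining the projections onto the ranges of the columns of the frames are
diagonal. -/
theorem exists_eq_blockDiag (hs : 0 < s) (hs1 : 12 * s < 1)
    {D : (PiLp 2 fun _ : Fin 3 => K) →L[ℂ] PiLp 2 fun _ : Fin 3 => K'}
    (hD : ∀ j z, D (X.frame s (blockIncl K j (X.frame s z j)))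
      = X'.frame s (blockIncl K' j (X'.frame s (D z) j))) :
    ∃ C : K →L[ℂ] K', C ∘L X.A = X'.A ∘L C ∧ C ∘L X.B = X'.B ∘L C ∧ D = blockDiag fun _ => C := by
  have hs0 : (s : ℂ) ≠ 0 := Complex.ofReal_ne_zero.2 hs.ne'
  -- c j is D read in the j-th column; `hc` says that D maps the range of the j-th column of one
  -- frame into that of the other.
  let c : Fin 3 → K →L[ℂ] K' := fun j =>
    PiLp.proj 2 (fun _ => K') j ∘L X'.frame s ∘L D ∘L X.frame s ∘L blockIncl K j
  have hc : ∀ j x, D (X.frame s (blockIncl K j x)) = X'.frame s (blockIncl K' j (c j x)) :=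
    fun j x => by
      have h := hD j (X.frame s (blockIncl K j x))
      rw [frame_frame_blockIncl_apply_self hs.le hs1] at h
      exact h
  have hinj : ∀ j, Function.Injective (blockIncl K' j : K' → PiLp 2 fun _ : Fin 3 => K') :=
    fun j x y h => by
      have := congrArg (fun z : PiLp 2 fun _ : Fin 3 => K' => z j) h
      simpa [blockIncl_apply] using this
  -- Applying the i-th projection to the j-th column produces s times the (i, j) entry of `off`; the
  -- factor cancels because s ≠ 0.
  have hoff : ∀ {i j} x, i ≠ j →
      c i (X.off (blockIncl K j x) i) = X'.off (blockIncl K' j (c j x)) i := fun {i j} x hij => by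
    have h := hD i (X.frame s (blockIncl K j x))
    rw [hc, hc, frame_frame_blockIncl_apply_of_ne hs.le hs1 hij,
      frame_frame_blockIncl_apply_of_ne hs.le hs1 hij, map_smul] at h
    exact smul_right_injective K' hs0 (hinj i (frame_injective hs.le hs1 h))
  have h01 : c 0 = c 1 := by
    ext x
    have := hoff (i := 0) (j := 1) x (by decide)
    rw [off, off, blockOp_blockIncl, blockOp_blockIncl] at this
    exact this
  have h02 : c 0 = c 2 := by
    ext x
    have := hoff (i := 0) (j := 2) x (by decide)
    rw [off, off, blockOp_blockIncl, blockOp_blockIncl] at this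
    exact this
  have h12 : ∀ x, c 0 (X.op x) = X'.op (c 0 x) := fun x => by
    have := hoff (i := 1) (j := 2) x (by decide)
    rw [off, off, blockOp_blockIncl, blockOp_blockIncl, ← h01, ← h02] at this
    exact this
  have h21 : ∀ x, c 0 (star X.op x) = star X'.op (c 0 x) := fun x => by
    have := hoff (i := 2) (j := 1) x (by decide)
    rw [off, off, blockOp_blockIncl, blockOp_blockIncl, ← h01, ← h02] at this
    exact this
  have hcj : ∀ j, c j = c 0 := fun j => by
    fin_cases j
    · rfl
    · exact h01.symm
    · exact h02.symm
  obtain ⟨hA, hB⟩ := comp_eq_of_comp_op h12 h21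
  refine ⟨c 0, hA, hB, ?_⟩
  -- So far D is diagonal with respect to the columns of the frames. As c 0 intertwines the pairs,
  -- its diagonal operator intertwines the frames, and the invertible frame can be cancelled.
  have key : D ∘L X.frame s = blockDiag (fun _ => c 0) ∘L X.frame s := by
    rw [blockDiag_frame hA hB]
    refine block_ext fun j x => ?_
    rw [ContinuousLinearMap.comp_apply, ContinuousLinearMap.comp_apply, hc, blockDiag_blockIncl, hcj]
  ext1 z
  obtain ⟨y, rfl⟩ := frame_surjective (X := X) hs.le hs1 z
  exact congrArg (fun T => T y) key

end SelfAdjointPair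

/-! ### The projections Q_k attached to a pair -/

section WildFamily

set_option linter.unusedSectionVars false

open SelfAdjointPair

variable {m r : ℕ} {θ : Ray m r → ℝ} {K K' : Type*} [NormedAddCommGroup K]
  [InnerProductSpace ℂ K] [CompleteSpace K] [NormedAddCommGroup K'] [InnerProductSpace ℂ K']
  [CompleteSpace K'] {q : Fin 3 → Fin m}

/-- The indicator of the indices over `k`. -/
noncomputable def fiberInd (q : Fin 3 → Fin m) (k : Fin m) (j : Fin 3) : ℝ := if q j = k then 1 else 0

namespace SelfAdjointPair

/-- The projections `1 - Q_k`. -/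
noncomputable def rangeProj (X : SelfAdjointPair K) (s : ℝ) (q : Fin 3 → Fin m) (k : Fin m) :
    (PiLp 2 fun _ : Fin 3 => K) →L[ℂ] PiLp 2 fun _ : Fin 3 => K :=
  X.frame s ∘L scalarDiag K (fiberInd q k) ∘L X.frame s

/-- The projections `Q_k`. -/
noncomputable def starQ (X : SelfAdjointPair K) (s : ℝ) (q : Fin 3 → Fin m) (k : Fin m) :
    (PiLp 2 fun _ : Fin 3 => K) →L[ℂ] PiLp 2 fun _ : Fin 3 => K :=
  ContinuousLinearMap.id ℂ _ - X.rangeProj s q k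

variable {X : SelfAdjointPair K} {X' : SelfAdjointPair K'} {s : ℝ}

theorem rangeProj_apply (k : Fin m) (x : PiLp 2 fun _ : Fin 3 => K) :
    X.rangeProj s q k x = X.frame s (scalarDiag K (fiberInd q k) (X.frame s x)) := rfl

theorem scalarDiag_fiberInd_self (hq : Function.Injective q) (j : Fin 3)
    (x : PiLp 2 fun _ : Fin 3 => K) : scalarDiag K (fiberInd q (q j)) x = blockIncl K j (x j) := by
  ext i
  rw [scalarDiag_apply, blockIncl_apply, fiberInd]
  by_cases h : i = j
  · subst h; simp
  · simp [h, hq.ne h]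

theorem scalarDiag_fiberInd_eq_zero {k : Fin m} (h : ∀ j, q j ≠ k)
    (x : PiLp 2 fun _ : Fin 3 => K) : scalarDiag K (fiberInd q k) x = 0 := by
  ext i
  rw [scalarDiag_apply, fiberInd, if_neg (h i)]
  simp

/-- For k = q j this is the projection onto the range of the j-th column of the frame, by the
isometry property of that column; for all other k it is zero. -/
theorem isStarProjection_rangeProj (hs : 0 ≤ s) (hs1 : 12 * s < 1) (hq : Function.Injective q)
    (k : Fin m) : IsStarProjection (X.rangeProj s q k) := by
  refine ⟨?_, ?_⟩
  · ext1 x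
    change X.rangeProj s q k (X.rangeProj s q k x) = X.rangeProj s q k x
    by_cases h : ∃ j, q j = k
    · obtain ⟨j, rfl⟩ := h
      simp only [rangeProj_apply, scalarDiag_fiberInd_self hq,
        frame_frame_blockIncl_apply_self hs hs1]
    · push Not at h
      simp only [rangeProj_apply, scalarDiag_fiberInd_eq_zero h, map_zero]
  · rw [ContinuousLinearMap.isSelfAdjoint_iff_isSymmetric]
    intro x y
    change ⟪X.rangeProj s q k x, y⟫_ℂ = ⟪x, X.rangeProj s q k y⟫_ℂ
    rw [rangeProj_apply, rangeProj_apply, inner_frame_left, inner_scalarDiag_left, inner_frame_left]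

theorem isStarProjection_starQ (hs : 0 ≤ s) (hs1 : 12 * s < 1) (hq : Function.Injective q)
    (k : Fin m) : IsStarProjection (X.starQ s q k) :=
  (isStarProjection_rangeProj hs hs1 hq k).one_sub

/-- The weighted sum of the projections `1 - Q_k`. -/
noncomputable def weightedSum (θ : Ray m r → ℝ) (X : SelfAdjointPair K) (s : ℝ) (q : Fin 3 → Fin m) :
    (PiLp 2 fun _ : Fin 3 => K) →L[ℂ] PiLp 2 fun _ : Fin 3 => K :=
  X.frame s ∘L scalarDiag K (fun j => tauSq θ (q j)) ∘L X.frame s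

theorem weightedSum_apply (x : PiLp 2 fun _ : Fin 3 => K) : X.weightedSum θ s q x
    = X.frame s (scalarDiag K (fun j => tauSq θ (q j)) (X.frame s x)) := rfl

theorem isSelfAdjoint_weightedSum : IsSelfAdjoint (X.weightedSum θ s q) := by
  rw [ContinuousLinearMap.isSelfAdjoint_iff_isSymmetric]
  intro x y
  change ⟪X.weightedSum θ s q x, y⟫_ℂ = ⟪x, X.weightedSum θ s q y⟫_ℂ
  rw [weightedSum_apply, weightedSum_apply, inner_frame_left, inner_scalarDiag_left, inner_frame_left]

/-- The squared norm of the frame is at most 1 + 12s, so for small s the weighted sum is hardly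
larger than the largest weight, which is less than ξ on M_l. -/
theorem norm_weightedSum_le (hs : 0 ≤ s) {μ : ℝ} (hμ : ∀ j, tauSq θ (q j) ≤ μ) :
    ‖X.weightedSum θ s q‖ ≤ μ * (1 + 12 * s) := by
  have hμ0 : 0 ≤ μ := (ProjDatum.tauSq_nonneg θ (q 0)).trans (hμ 0)
  have h1 : ‖scalarDiag K (fun j => tauSq θ (q j))‖ ≤ μ := norm_scalarDiag_le hμ0 fun j => by
    rw [abs_of_nonneg (ProjDatum.tauSq_nonneg θ (q j))]
    exact hμ j
  have h2 := norm_frame_le (X := X) hs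
  have h3 := Real.sqrt_nonneg (1 + 12 * s)
  calc ‖X.weightedSum θ s q‖
      ≤ ‖X.frame s‖ * (‖scalarDiag K (fun j => tauSq θ (q j))‖ * ‖X.frame s‖) :=
        (ContinuousLinearMap.opNorm_comp_le _ _).trans
          (mul_le_mul_of_nonneg_left (ContinuousLinearMap.opNorm_comp_le _ _) (norm_nonneg _))
    _ ≤ Real.sqrt (1 + 12 * s) * (μ * Real.sqrt (1 + 12 * s)) := by gcongr
    _ = μ * (1 + 12 * s) := by
      rw [mul_left_comm, Real.mul_self_sqrt (by linarith)]

/-- Each index j lies over the single vertex q j, so summing the weighted fiber indicators gives the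
diagonal operator of the weights. -/
theorem defect_starQ (x : PiLp 2 fun _ : Fin 3 => K) :
    defect (X.starQ s q) θ x = (xi θ : ℂ) • x - X.weightedSum θ s q x := by
  have h : ∀ k, x - X.starQ s q k x
      = X.frame s (scalarDiag K (fiberInd q k) (X.frame s x)) := fun k => sub_sub_cancel _ _
  have h' : ∑ k, (tauSq θ k : ℂ) • (x - X.starQ s q k x)
      = X.frame s (∑ k, (tauSq θ k : ℂ) • scalarDiag K (fiberInd q k) (X.frame s x)) := by
    simp only [h, map_sum, map_smul]
  rw [defect_apply, h', weightedSum_apply]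
  congr 2
  ext j
  rw [WithLp.ofLp_sum, Finset.sum_apply, scalarDiag_apply, Finset.sum_eq_single (q j)]
  · change (tauSq θ (q j) : ℂ) • scalarDiag K (fiberInd q (q j)) (X.frame s x) j = _
    rw [scalarDiag_apply, fiberInd, if_pos rfl, Complex.ofReal_one, one_smul]
  · intro k _ hk
    change (tauSq θ k : ℂ) • scalarDiag K (fiberInd q k) (X.frame s x) j = 0
    rw [scalarDiag_apply, fiberInd, if_neg hk.symm, Complex.ofReal_zero, zero_smul, smul_zero]
  · exact fun h => absurd (Finset.mem_univ _) h

/-- The square root of the defect operator. -/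
noncomputable def defectRoot (θ : Ray m r → ℝ) (X : SelfAdjointPair K) (s : ℝ) (q : Fin 3 → Fin m) :
    (PiLp 2 fun _ : Fin 3 => K) →L[ℂ] PiLp 2 fun _ : Fin 3 => K :=
  sqrtSub (xi θ) (X.weightedSum θ s q)

theorem inner_defectRoot_defectRoot (h : ‖X.weightedSum θ s q‖ < xi θ)
    (x y : PiLp 2 fun _ : Fin 3 => K) :
    ⟪X.defectRoot θ s q x, X.defectRoot θ s q y⟫_ℂ = ⟪x, defect (X.starQ s q) θ y⟫_ℂ := by
  have h1 : IsSelfAdjoint (X.defectRoot θ s q) := isSelfAdjoint_sqrtSub _ _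
  rw [← ContinuousLinearMap.adjoint_inner_right, h1.adjoint_eq, defectRoot,
    sqrtSub_sqrtSub_apply isSelfAdjoint_weightedSum h.le, defect_starQ]

theorem defectRoot_surjective (h : ‖X.weightedSum θ s q‖ < xi θ) :
    Function.Surjective (X.defectRoot θ s q) := by
  obtain ⟨w, hw⟩ := isUnit_sqrtSub isSelfAdjoint_weightedSum h
  intro y
  refine ⟨(↑w⁻¹ : (PiLp 2 fun _ : Fin 3 => K) →L[ℂ] _) y, ?_⟩
  rw [defectRoot, ← hw]
  exact congrArg (fun T : (PiLp 2 fun _ : Fin 3 => K) →L[ℂ] _ => T y) w.mul_inv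

theorem entriesMem_rangeProj (k : Fin m) : EntriesMem X.algebra (X.rangeProj s q k) :=
  (X.entriesMem_frame s).comp ((entriesMem_scalarDiag _).comp (X.entriesMem_frame s))

theorem entriesMem_defectRoot : EntriesMem X.algebra (X.defectRoot θ s q) :=
  EntriesMem.sqrtSub X.isClosed_algebra
    ((X.entriesMem_frame s).comp ((entriesMem_scalarDiag _).comp (X.entriesMem_frame s))) _

theorem blockDiag_frame_apply {C : K →L[ℂ] K'} (hA : C ∘L X.A = X'.A ∘L C)
    (hB : C ∘L X.B = X'.B ∘L C) (x : PiLp 2 fun _ : Fin 3 => K) :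
    blockDiag (fun _ => C) (X.frame s x) = X'.frame s (blockDiag (fun _ => C) x) :=
  congrArg (fun T => T x) (blockDiag_frame hA hB s)

theorem blockDiag_starQ {C : K →L[ℂ] K'} (hA : C ∘L X.A = X'.A ∘L C) (hB : C ∘L X.B = X'.B ∘L C)
    (k : Fin m) (x : PiLp 2 fun _ : Fin 3 => K) :
    blockDiag (fun _ => C) (X.starQ s q k x) = X'.starQ s q k (blockDiag (fun _ => C) x) := by
  change blockDiag (fun _ => C) (x - X.rangeProj s q k x)
    = blockDiag (fun _ => C) x - X'.rangeProj s q k (blockDiag (fun _ => C) x)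
  simp only [map_sub, rangeProj_apply, blockDiag_frame_apply hA hB, blockDiag_scalarDiag]

theorem blockDiag_defectRoot {C : K →L[ℂ] K'} (hA : C ∘L X.A = X'.A ∘L C)
    (hB : C ∘L X.B = X'.B ∘L C) (x : PiLp 2 fun _ : Fin 3 => K) :
    blockDiag (fun _ => C) (X.defectRoot θ s q x)
      = X'.defectRoot θ s q (blockDiag (fun _ => C) x) := by
  have h : blockDiag (fun _ => C) ∘L X.weightedSum θ s q
      = X'.weightedSum θ s q ∘L blockDiag fun _ => C := by
    ext1 y
    rw [ContinuousLinearMap.comp_apply, ContinuousLinearMap.comp_apply, weightedSum_apply,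
      weightedSum_apply, blockDiag_frame_apply hA hB, blockDiag_scalarDiag, blockDiag_frame_apply hA hB]
  exact congrArg (fun T => T x)
    (comp_sqrtSub isSelfAdjoint_weightedSum isSelfAdjoint_weightedSum h (xi θ))

end SelfAdjointPair

end WildFamily

/-! ### Grouping coordinates in triples -/

section Slots

set_option linter.unusedSectionVars false

variable {K K' : Type*} [NormedAddCommGroup K] [InnerProductSpace ℂ K]
  [NormedAddCommGroup K'] [InnerProductSpace ℂ K'] {σ ν : Type*}
  [Fintype σ] [DecidableEq σ] [Fintype ν] [DecidableEq ν] {e : ν ≃ σ × Fin 3}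

/-- The embedding of a summand `K³`, for coordinates grouped in triples. -/
noncomputable def slotIncl (K : Type*) [NormedAddCommGroup K] [InnerProductSpace ℂ K]
    (e : ν ≃ σ × Fin 3) (κ : σ) : (PiLp 2 fun _ : Fin 3 => K) →L[ℂ] PiLp 2 fun _ : ν => K :=
  blockOp fun a c => if e a = (κ, c) then 1 else 0

theorem slotIncl_apply (κ : σ) (x : PiLp 2 fun _ : Fin 3 => K) (a : ν) :
    slotIncl K e κ x a = if (e a).1 = κ then x (e a).2 else 0 := by
  rw [slotIncl, blockOp_apply, Finset.sum_eq_single (e a).2]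
  · split_ifs with h1 h2 h2
    · rfl
    · exact absurd (congrArg Prod.fst h1) h2
    · exact absurd (show e a = (κ, (e a).2) from Prod.ext h2 rfl) h1
    · rfl
  · intro c _ hc
    rw [if_neg fun h => hc (congrArg Prod.snd h).symm, zero_apply]
  · exact fun h => absurd (Finset.mem_univ _) h

theorem inner_slotIncl (κ κ' : σ) (x y : PiLp 2 fun _ : Fin 3 => K) :
    ⟪slotIncl K e κ x, slotIncl K e κ' y⟫_ℂ = if κ = κ' then ⟪x, y⟫_ℂ else 0 := by
  simp only [PiLp.inner_apply, slotIncl_apply]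
  rw [e.sum_comp (fun p : σ × Fin 3 => ⟪if p.1 = κ then x p.2 else 0,
    if p.1 = κ' then y p.2 else 0⟫_ℂ), Fintype.sum_prod_type, Finset.sum_eq_single κ]
  · split_ifs with h
    · subst h; simp
    · simp
  · intro l _ hl
    simp [hl]
  · exact fun h => absurd (Finset.mem_univ _) h

theorem sum_slotIncl (z : PiLp 2 fun _ : ν => K) :
    ∑ κ, slotIncl K e κ (WithLp.toLp 2 fun c => z (e.symm (κ, c))) = z := by
  ext a
  rw [WithLp.ofLp_sum, Finset.sum_apply, Finset.sum_eq_single (e a).1]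
  · rw [slotIncl_apply, if_pos rfl]
    change z (e.symm (e a)) = z a
    rw [e.symm_apply_apply]
  · intro κ _ hκ
    rw [slotIncl_apply, if_neg hκ.symm]
  · exact fun h => absurd (Finset.mem_univ _) h

theorem blockDiag_slotIncl (C : K →L[ℂ] K') (κ : σ) (x : PiLp 2 fun _ : Fin 3 => K) :
    blockDiag (fun _ => C) (slotIncl K e κ x) = slotIncl K' e κ (blockDiag (fun _ => C) x) := by
  ext a
  simp only [blockDiag_apply, slotIncl_apply]
  split_ifs
  · rfl
  · exact map_zero C

theorem entriesMem_slotIncl [CompleteSpace K] {𝒜 : StarSubalgebra ℂ (K →L[ℂ] K)} (κ : σ) :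
    EntriesMem 𝒜 (slotIncl K e κ) := entriesMem_blockOp fun a c => by
  split_ifs
  · exact one_mem 𝒜
  · exact zero_mem 𝒜

end Slots

namespace SubspaceSystem

variable {m r : ℕ} {θ : Ray m r → ℝ}

theorem map_gramMap {H H' H₀ H₀' : Type*} [NormedAddCommGroup H] [InnerProductSpace ℂ H]
    [NormedAddCommGroup H'] [InnerProductSpace ℂ H'] [NormedAddCommGroup H₀]
    [InnerProductSpace ℂ H₀] [NormedAddCommGroup H₀'] [InnerProductSpace ℂ H₀']
    {Q : Fin m → H₀ →L[ℂ] H₀} {Q' : Fin m → H₀' →L[ℂ] H₀'} {F : StarVertex m r → H₀ →ₗ[ℂ] H}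
    {F' : StarVertex m r → H₀' →ₗ[ℂ] H'} {D : H →L[ℂ] H'} {C : H₀ →L[ℂ] H₀'}
    (hF : ∀ i x, D (F i x) = F' i (C x)) (hQ : ∀ k x, C (Q k x) = Q' k (C x))
    (i : StarVertex m r) (x : H₀) : D (gramMap θ Q F i x) = gramMap θ Q' F' i (C x) := by
  rcases i with _ | i | i | i <;> simp [gramMap, hF, hQ]

/-- Intertwiners of the maps `V i` intertwine the projections. -/
theorem IsGramFamily.comp_proj_eq {ι : Type} {H H' H₀ H₀' : Type*}
    [NormedAddCommGroup H] [InnerProductSpace ℂ H] [CompleteSpace H]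
    [NormedAddCommGroup H'] [InnerProductSpace ℂ H'] [CompleteSpace H']
    [NormedAddCommGroup H₀] [InnerProductSpace ℂ H₀]
    [NormedAddCommGroup H₀'] [InnerProductSpace ℂ H₀']
    {S : SubspaceSystem ι H} {B : ι → ι → H₀ →L[ℂ] H₀} {V : ι → H₀ →ₗᵢ[ℂ] H}
    (hV : S.IsGramFamily B V) (hd : (⨆ i, S.space i).topologicalClosure = ⊤)
    {S' : SubspaceSystem ι H'} {B' : ι → ι → H₀' →L[ℂ] H₀'} {V' : ι → H₀' →ₗᵢ[ℂ] H'}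
    (hV' : S'.IsGramFamily B' V') {D : H →L[ℂ] H'} {C : H₀ →L[ℂ] H₀'}
    (hD : ∀ i x, D (V i x) = V' i (C x)) (hC : ∀ i j x, C (B i j x) = B' i j (C x)) (i : ι) :
    D ∘L S.proj i = S'.proj i ∘L D := by
  refine hV.ext_of_dense hd fun j x => ?_
  rw [ContinuousLinearMap.comp_apply, ContinuousLinearMap.comp_apply, hV.proj_apply, hD, hD,
    hV'.proj_apply, hC]

end SubspaceSystem

/-! ### The system attached to a pair -/

namespace SelfAdjointPair

variable {m r : ℕ} {θ : Ray m r → ℝ} {K K' : Type*} [NormedAddCommGroup K]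
  [InnerProductSpace ℂ K] [CompleteSpace K] [NormedAddCommGroup K'] [InnerProductSpace ℂ K']
  [CompleteSpace K'] {q : Fin 3 → Fin m} {ν : Type*} [Fintype ν] [DecidableEq ν]
  {e : ν ≃ Option (Option (Fin m ⊕ Fin r)) × Fin 3}

/-- Maps with orthogonal ranges from which the system of the pair is built. -/
noncomputable def rangeMap (θ : Ray m r → ℝ) (X : SelfAdjointPair K) (s : ℝ) (q : Fin 3 → Fin m)
    (e : ν ≃ Option (Option (Fin m ⊕ Fin r)) × Fin 3) :
    StarVertex m r → (PiLp 2 fun _ : Fin 3 => K) →L[ℂ] PiLp 2 fun _ : ν => K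
  | none => slotIncl K e none ∘L X.defectRoot θ s q
  | some (.fst k) => slotIncl K e (some (some (.inl k)))
  -- All second vertices share one slot K³: the indicator of the fiber over k keeps their ranges
  -- orthogonal, and together they fill the slot. The centre, the first vertices and the leaves have
  -- slots of their own.
  | some (.snd k) => slotIncl K e (some none) ∘L scalarDiag K (fiberInd q k) ∘L X.frame s
  | some (.leaf j) => slotIncl K e (some (some (.inr j)))

variable {X : SelfAdjointPair K} {X' : SelfAdjointPair K'} {s : ℝ}

/-- Fibers over different k are disjoint, and fiber indicators are idempotent. -/
theorem inner_snd (k l : Fin m) (x y : PiLp 2 fun _ : Fin 3 => K) :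
    ⟪scalarDiag K (fiberInd q k) (X.frame s x), scalarDiag K (fiberInd q l) (X.frame s y)⟫_ℂ
      = if k = l then ⟪x, X.rangeProj s q k y⟫_ℂ else 0 := by
  rw [inner_scalarDiag_left, scalarDiag_scalarDiag, inner_frame_left]
  split_ifs with h
  · subst h
    rw [rangeProj_apply]
    have : (fun a => fiberInd q k a * fiberInd q k a) = fiberInd q k := by
      funext a
      unfold fiberInd
      split_ifs <;> simp
    rw [this]
  · have h0 : (fun a => fiberInd q k a * fiberInd q l a) = fun _ => 0 := by
      funext a
      unfold fiberInd
      split_ifs with h1 h2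
      · exact absurd (h1.symm.trans h2) h
      all_goals simp
    have h1 : scalarDiag K (fun _ : Fin 3 => (0 : ℝ)) (X.frame s y) = 0 := by
      ext a
      rw [scalarDiag_apply]
      simp
    rw [h0, h1, map_zero, inner_zero_right]

open Classical in
theorem inner_rangeMap (h : ‖X.weightedSum θ s q‖ < xi θ) (i j : StarVertex m r)
    (x y : PiLp 2 fun _ : Fin 3 => K) :
    ⟪X.rangeMap θ s q e i x, X.rangeMap θ s q e j y⟫_ℂ
      = if i = j then ⟪x, vertexDefect (X.starQ s q) θ i y⟫_ℂ else 0 := by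
  have hR : ∀ k, y - X.starQ s q k y = X.rangeProj s q k y := fun k => sub_sub_cancel _ _
  rcases i with _ | i | i | i <;> rcases j with _ | j | j | j <;>
    simp only [rangeMap, ContinuousLinearMap.comp_apply, inner_slotIncl, reduceCtorEq, if_false,
      if_true, Option.some.injEq, Ray.fst.injEq, Ray.snd.injEq, Ray.leaf.injEq, Sum.inl.injEq,
      Sum.inr.injEq, vertexDefect, rayDefect, inner_defectRoot_defectRoot h, inner_snd,
      ContinuousLinearMap.id_apply, sub_apply, hR]

theorem blockDiag_rangeMap {C : K →L[ℂ] K'} (hA : C ∘L X.A = X'.A ∘L C)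
    (hB : C ∘L X.B = X'.B ∘L C) (i : StarVertex m r) (x : PiLp 2 fun _ : Fin 3 => K) :
    blockDiag (fun _ => C) (X.rangeMap θ s q e i x)
      = X'.rangeMap θ s q e i (blockDiag (fun _ => C) x) := by
  rcases i with _ | i | i | i <;>
    simp only [rangeMap, ContinuousLinearMap.comp_apply, blockDiag_slotIncl,
      blockDiag_defectRoot hA hB, blockDiag_scalarDiag, blockDiag_frame_apply hA hB]

theorem entriesMem_rangeMap (i : StarVertex m r) :
    EntriesMem X.algebra (X.rangeMap θ s q e i) := by
  rcases i with _ | i | i | i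
  · exact (entriesMem_slotIncl _).comp entriesMem_defectRoot
  · exact entriesMem_slotIncl _
  · exact (entriesMem_slotIncl _).comp ((entriesMem_scalarDiag _).comp (X.entriesMem_frame s))
  · exact entriesMem_slotIncl _

theorem entriesMem_starQ (k : Fin m) : EntriesMem X.algebra (X.starQ s q k) := by
  have h : X.starQ s q k = 1 + (-1 : ℂ) • X.rangeProj s q k := by
    ext1 x
    change x - X.rangeProj s q k x = x + (-1 : ℂ) • X.rangeProj s q k x
    rw [neg_smul, one_smul, sub_eq_add_neg]
  rw [h]
  exact EntriesMem.add (one_mem (blockAlgebra (Fin 3) X.algebra)) ((entriesMem_rangeProj k).smul _)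

open SubspaceSystem in
theorem entriesMem_of_eq_gramMap {V : (PiLp 2 fun _ : Fin 3 => K) →L[ℂ] PiLp 2 fun _ : ν => K}
    {i : StarVertex m r}
    (hV : ∀ x, V x = gramMap θ (X.starQ s q) (fun i => (X.rangeMap θ s q e i).toLinearMap) i x) :
    EntriesMem X.algebra V := by
  rcases i with _ | i | i | i
  · have h : V = X.rangeMap θ s q e none
        + ∑ i, (Real.cos (θ i) : ℂ) • X.rangeMap θ s q e (some i) := by
      ext1 x
      rw [hV]
      simp [gramMap]
    rw [h]
    refine (entriesMem_rangeMap _).add ?_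
    exact Finset.sum_induction _ (EntriesMem X.algebra) (fun _ _ => EntriesMem.add) entriesMem_zero
      fun i _ => (entriesMem_rangeMap _).smul _
  · rw [show V = X.rangeMap θ s q e (some (.fst i)) from ContinuousLinearMap.ext hV]
    exact entriesMem_rangeMap _
  · rw [show V = X.rangeMap θ s q e (some (.fst i)) ∘L X.starQ s q i
      + X.rangeMap θ s q e (some (.snd i)) from ContinuousLinearMap.ext hV]
    exact ((entriesMem_rangeMap _).comp (entriesMem_starQ i)).add (entriesMem_rangeMap _)
  · rw [show V = X.rangeMap θ s q e (some (.leaf i)) from ContinuousLinearMap.ext hV]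
    exact entriesMem_rangeMap _

/-- Every slot is filled: the central one because the defect root is invertible, the shared one
because the fiber indicators add up to 1 and the frame is surjective, the others trivially. -/
theorem eq_top_of_rangeMap_mem (hs : 0 ≤ s) (hs1 : 12 * s < 1)
    (h : ‖X.weightedSum θ s q‖ < xi θ) {M : Submodule ℂ (PiLp 2 fun _ : ν => K)}
    (hM : ∀ i x, X.rangeMap θ s q e i x ∈ M) : M = ⊤ := by
  refine eq_top_iff.2 fun z _ => ?_
  rw [← sum_slotIncl (e := e) z]
  refine sum_mem fun κ _ => ?_
  rcases κ with _ | _ | k | j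
  · obtain ⟨y, hy⟩ := defectRoot_surjective h (WithLp.toLp 2 fun c => z (e.symm (none, c)))
    rw [← hy]
    exact hM none y
  · obtain ⟨y, hy⟩ := frame_surjective (X := X) hs hs1
      (WithLp.toLp 2 fun c => z (e.symm (some none, c)))
    have h1 : ∑ k, scalarDiag K (fiberInd q k) (X.frame s y) = X.frame s y := by
      ext j
      rw [WithLp.ofLp_sum, Finset.sum_apply, Finset.sum_eq_single (q j)]
      · rw [scalarDiag_apply, fiberInd, if_pos rfl, Complex.ofReal_one, one_smul]
      · intro k _ hk
        rw [scalarDiag_apply, fiberInd, if_neg hk.symm, Complex.ofReal_zero, zero_smul]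
      · exact fun h => absurd (Finset.mem_univ _) h
    rw [← hy, ← h1, map_sum]
    exact sum_mem fun k _ => hM (some (.snd k)) y
  · exact hM (some (.fst k)) _
  · exact hM (some (.leaf j)) _

end SelfAdjointPair

/-! ### Wildness for three or more indices in M_l -/

section Wild

open SubspaceSystem SelfAdjointPair

variable {m r : ℕ} {θ : Ray m r → ℝ}

theorem exists_injective_of_three_le_card_Ml (h : 3 ≤ (Ml θ).card) :
    ∃ q : Fin 3 → Fin m, Function.Injective q ∧ ∀ j, q j ∈ Ml θ := by
  obtain ⟨f⟩ := Function.Embedding.nonempty_of_card_le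
    (α := Fin 3) (β := Ml θ) (by rwa [Fintype.card_fin, Fintype.card_coe])
  exact ⟨fun j => f j, fun i j hij => f.injective (Subtype.ext hij), fun j => (f j).2⟩

theorem xi_le_one : xi θ ≤ 1 := by
  unfold xi
  have h1 : 0 ≤ ∑ k, tauSq θ k := Finset.sum_nonneg fun k _ => ProjDatum.tauSq_nonneg θ k
  have h2 : 0 ≤ ∑ j : Fin r, Real.cos (θ (.leaf j)) ^ 2 := Finset.sum_nonneg fun _ _ => sq_nonneg _
  linarith

theorem exists_norm_weightedSum_lt {q : Fin 3 → Fin m} (hq : ∀ j, q j ∈ Ml θ) :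
    ∃ s : ℝ, 0 < s ∧ 12 * s < 1 ∧ ∀ (K : Type u) [NormedAddCommGroup K] [InnerProductSpace ℂ K]
      [CompleteSpace K] (X : SelfAdjointPair K), ‖X.weightedSum θ s q‖ < xi θ := by
  obtain ⟨j₀, hj₀⟩ := Finite.exists_max fun j => tauSq θ (q j)
  have h1 := ProjDatum.mem_Ml.1 (hq j₀)
  have h2 := ProjDatum.tauSq_nonneg θ (q j₀)
  have h3 := xi_le_one (θ := θ)
  -- Let μ be the largest of the three weights. Then 12s = (ξ - μ)/2 is less than 1, and μ(1 + 12s)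
  -- = μ + μ(ξ - μ)/2 < ξ because μ < ξ ≤ 1.
  have hs : 0 < (xi θ - tauSq θ (q j₀)) / 24 := by linarith
  refine ⟨(xi θ - tauSq θ (q j₀)) / 24, hs, by linarith, fun K _ _ _ X => ?_⟩
  refine (norm_weightedSum_le hs.le hj₀).trans_lt ?_
  nlinarith

theorem SelfAdjointPair.exists_isGramFamily (hpair : ∀ k : Fin m, θ (.fst k) = θ (.snd k))
    {K : Type*} [NormedAddCommGroup K] [InnerProductSpace ℂ K] [CompleteSpace K]
    {q : Fin 3 → Fin m} (hq : Function.Injective q) {s : ℝ} (hs : 0 ≤ s) (hs1 : 12 * s < 1)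
    {ν : Type*} [Fintype ν] [DecidableEq ν] (e : ν ≃ Option (Option (Fin m ⊕ Fin r)) × Fin 3)
    (X : SelfAdjointPair K) (h : ‖X.weightedSum θ s q‖ < xi θ) :
    ∃ (S : SubspaceSystem (StarVertex m r) (PiLp 2 fun _ : ν => K))
      (V : StarVertex m r → (PiLp 2 fun _ : Fin 3 => K) →ₗᵢ[ℂ] PiLp 2 fun _ : ν => K),
      S.IsGramFamily (gramB θ (X.starQ s q)) V ∧
      (∀ i x, V i x = gramMap θ (X.starQ s q)
        (fun i => (X.rangeMap θ s q e i).toLinearMap) i x) ∧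
      (⨆ i, S.space i).topologicalClosure = ⊤ := by
  classical
  obtain ⟨S, V, hV, hVe, hF⟩ := exists_isGramFamily_gramMap hpair
    (fun k => isStarProjection_starQ (X := X) hs hs1 hq k)
    (F := fun i => (X.rangeMap θ s q e i).toLinearMap) fun i j x y => by
      rw [ContinuousLinearMap.coe_coe, ContinuousLinearMap.coe_coe, inner_rangeMap h]
  refine ⟨S, V, hV, hVe, ?_⟩
  rw [eq_top_of_rangeMap_mem hs hs1 h hF]
  exact eq_top_iff.2 (Submodule.le_topologicalClosure _)

theorem eq_blockDiag_iff {K K' : Type*} [NormedAddCommGroup K] [InnerProductSpace ℂ K]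
    [NormedAddCommGroup K'] [InnerProductSpace ℂ K'] {α : Type*} [Fintype α] [DecidableEq α]
    {D : (PiLp 2 fun _ : α => K) →L[ℂ] PiLp 2 fun _ : α => K'} {C : K →L[ℂ] K'} :
    D = blockDiag (fun _ => C) ↔ ∀ x a, D x a = C (x a) := by
  refine ⟨fun h x a => by rw [h, blockDiag_apply], fun h => ?_⟩
  ext x a
  rw [h, blockDiag_apply]

/-- If `M_l` has at least three elements the problem is `*`-wild. -/
theorem isStarWild_of_three_le_card_Ml (hτ : ∀ i, Real.cos (θ i) ≠ 0)
    (hpair : ∀ k : Fin m, θ (.fst k) = θ (.snd k)) (h3 : 3 ≤ (Ml θ).card) :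
    IsStarWild.{u} (AngComOrt θ) := by
  obtain ⟨q, hq, hqM⟩ := exists_injective_of_three_le_card_Ml h3
  obtain ⟨s, hs, hs1, hlt⟩ := exists_norm_weightedSum_lt.{u} hqM
  -- There are m + r + 2 slots K³: the defect, the shared slot of the second vertices, and one for
  -- each first vertex and each leaf. The number n is independent of K and of the pair.
  let n := Fintype.card (Option (Option (Fin m ⊕ Fin r)) × Fin 3)
  let e : Fin n ≃ Option (Option (Fin m ⊕ Fin r)) × Fin 3 := (Fintype.equivFin _).symm
  have key := fun (K : Type u) [NormedAddCommGroup K] [InnerProductSpace ℂ K] [CompleteSpace K]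
    (X : SelfAdjointPair K) => X.exists_isGramFamily hpair hq hs.le hs1 e (hlt K X)
  refine ⟨n, Fintype.card_pos, fun K _ _ _ X => (key K X).choose, ?_, ?_⟩
  · intro K _ _ _ X
    obtain ⟨V, hV, hVe, -⟩ := (key K X).choose_spec
    refine ⟨hV.angComOrt (fun k => isStarProjection_starQ hs.le hs1 hq k), fun i => ?_⟩
    -- P_i = V_i V_i^*, so it suffices that the entries of V_i lie in the algebra generated by the
    -- pair.
    have hp : ∀ z, (key K X).choose.proj i z
        = ((V i).toContinuousLinearMap ∘L (V i).toContinuousLinearMap.adjoint) z := hV.proj_eq i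
    have hE : EntriesMem X.algebra (V i).toContinuousLinearMap := entriesMem_of_eq_gramMap (hVe i)
    refine ⟨entry ((V i).toContinuousLinearMap ∘L (V i).toContinuousLinearMap.adjoint),
      hE.comp hE.adjoint, fun x a => ?_⟩
    rw [hp, apply_eq_sum_entry]
  · intro K K' _ _ _ _ _ _ X X' D
    obtain ⟨V, hV, hVe, hd⟩ := (key K X).choose_spec
    obtain ⟨V', hV', hVe', -⟩ := (key K' X').choose_spec
    have hdiag : ∀ C : K →L[ℂ] K', C ∘L X.A = X'.A ∘L C → C ∘L X.B = X'.B ∘L C →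
        ∀ i x, blockDiag (fun _ => C) (V i x) = V' i (blockDiag (fun _ => C) x) :=
      fun C hA hB i x => by
        rw [hVe, hVe']
        exact map_gramMap (blockDiag_rangeMap hA hB) (blockDiag_starQ hA hB) i x
    constructor
    · intro hD
      obtain ⟨C₀, hC₀, hC₀Q⟩ := hV.exists_intertwiner hV' hτ D
        fun i x => congrArg (fun T => T x) (hD i)
      -- The intertwiner C₀ of the Q_k, tested at the three chosen indices, intertwines the
      -- projections onto the columns of the frames, so it is diagonal with one repeated entry C.
      obtain ⟨C, hA, hB, rfl⟩ := exists_eq_blockDiag hs hs1 (D := C₀) (X := X) (X' := X')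
        fun j z => by
          have h1 := hC₀Q (q j) z
          have h2 : C₀ (z - X.rangeProj s q (q j) z)
              = C₀ z - X'.rangeProj s q (q j) (C₀ z) := h1
          rw [map_sub, sub_right_inj, rangeProj_apply, rangeProj_apply,
            scalarDiag_fiberInd_self hq, scalarDiag_fiberInd_self hq] at h2
          exact h2
      refine ⟨C, hA, hB, eq_blockDiag_iff.1 (hV.ext_of_dense hd fun i x => ?_)⟩
      rw [hC₀, hdiag C hA hB]
    · rintro ⟨C, hA, hB, hC⟩ i
      obtain rfl := eq_blockDiag_iff.2 hC
      refine hV.comp_proj_eq hd hV' (hdiag C hA hB) (fun i j x => ?_) i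
      exact (gramB_conj _ _ (blockDiag fun _ => C)
        (fun k x => (blockDiag_starQ hA hB k x).symm) i j x).symm

end Wild

/-! ### Collecting the cases -/

theorem mainTheorem1 (m r : ℕ) (θ : Ray m r → ℝ)
    (hθ : ∀ i, θ i ∈ Set.Ioo 0 (Real.pi / 2))
    (hpair : ∀ k : Fin m, θ (.fst k) = θ (.snd k)) :
    -- `ξ(τ) < 0`: no nonzero systems
    (xi θ < 0 →
      ∀ (H : Type u) [NormedAddCommGroup H] [InnerProductSpace ℂ H] [CompleteSpace H]
        (S : SubspaceSystem (StarVertex m r) H), AngComOrt θ H S → ¬ S.IsNonzero) ∧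
    -- `ξ(τ) = 0`: one system
    (xi θ = 0 →
      ∃ model, IsClassification.{u} θ (I := Unit) (fun _ => (m + r, 1)) model) ∧
    -- `ξ(τ) > 0`, `M_l = ∅`
    (0 < xi θ → Ml θ = ∅ →
      ∃ model, IsClassification.{u} θ (I := Fin ((Me θ).card + 1))
        (fun _ => (m + r + 1, 1)) model) ∧
    -- `ξ(τ) > 0`, `|M_l| = 1`
    (0 < xi θ → (Ml θ).card = 1 →
      ∃ model, IsClassification.{u} θ (I := Fin ((Me θ).card + 1) ⊕ Unit)
        (Sum.elim (fun _ => (m + r + 1, 1)) (fun _ => (m + r + 2, 1))) model) ∧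
    -- `ξ(τ) > 0`, `|M_l| = 2`, the sum over `M_l` is greater than `ξ(τ)`
    (0 < xi θ → (Ml θ).card = 2 → xi θ < ∑ k ∈ Ml θ, tauSq θ k →
      phi θ ∈ Set.Ioo 0 (Real.pi / 2) ∧
      ∃ model, IsClassification.{u} θ
        (I := Fin ((Me θ).card + 1) ⊕ Fin 2 ⊕ Set.Ioo (phi θ) (Real.pi / 2) ⊕ Unit)
        (Sum.elim (fun _ => (m + r + 1, 1)) <| Sum.elim (fun _ => (m + r + 2, 1)) <|
          Sum.elim (fun _ => (2 * m + 2 * r + 4, 2)) (fun _ => (2 * m + 2 * r + 3, 2))) model ∧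
        (∀ φ, CorrespondsToAngle θ (model (.inr (.inr (.inl φ)))) φ) ∧
        CorrespondsToAngle θ (model (.inr (.inr (.inr ())))) (phi θ)) ∧
    -- `ξ(τ) > 0`, `|M_l| = 2`, the sum over `M_l` is equal to `ξ(τ)`
    (0 < xi θ → (Ml θ).card = 2 → ∑ k ∈ Ml θ, tauSq θ k = xi θ →
      ∃ model, IsClassification.{u} θ
        (I := Fin ((Me θ).card + 1) ⊕ Fin 3 ⊕ Set.Ioo (0 : ℝ) (Real.pi / 2))
        (Sum.elim (fun _ => (m + r + 1, 1)) <| Sum.elim (fun _ => (m + r + 2, 1)) <|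
          (fun _ => (2 * m + 2 * r + 4, 2))) model ∧
        ∀ φ, CorrespondsToAngle θ (model (.inr (.inr φ))) φ) ∧
    -- `ξ(τ) > 0`, `|M_l| = 2`, the sum over `M_l` is less than `ξ(τ)`
    (0 < xi θ → (Ml θ).card = 2 → ∑ k ∈ Ml θ, tauSq θ k < xi θ →
      ∃ model, IsClassification.{u} θ
        (I := Fin ((Me θ).card + 1) ⊕ Fin 2 ⊕ Unit ⊕ Set.Ioo (0 : ℝ) (Real.pi / 2))
        (Sum.elim (fun _ => (m + r + 1, 1)) <| Sum.elim (fun _ => (m + r + 2, 1)) <|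
          Sum.elim (fun _ => (m + r + 3, 1)) (fun _ => (2 * m + 2 * r + 4, 2))) model ∧
        ∀ φ, CorrespondsToAngle θ (model (.inr (.inr (.inr φ)))) φ) ∧
    -- `|M_l| ≥ 3`: the problem is `*`-wild
    (3 ≤ (Ml θ).card → IsStarWild.{u} (AngComOrt θ)) := by
  have hτ : ∀ i, Real.cos (θ i) ≠ 0 := fun i => (Real.cos_pos_of_mem_Ioo
    ⟨by linarith [(hθ i).1, Real.pi_pos], (hθ i).2⟩).ne'
  exact ⟨fun hξ _ _ _ _ _ hS => hS.not_isNonzero hτ hpair hξ,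
    exists_isClassification_of_xi_eq_zero hτ hpair,
    exists_isClassification_of_Ml_eq_empty hτ hpair,
    exists_isClassification_of_card_Ml_eq_one hτ hpair,
    exists_isClassification_of_lt_sum hτ hpair,
    exists_isClassification_of_sum_eq hτ hpair,
    exists_isClassification_of_sum_lt hτ hpair,
    isStarWild_of_three_le_card_Ml hτ hpair⟩
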